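/- Let $(R,\mathfrak m)$ be a Noetherian local ring of Krull dimension $d$ that is equidimensional (that is, $\dim R/P=\dim R$ for every minimal prime $P$ of $R$) and unmixed (that is, every associated prime of $R$ is a minimal prime of $R$). Let $\omega_R$ be a canonical module of $R$, that is, a finitely generated $R$-module with $\operatorname{Hom}_R(\omega_R,E)\cong H^d_{\mathfrak m}(R)$, where $E$ is the injective hull of the residue field $R/\mathfrak m$ and $H^d_{\mathfrak m}$ denotes local cohomology with support in $\mathfrak m$. Then the following are equivalent: 1. there exists an ideal $I$ of $R$ with $I\cong\omega_R$ as $R$-modules; 2. $R$ is generically Gorenstein, that is, the local ring $R_P$ is Gorenstein (has finite injective dimension as a module over itself) for every minimal prime $P$ of $R$. Moreover, when these equivalent conditions hold, every ideal $I$ of $R$ with $I\cong\omega_R$ contains a nonzerodivisor of $R$. -/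

import Mathlib

open CategoryTheory

universe u v

/-- `R` is equidimensional: `dim R/P = dim R` for every minimal prime `P` of `R`. -/
def IsEquidimensionalRing (R : Type u) [CommRing R] : Prop :=
  ∀ P ∈ minimalPrimes R, ringKrullDim (R ⧸ P) = ringKrullDim R

/-- `R` is unmixed: it has no embedded primes, that is, every associated prime of `R` is a
minimal prime of `R`. -/
def IsUnmixedRing (R : Type u) [CommRing R] : Prop :=
  ∀ P ∈ associatedPrimes R R, P ∈ minimalPrimes R

/-- `f : M → E` is an injective hull of `M`: `E` is an injective module, `f` is a monomorphism,
and `E` is an essential extension of the image of `f`. -/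
structure IsInjectiveHull {R : Type u} [CommRing R] {M : Type u} [AddCommGroup M] [Module R M]
    {E : Type u} [AddCommGroup E] [Module R E] (f : M →ₗ[R] E) : Prop where
  isInjective : Module.Injective R E
  mono : Function.Injective f
  essential : ∀ N : Submodule R E, N ⊓ LinearMap.range f = ⊥ → N = ⊥

/-- `ω` is a canonical module of the (Noetherian) local ring `(R, 𝔪)` of dimension `d`: it is
finitely generated, and its Matlis dual `Hom_R(ω, E)`, where `E` is the injective hull of the
residue field `R/𝔪`, is isomorphic to the top local cohomology module `H^d_𝔪(R)`. -/
def IsCanonicalModule (R : Type u) [CommRing R] [IsLocalRing R]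
    (ω : Type v) [AddCommGroup ω] [Module R ω] : Prop :=
  Module.Finite R ω ∧
    ∃ (d : ℕ) (E : ModuleCat.{u} R) (f : IsLocalRing.ResidueField R →ₗ[R] E),
      ringKrullDim R = (d : WithBot ℕ∞) ∧ IsInjectiveHull f ∧
      Nonempty ((ω →ₗ[R] E) ≃ₗ[R]
        ((localCohomology (IsLocalRing.maximalIdeal R) d).obj (ModuleCat.of R R) :
          ModuleCat.{u} R))

/-- `R` is a Gorenstein local ring: a Noetherian local ring that has finite injective dimension
as a module over itself. -/
def IsGorensteinLocalRing (R : Type u) [CommRing R] : Prop :=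
  IsNoetherianRing R ∧ IsLocalRing R ∧ ∃ n : ℕ, HasInjectiveDimensionLE (ModuleCat.of R R) n

/-- `R` is generically Gorenstein: `R_P` is Gorenstein for every minimal prime `P` of `R`. -/
def IsGenericallyGorenstein (R : Type u) [CommRing R] : Prop :=
  ∀ (P : Ideal R) [P.IsPrime], P ∈ minimalPrimes R →
    IsGorensteinLocalRing (Localization.AtPrime P)

/-! The aim is to control ω at the minimal primes without completing R and without knowing that
canonical modules localize. The tool is multiplicity. Let l be a system of parameters, d its length,
χ(M) the Euler characteristic of Koszul cohomology of l on M, and e(M) = (-1)^d χ(M). On finitely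
generated modules e is additive and nonnegative, e(R/P) > 0 when dim R/P = d, and e(R/Q) = 0 for a
nonminimal prime Q. Hence e(M) is the sum of length(M_P) e(R/P) over the minimal primes P
(`koszulMult_eq_sum`).

The number e(M) can be read off top local cohomology: χ(H^d_m(M)) = e(M) (`LocCoh.koszulChar_eq`).
Matlis duality exchanges kernel and cokernel of each parameter, so it multiplies χ by (-1)^d; thus
Hom(W,E) ≅ H^d_m(M) gives e(W) = e(M). Since H^d_m is right exact, the isomorphism defining ω yields
Hom(0:_ω J, E) ≅ H^d_m(R/J) for every ideal J, whence e(0:_ω J) = e(R/J).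

For J = P minimal, 0:_ω P is supported at no other minimal prime, so its length at P is one. Hence
ω_P has socle of length at most one and length ω_P ≤ length R_P. As e(ω) = e(R) and every e(R/P) is
positive by equidimensionality, these are equalities. For J = Q a nonminimal prime, H^d_m(R/Q) = 0,
so 0:_ω Q = 0 and Q is not associated to ω. These facts form `IsGenericallyCanonical`.

If I ≅ ω, then I_P ⊆ R_P have equal length, so I_P = R_P. Thus I lies in no minimal prime, and
unmixedness with prime avoidance gives a nonzerodivisor in I; moreover the socle bound and a length
count make R_P self-injective. Conversely, an Artinian local ring of finite injective dimension is
self-injective, so an embedding of the socle extends to an embedding ω_P → R_P, an isomorphism by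
lengths. These maps lift to ω → R up to denominators and combine into one map that is an isomorphism
at every minimal prime; its kernel is zero because the associated primes of ω are minimal. -/

set_option linter.unusedSectionVars false

/-! ### Long exact sequence of `Ext` in the second variable -/

open Limits in
-- Functors forming a short exact sequence on projectives give a short exact sequence of complexes
-- on a projective resolution. The map `δ` is its homology connecting map, natural because morphisms
-- lift to resolutions.
theorem CategoryTheory.NatTrans.exists_leftDerived_connecting
    {C : Type*} [Category* C] [Abelian C] [HasProjectiveResolutions C]
    {D : Type*} [Category* D] [Abelian D] {F G H : C ⥤ D} [F.Additive] [G.Additive] [H.Additive]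
    (α : F ⟶ G) (β : G ⟶ H) (w : ∀ X, α.app X ≫ β.app X = 0)
    (hS : ∀ X, Projective X → (ShortComplex.mk (α.app X) (β.app X) (w X)).ShortExact) (n : ℕ) :
    ∃ δ : H.leftDerived (n + 1) ⟶ F.leftDerived n, ∀ X,
      (∃ w₁, (ShortComplex.mk ((NatTrans.leftDerived β (n + 1)).app X) (δ.app X) w₁).Exact) ∧
      (∃ w₂, (ShortComplex.mk (δ.app X) ((NatTrans.leftDerived α n).app X) w₂).Exact) := by
  let P : ∀ X : C, ProjectiveResolution X := fun X => projectiveResolution X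
  obtain ⟨d, hnat, hd⟩ : ∃ d : ∀ X : C,
      (HomologicalComplex.homologyFunctor D (ComplexShape.down ℕ) (n + 1)).obj
        ((H.mapHomologicalComplex _).obj (P X).complex) ⟶
      (HomologicalComplex.homologyFunctor D (ComplexShape.down ℕ) n).obj
        ((F.mapHomologicalComplex _).obj (P X).complex),
      (∀ X Y (φ : (P X).complex ⟶ (P Y).complex),
        (H.mapHomologicalComplex _ ⋙ HomologicalComplex.homologyFunctor D _ (n + 1)).map φ ≫ d Y =
          d X ≫ (F.mapHomologicalComplex _ ⋙ HomologicalComplex.homologyFunctor D _ n).map φ) ∧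
      ∀ X, (∃ w₁, (ShortComplex.mk ((HomologicalComplex.homologyFunctor D _ (n + 1)).map
          ((NatTrans.mapHomologicalComplex β _).app (P X).complex)) (d X) w₁).Exact) ∧
        (∃ w₂, (ShortComplex.mk (d X) ((HomologicalComplex.homologyFunctor D _ n).map
          ((NatTrans.mapHomologicalComplex α _).app (P X).complex)) w₂).Exact) := by
    let S : ∀ X, ShortComplex (ChainComplex D ℕ) := fun X =>
      ShortComplex.mk ((NatTrans.mapHomologicalComplex α (ComplexShape.down ℕ)).app (P X).complex)
        ((NatTrans.mapHomologicalComplex β (ComplexShape.down ℕ)).app (P X).complex)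
        (by ext i; exact w _)
    have hSX : ∀ X, (S X).ShortExact := fun X =>
      HomologicalComplex.shortExact_of_degreewise_shortExact (S X) fun i =>
        hS _ ((P X).projective i)
    have rel : (ComplexShape.down ℕ).Rel (n + 1) n := by simp
    refine ⟨fun X => (hSX X).δ (n + 1) n rel, fun X Y φ => ?_, fun X =>
      ⟨⟨(hSX X).comp_δ (n + 1) n rel, (hSX X).homology_exact₃ (n + 1) n rel⟩,
        ⟨(hSX X).δ_comp (n + 1) n rel, (hSX X).homology_exact₁ (n + 1) n rel⟩⟩⟩
    let ψ : S X ⟶ S Y :=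
      { τ₁ := (F.mapHomologicalComplex _).map φ
        τ₂ := (G.mapHomologicalComplex _).map φ
        τ₃ := (H.mapHomologicalComplex _).map φ
        comm₁₂ := (NatTrans.mapHomologicalComplex α _).naturality φ
        comm₂₃ := (NatTrans.mapHomologicalComplex β _).naturality φ }
    exact (HomologicalComplex.HomologySequence.δ_naturality ψ (hSX X) (hSX Y) (n + 1) n rel).symm
  refine ⟨{ app := fun X => ((P X).isoLeftDerivedObj H (n + 1)).hom ≫
              d X ≫ ((P X).isoLeftDerivedObj F n).inv
            naturality := ?_ }, fun X => ⟨?_, ?_⟩⟩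
  · intro X Y f
    let φ := ProjectiveResolution.lift f (P X) (P Y)
    have comm : φ.f 0 ≫ (P Y).π.f 0 = (P X).π.f 0 ≫ f :=
      ProjectiveResolution.lift_commutes_zero f (P X) (P Y)
    rw [ProjectiveResolution.isoLeftDerivedObj_hom_naturality_assoc f (P X) (P Y) φ comm,
      Category.assoc, Category.assoc,
      ProjectiveResolution.isoLeftDerivedObj_inv_naturality f (P X) (P Y) φ comm,
      reassoc_of% (hnat X Y φ)]
    rfl
  · obtain ⟨w₁, ex⟩ := (hd X).1
    refine ⟨?_, ShortComplex.exact_of_iso (ShortComplex.isoMk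
      ((P X).isoLeftDerivedObj G (n + 1)).symm ((P X).isoLeftDerivedObj H (n + 1)).symm
      ((P X).isoLeftDerivedObj F n).symm ?_ ?_) ex⟩
    · rw [(P X).leftDerived_app_eq β]
      simp only [Category.assoc, Iso.inv_hom_id_assoc, reassoc_of% w₁, comp_zero, zero_comp]
    · change ((P X).isoLeftDerivedObj G (n + 1)).inv ≫ (NatTrans.leftDerived β (n + 1)).app X =
        _ ≫ ((P X).isoLeftDerivedObj H (n + 1)).inv
      rw [(P X).leftDerived_app_eq β, Iso.inv_hom_id_assoc]
    · simp
  · obtain ⟨w₂, ex⟩ := (hd X).2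
    refine ⟨?_, ShortComplex.exact_of_iso (ShortComplex.isoMk
      ((P X).isoLeftDerivedObj H (n + 1)).symm ((P X).isoLeftDerivedObj F n).symm
      ((P X).isoLeftDerivedObj G n).symm ?_ ?_) ex⟩
    · rw [(P X).leftDerived_app_eq α]
      simp only [Category.assoc, Iso.inv_hom_id_assoc, reassoc_of% w₂, comp_zero, zero_comp]
    · simp
    · change ((P X).isoLeftDerivedObj F n).inv ≫ (NatTrans.leftDerived α n).app X =
        _ ≫ ((P X).isoLeftDerivedObj G n).inv
      rw [(P X).leftDerived_app_eq α, Iso.inv_hom_id_assoc]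

open Limits in
theorem CategoryTheory.NatTrans.leftDerived_exact_middle
    {C : Type*} [Category* C] [Abelian C] [HasProjectiveResolutions C]
    {D : Type*} [Category* D] [Abelian D] {F G H : C ⥤ D} [F.Additive] [G.Additive] [H.Additive]
    (α : F ⟶ G) (β : G ⟶ H) (w : ∀ X, α.app X ≫ β.app X = 0)
    (hS : ∀ X, Projective X → (ShortComplex.mk (α.app X) (β.app X) (w X)).ShortExact) (n : ℕ)
    (X : C) : ∃ w', (ShortComplex.mk ((NatTrans.leftDerived α n).app X)
      ((NatTrans.leftDerived β n).app X) w').Exact := by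
  let P : ProjectiveResolution X := projectiveResolution X
  let S : ShortComplex (ChainComplex D ℕ) :=
    ShortComplex.mk ((NatTrans.mapHomologicalComplex α (ComplexShape.down ℕ)).app P.complex)
      ((NatTrans.mapHomologicalComplex β (ComplexShape.down ℕ)).app P.complex)
      (by ext i; exact w _)
  have hSX : S.ShortExact :=
    HomologicalComplex.shortExact_of_degreewise_shortExact S fun i =>
      hS _ (P.projective i)
  have ex := hSX.homology_exact₂ n
  refine ⟨?_, ?_⟩
  · rw [P.leftDerived_app_eq α, P.leftDerived_app_eq β]
    simp only [Category.assoc, Iso.inv_hom_id_assoc]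
    have h0 : (HomologicalComplex.homologyFunctor D (ComplexShape.down ℕ) n).map
        ((NatTrans.mapHomologicalComplex α (ComplexShape.down ℕ)).app P.complex) ≫
        (HomologicalComplex.homologyFunctor D (ComplexShape.down ℕ) n).map
        ((NatTrans.mapHomologicalComplex β (ComplexShape.down ℕ)).app P.complex) = 0 := by
      rw [← Functor.map_comp, S.zero, Functor.map_zero]
    rw [reassoc_of% h0, zero_comp, comp_zero]
  · refine ShortComplex.exact_of_iso ?_ ex
    refine ShortComplex.isoMk (P.isoLeftDerivedObj F n).symm
      (P.isoLeftDerivedObj G n).symm (P.isoLeftDerivedObj H n).symm ?_ ?_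
    · dsimp only [Iso.symm_hom]
      rw [P.leftDerived_app_eq α]
      exact Iso.inv_hom_id_assoc _ _
    · dsimp only [Iso.symm_hom]
      rw [P.leftDerived_app_eq β]
      exact Iso.inv_hom_id_assoc _ _

theorem CategoryTheory.ShortComplex.comp_f_comp_g {C : Type*} [Category* C]
    [Limits.HasZeroMorphisms C] (S : ShortComplex C) {X : C} (φ : X ⟶ S.X₁) :
    (φ ≫ S.f) ≫ S.g = 0 := by
  rw [Category.assoc, S.zero, Limits.comp_zero]

-- `Hom(X, -)` is exact for projective `X`. `Ext` is a left derived functor with values in the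
-- opposite category, which reverses the sequence, so `S.g` comes first.
open Opposite in
theorem ModuleCat.shortExact_linearYoneda_op {R : Type u} [CommRing R]
    {S : ShortComplex (ModuleCat.{u} R)} (hS : S.ShortExact) (X : ModuleCat.{u} R) [Projective X]
    (w) : (ShortComplex.mk ((NatTrans.rightOp ((linearYoneda R (ModuleCat.{u} R)).map S.g)).app X)
      ((NatTrans.rightOp ((linearYoneda R (ModuleCat.{u} R)).map S.f)).app X) w).ShortExact := by
  let T : ShortComplex (ModuleCat.{u} R) :=
    ShortComplex.mk (((linearYoneda R (ModuleCat.{u} R)).map S.f).app (op X))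
      (((linearYoneda R (ModuleCat.{u} R)).map S.g).app (op X)) (Quiver.Hom.op_inj w)
  have hT : T.ShortExact := by
    have := hS.mono_f
    have := hS.epi_g
    refine ModuleCat.shortComplex_shortExact T ?_ ?_ ?_
    · intro φ
      constructor
      · intro h
        exact ⟨hS.exact.lift φ h, hS.exact.lift_f φ h⟩
      · rintro ⟨ψ, rfl⟩
        exact S.comp_f_comp_g ψ
    · intro a b h
      exact (cancel_mono S.f).1 h
    · intro φ
      exact ⟨Projective.factorThru φ S.g, Projective.factorThru_comp φ S.g⟩
  exact hT.op

-- Naturality of `δ` in the first variable is what later lets it pass to the colimit over powers of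
-- an ideal.
open Opposite in
theorem ModuleCat.exists_ext_connecting {R : Type u} [CommRing R]
    {S : ShortComplex (ModuleCat.{u} R)} (hS : S.ShortExact) (n : ℕ) :
    ∃ δ : (Ext R (ModuleCat.{u} R) n).flip.obj S.X₃ ⟶
        (Ext R (ModuleCat.{u} R) (n + 1)).flip.obj S.X₁, ∀ X,
      Function.Exact (((Ext R (ModuleCat.{u} R) n).obj X).map S.g) (δ.app X) ∧
      Function.Exact (δ.app X) (((Ext R (ModuleCat.{u} R) (n + 1)).obj X).map S.f) := by
  obtain ⟨δ, hδ⟩ := NatTrans.exists_leftDerived_connecting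
    (NatTrans.rightOp ((linearYoneda R (ModuleCat.{u} R)).map S.g))
    (NatTrans.rightOp ((linearYoneda R (ModuleCat.{u} R)).map S.f))
    (fun X => by
      apply Quiver.Hom.unop_inj
      refine ModuleCat.hom_ext (LinearMap.ext fun φ => ?_)
      exact S.comp_f_comp_g φ)
    (fun X _ => ModuleCat.shortExact_linearYoneda_op hS X _) n
  refine ⟨NatTrans.leftOp δ, fun X => ?_⟩
  obtain ⟨⟨w₁, h₁⟩, ⟨w₂, h₂⟩⟩ := hδ X.unop
  exact ⟨(ShortComplex.ShortExact.moduleCat_exact_iff_function_exact _).1 h₂.unop,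
    (ShortComplex.ShortExact.moduleCat_exact_iff_function_exact _).1 h₁.unop⟩

open Opposite in
theorem ModuleCat.ext_exact_middle {R : Type u} [CommRing R]
    {S : ShortComplex (ModuleCat.{u} R)} (hS : S.ShortExact) (n : ℕ) (X) :
    Function.Exact (((Ext R (ModuleCat.{u} R) n).obj X).map S.f)
      (((Ext R (ModuleCat.{u} R) n).obj X).map S.g) := by
  obtain ⟨w, h⟩ := NatTrans.leftDerived_exact_middle
    (NatTrans.rightOp ((linearYoneda R (ModuleCat.{u} R)).map S.g))
    (NatTrans.rightOp ((linearYoneda R (ModuleCat.{u} R)).map S.f))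
    (fun X => by
      apply Quiver.Hom.unop_inj
      refine ModuleCat.hom_ext (LinearMap.ext fun φ => ?_)
      exact S.comp_f_comp_g φ)
    (fun X _ => ModuleCat.shortExact_linearYoneda_op hS X _) n X.unop
  exact (ShortComplex.ShortExact.moduleCat_exact_iff_function_exact _).1 h.unop

/-! ### Scalars on `Ext`, and vanishing on injectives -/

theorem ModuleCat.comp_smul_id {R : Type u} [CommRing R] (r : R) {A B : ModuleCat.{u} R}
    (φ : A ⟶ B) : φ ≫ (r • 𝟙 B) = r • φ := by
  simp

theorem ModuleCat.smul_id_comp {R : Type u} [CommRing R] (r : R) {A B : ModuleCat.{u} R}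
    (φ : A ⟶ B) : (r • 𝟙 A) ≫ φ = r • φ := by
  simp

open Opposite in
theorem ModuleCat.smul_id_op_comm {R : Type u} [CommRing R] {A B : (ModuleCat.{u} R)ᵒᵖ}
    (f : A ⟶ B) (r : R) :
    (r • 𝟙 (unop A)).op ≫ f = f ≫ (r • 𝟙 (unop B)).op := by
  apply Quiver.Hom.unop_inj
  simp

open Opposite in
theorem ModuleCat.homologyMap_smul_id_op {R : Type u} [CommRing R]
    {K : ChainComplex (ModuleCat.{u} R)ᵒᵖ ℕ} (φ : K ⟶ K) (r : R)
    (hφ : ∀ i, φ.f i = (r • 𝟙 (unop (K.X i))).op) (n : ℕ) :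
    HomologicalComplex.homologyMap φ n = (r • 𝟙 (unop (K.homology n))).op := by
  rw [← cancel_epi (K.homologyπ n), HomologicalComplex.homologyπ_naturality,
    ← ModuleCat.smul_id_op_comm]
  congr 1
  rw [← cancel_mono (K.iCycles n), HomologicalComplex.cyclesMap_i, hφ,
    ModuleCat.smul_id_op_comm]

open Opposite in
theorem ModuleCat.ext_map_smul_id {R : Type u} [CommRing R] (X M : ModuleCat.{u} R) (n : ℕ)
    (r : R) : ((Ext R (ModuleCat.{u} R) n).obj (op X)).map (r • 𝟙 M) = r • 𝟙 _ := by
  let P : ProjectiveResolution X := CategoryTheory.projectiveResolution X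
  have h := P.leftDerived_app_eq (NatTrans.rightOp ((linearYoneda R (ModuleCat.{u} R)).map
    (r • 𝟙 M))) n
  have h2 := ModuleCat.homologyMap_smul_id_op ((NatTrans.mapHomologicalComplex
    (NatTrans.rightOp ((linearYoneda R (ModuleCat.{u} R)).map (r • 𝟙 M))) _).app P.complex) r
    (fun i => by
      apply Quiver.Hom.unop_inj
      refine ModuleCat.hom_ext (LinearMap.ext fun φ => ?_)
      exact ModuleCat.comp_smul_id r (A := P.complex.X i) (B := M) φ) n
  apply Quiver.Hom.op_inj
  refine h.trans ?_
  rw [HomologicalComplex.homologyFunctor_map, h2]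
  refine (congrArg _ (ModuleCat.smul_id_op_comm _ r)).trans ?_
  exact Iso.hom_inv_id_assoc _ _

open Opposite in
theorem ModuleCat.ext_map_op_smul_id {R : Type u} [CommRing R] (X M : ModuleCat.{u} R) (n : ℕ)
    (r : R) : ((Ext R (ModuleCat.{u} R) n).map (r • 𝟙 X).op).app M = r • 𝟙 _ := by
  let P : ProjectiveResolution X := CategoryTheory.projectiveResolution X
  have h := Functor.leftDerived_map_eq ((linearYoneda R (ModuleCat.{u} R)).obj M).rightOp n
    (r • 𝟙 X) (P := P) (Q := P) (r • 𝟙 _) (by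
      rw [Linear.smul_comp, Category.id_comp]
      ext : 1
      exact (ModuleCat.comp_smul_id r (B := X) (P.π.f 0)).symm)
  have h2 := ModuleCat.homologyMap_smul_id_op
    (((((linearYoneda R (ModuleCat.{u} R)).obj M).rightOp).mapHomologicalComplex
      (ComplexShape.down ℕ)).map (r • 𝟙 P.complex)) r
    (fun i => by
      apply Quiver.Hom.unop_inj
      refine ModuleCat.hom_ext (LinearMap.ext fun φ => ?_)
      exact ModuleCat.smul_id_comp r (A := P.complex.X i) (B := M) φ) n
  apply Quiver.Hom.op_inj
  refine h.trans ?_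
  rw [Functor.comp_map, HomologicalComplex.homologyFunctor_map, h2]
  refine (congrArg _ (ModuleCat.smul_id_op_comm _ r)).trans ?_
  exact Iso.hom_inv_id_assoc _ _

-- Multiplication by `r` on `Ext` is induced from the first argument, where it coincides with
-- multiplication by `0`.
open Opposite in
theorem ModuleCat.smul_ext_eq_zero {R : Type u} [CommRing R] {X M : ModuleCat.{u} R} {n : ℕ}
    {r : R} (hr : ∀ x : X, r • x = 0)
    (z : ((Ext R (ModuleCat.{u} R) n).obj (op X)).obj M) : r • z = 0 := by
  have h0 : r • 𝟙 X = 0 := ModuleCat.hom_ext (LinearMap.ext fun x => hr x)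
  have h1 := ModuleCat.ext_map_op_smul_id X M n r
  have h2 := ModuleCat.ext_map_op_smul_id X M n 0
  rw [zero_smul, zero_smul] at h2
  rw [h0, h2] at h1
  exact (LinearMap.congr_fun (congrArg ModuleCat.Hom.hom h1) z).symm

open Opposite Limits in
theorem ModuleCat.isZero_ext_of_injective {R : Type u} [CommRing R] (X J : ModuleCat.{u} R)
    [Injective J] (n : ℕ) : IsZero (((Ext R (ModuleCat.{u} R) (n + 1)).obj (op X)).obj J) := by
  let P : ProjectiveResolution X := CategoryTheory.projectiveResolution X
  refine IsZero.of_iso ?_ (P.isoExt (n + 1) J)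
  rw [← HomologicalComplex.exactAt_iff_isZero_homology,
    HomologicalComplex.exactAt_iff' _ n (n + 1) (n + 2) (by simp) (by simp),
    ShortComplex.ShortExact.moduleCat_exact_iff_function_exact]
  intro φ
  constructor
  · intro h
    exact ⟨(P.exact_succ n).descToInjective φ h, (P.exact_succ n).comp_descToInjective φ h⟩
  · rintro ⟨ψ, rfl⟩
    exact (Category.assoc _ _ _).symm.trans ((congrArg (· ≫ ψ) (P.complex.d_comp_d _ _ _)).trans zero_comp)

/-! ### Local cohomology as a filtered colimit of `Ext` modules -/

instance ModuleCat.forget_preservesSmallestFilteredColimits {R : Type u} [Ring R] :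
    Limits.PreservesFilteredColimitsOfSize.{0, 0} (forget (ModuleCat.{u} R)) :=
  Limits.preservesSmallestFilteredColimits_of_preservesFilteredColimits _

open Limits in
theorem ModuleCat.exact_of_isColimit {R : Type u} [CommRing R] {K : Type} [SmallCategory K]
    [IsFiltered K] {A B C : K ⥤ ModuleCat.{u} R} (α : A ⟶ B) (β : B ⟶ C)
    (h : ∀ k, Function.Exact (α.app k) (β.app k)) {cA : Cocone A} {cB : Cocone B} {cC : Cocone C}
    (hA : IsColimit cA) (hB : IsColimit cB) (hC : IsColimit cC) (a : cA.pt ⟶ cB.pt)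
    (b : cB.pt ⟶ cC.pt) (ha : ∀ k, cA.ι.app k ≫ a = α.app k ≫ cB.ι.app k)
    (hb : ∀ k, cB.ι.app k ≫ b = β.app k ≫ cC.ι.app k) : Function.Exact a b := by
  have ha' : ∀ k x, a (cA.ι.app k x) = cB.ι.app k (α.app k x) := fun k x =>
    ConcreteCategory.congr_hom (ha k) x
  have hb' : ∀ k x, b (cB.ι.app k x) = cC.ι.app k (β.app k x) := fun k x =>
    ConcreteCategory.congr_hom (hb k) x
  intro z
  constructor
  · intro hz
    obtain ⟨k, y, rfl⟩ := Concrete.isColimit_exists_rep B hB z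
    rw [hb'] at hz
    have hz' : cC.ι.app k (β.app k y) = cC.ι.app k 0 := by rw [hz, map_zero]
    obtain ⟨l, f, g, hfg⟩ := Concrete.isColimit_exists_of_rep_eq C hC _ _ hz'
    rw [map_zero] at hfg
    have h1 : β.app l (B.map f y) = 0 := by
      rw [← hfg]
      exact ConcreteCategory.congr_hom (β.naturality f) y
    obtain ⟨x, hx⟩ := (h l _).1 h1
    refine ⟨cA.ι.app l x, ?_⟩
    rw [ha', hx]
    exact ConcreteCategory.congr_hom (cB.w f) y
  · rintro ⟨x, rfl⟩
    obtain ⟨k, y, rfl⟩ := Concrete.isColimit_exists_rep A hA x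
    rw [ha', hb', (h k).apply_apply_eq_zero, map_zero]

namespace localCohomology

open Limits Opposite

variable {R : Type u} [CommRing R] (J : Ideal R)

/-- The system of modules `Ext^i(R/J^t, M)` whose colimit is the local cohomology of `M`. -/
noncomputable def system (i : ℕ) (M : ModuleCat.{u} R) : ℕᵒᵖᵒᵖ ⥤ ModuleCat.{u} R :=
  diagram (idealPowersDiagram J) i ⋙ (evaluation _ _).obj M

/-- The cocone under `localCohomology.system` with point the local cohomology of `M`. -/
noncomputable def cocone (i : ℕ) (M : ModuleCat.{u} R) : Cocone (system J i M) :=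
  ((evaluation _ _).obj M).mapCocone (colimit.cocone (diagram (idealPowersDiagram J) i))

/-- Local cohomology is the colimit of `localCohomology.system`. -/
noncomputable def isColimitCocone (i : ℕ) (M : ModuleCat.{u} R) : IsColimit (cocone J i M) :=
  isColimitOfPreserves ((evaluation _ _).obj M)
    (colimit.isColimit (diagram (idealPowersDiagram J) i))

theorem cocone_ι_map (i : ℕ) {M N : ModuleCat.{u} R} (f : M ⟶ N) (k) :
    (cocone J i M).ι.app k ≫ (localCohomology J i).map f =
      ((diagram (idealPowersDiagram J) i).obj k).map f ≫ (cocone J i N).ι.app k :=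
  ((colimit.ι (diagram (idealPowersDiagram J) i) k).naturality f).symm

/-- The transformation between the systems computing local cohomology induced by a linear map. -/
noncomputable def systemMap (i : ℕ) {M N : ModuleCat.{u} R} (f : M ⟶ N) :
    system J i M ⟶ system J i N :=
  Functor.whiskerLeft _ ((evaluation _ _).map f)

variable {J}

theorem exact_middle {S : ShortComplex (ModuleCat.{u} R)} (hS : S.ShortExact) (i : ℕ) :
    Function.Exact ((localCohomology J i).map S.f) ((localCohomology J i).map S.g) :=
  ModuleCat.exact_of_isColimit (systemMap J i S.f) (systemMap J i S.g)
    (fun _ => ModuleCat.ext_exact_middle hS i _) (isColimitCocone J i S.X₁)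
    (isColimitCocone J i S.X₂) (isColimitCocone J i S.X₃) _ _
    (fun k => cocone_ι_map J i S.f k) (fun k => cocone_ι_map J i S.g k)

theorem exists_connecting {S : ShortComplex (ModuleCat.{u} R)} (hS : S.ShortExact) (i : ℕ) :
    ∃ δ : (localCohomology J i).obj S.X₃ ⟶ (localCohomology J (i + 1)).obj S.X₁,
      Function.Exact ((localCohomology J i).map S.g) δ ∧
      Function.Exact δ ((localCohomology J (i + 1)).map S.f) := by
  obtain ⟨δ, hδ⟩ := ModuleCat.exists_ext_connecting hS i
  let t : system J i S.X₃ ⟶ system J (i + 1) S.X₁ :=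
    { app := fun k => δ.app (op ((ringModIdeals (idealPowersDiagram J)).obj k.unop))
      naturality := fun k l f => δ.naturality _ }
  let d : (cocone J i S.X₃).pt ⟶ (cocone J (i + 1) S.X₁).pt :=
    (isColimitCocone J i S.X₃).map (cocone J (i + 1) S.X₁) t
  have hd : ∀ k, (cocone J i S.X₃).ι.app k ≫ d = t.app k ≫ (cocone J (i + 1) S.X₁).ι.app k :=
    fun k => (isColimitCocone J i S.X₃).ι_map _ t k
  exact ⟨d, ModuleCat.exact_of_isColimit (systemMap J i S.g) t (fun k => (hδ _).1)
      (isColimitCocone J i S.X₂) (isColimitCocone J i S.X₃) (isColimitCocone J (i + 1) S.X₁) _ _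
      (fun k => cocone_ι_map J i S.g k) hd,
    ModuleCat.exact_of_isColimit t (systemMap J (i + 1) S.f) (fun k => (hδ _).2)
      (isColimitCocone J i S.X₃) (isColimitCocone J (i + 1) S.X₁)
      (isColimitCocone J (i + 1) S.X₂) _ _ hd (fun k => cocone_ι_map J (i + 1) S.f k)⟩

theorem map_smul_id (i : ℕ) (M : ModuleCat.{u} R) (r : R) :
    (localCohomology J i).map (r • 𝟙 M) = r • 𝟙 _ := by
  refine (isColimitCocone J i M).hom_ext fun k => ?_
  refine (cocone_ι_map J i (r • 𝟙 M) k).trans ?_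
  refine (congrArg (· ≫ _) (ModuleCat.ext_map_smul_id _ M i r)).trans ?_
  exact (ModuleCat.smul_id_comp r _).trans (ModuleCat.comp_smul_id r _).symm

/-- A class comes from some `Ext^i(R/J^k, M)`, which `J^k` annihilates. -/
theorem exists_pow_smul_eq_zero {i : ℕ} {M : ModuleCat.{u} R}
    (z : (localCohomology J i).obj M) : ∃ n : ℕ, ∀ r ∈ J ^ n, r • z = 0 := by
  obtain ⟨k, y, hy⟩ := Concrete.isColimit_exists_rep _ (isColimitCocone J i M) z
  refine ⟨k.unop.unop, fun r hr => ?_⟩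
  have h0 : r • y = 0 := ModuleCat.smul_ext_eq_zero (fun x => by
    obtain ⟨x, rfl⟩ := Submodule.Quotient.mk_surjective _ x
    exact (Submodule.Quotient.mk_eq_zero (J ^ k.unop.unop)).2 (Ideal.mul_mem_right x _ hr)) y
  rw [← hy]
  exact ((map_smul ((cocone J i M).ι.app k).hom r y).symm.trans (congrArg _ h0)).trans (map_zero _)

theorem subsingleton_of_injective (i : ℕ) (M : ModuleCat.{u} R) [Injective M] :
    Subsingleton ((localCohomology J (i + 1)).obj M) := by
  refine subsingleton_of_forall_eq 0 fun z => ?_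
  obtain ⟨k, y, rfl⟩ := Concrete.isColimit_exists_rep _ (isColimitCocone J (i + 1) M) z
  have : Subsingleton ((system J (i + 1) M).obj k) :=
    ModuleCat.subsingleton_of_isZero (ModuleCat.isZero_ext_of_injective _ M i)
  exact (congrArg _ (Subsingleton.elim y 0)).trans (map_zero ((cocone J (i + 1) M).ι.app k).hom)

end localCohomology

/-! ### Degree zero: `Ext^0`, `Hom` and power torsion -/

theorem CategoryTheory.NatTrans.leftDerived_zero_comp_fromLeftDerivedZero
    {C : Type*} [Category* C] [Abelian C] [HasProjectiveResolutions C]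
    {D : Type*} [Category* D] [Abelian D] {F G : C ⥤ D} [F.Additive] [G.Additive]
    (α : F ⟶ G) (X : C) :
    (NatTrans.leftDerived α 0).app X ≫ G.fromLeftDerivedZero.app X =
      F.fromLeftDerivedZero.app X ≫ α.app X := by
  let P : ProjectiveResolution X := CategoryTheory.projectiveResolution X
  have h : HomologicalComplex.opcyclesMap ((NatTrans.mapHomologicalComplex α _).app P.complex) 0 ≫
      P.fromLeftDerivedZero' G = P.fromLeftDerivedZero' F ≫ α.app X := by
    rw [← cancel_epi (HomologicalComplex.pOpcycles _ _)]
    rw [HomologicalComplex.p_opcyclesMap_assoc,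
      ProjectiveResolution.pOpcycles_comp_fromLeftDerivedZero',
      ProjectiveResolution.pOpcycles_comp_fromLeftDerivedZero'_assoc]
    exact (α.naturality (P.π.f 0)).symm
  rw [P.leftDerived_app_eq α, P.fromLeftDerivedZero_eq, P.fromLeftDerivedZero_eq]
  simp only [Category.assoc, Iso.inv_hom_id_assoc]
  refine congrArg (_ ≫ ·) ?_
  refine (HomologicalComplex.homologyι_naturality_assoc
    ((NatTrans.mapHomologicalComplex α _).app P.complex) 0 _).trans ?_
  exact (congrArg (_ ≫ ·) h).trans (Category.assoc _ _ _).symm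

namespace ModuleCat

open Opposite Limits

variable {R : Type u} [CommRing R]

instance preservesFiniteLimits_linearYoneda (M : ModuleCat.{u} R) :
    PreservesFiniteLimits ((linearYoneda R (ModuleCat.{u} R)).obj M) := by
  have : PreservesFiniteLimits
      ((linearYoneda R (ModuleCat.{u} R)).obj M ⋙ forget (ModuleCat.{u} R)) :=
    inferInstanceAs (PreservesFiniteLimits (yoneda.obj M))
  exact preservesFiniteLimits_of_reflects_of_preserves _ (forget (ModuleCat.{u} R))

instance preservesFiniteColimits_linearYoneda_rightOp (M : ModuleCat.{u} R) :
    PreservesFiniteColimits ((linearYoneda R (ModuleCat.{u} R)).obj M).rightOp :=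
  preservesFiniteColimits_rightOp _

/-- The canonical isomorphism from `Ext^0` to homomorphisms. -/
noncomputable def extZeroIso (X M : ModuleCat.{u} R) :
    ((Ext R (ModuleCat.{u} R) 0).obj (op X)).obj M ≅
      ((linearYoneda R (ModuleCat.{u} R)).obj M).obj (op X) :=
  ((((linearYoneda R (ModuleCat.{u} R)).obj M).rightOp.leftDerivedZeroIsoSelf).app X).unop.symm

theorem extZeroIso_inv_naturality_right (X : ModuleCat.{u} R) {M N : ModuleCat.{u} R}
    (f : M ⟶ N) : (extZeroIso X M).inv ≫ ((Ext R (ModuleCat.{u} R) 0).obj (op X)).map f =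
      ((linearYoneda R (ModuleCat.{u} R)).map f).app (op X) ≫ (extZeroIso X N).inv :=
  Quiver.Hom.op_inj (NatTrans.leftDerived_zero_comp_fromLeftDerivedZero
    (NatTrans.rightOp ((linearYoneda R (ModuleCat.{u} R)).map f)) X)

theorem extZeroIso_inv_naturality_left {X Y : ModuleCat.{u} R} (g : X ⟶ Y) (M : ModuleCat.{u} R) :
    (extZeroIso Y M).inv ≫ ((Ext R (ModuleCat.{u} R) 0).map g.op).app M =
      ((linearYoneda R (ModuleCat.{u} R)).obj M).map g.op ≫ (extZeroIso X M).inv :=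
  Quiver.Hom.op_inj
    (((linearYoneda R (ModuleCat.{u} R)).obj M).rightOp.fromLeftDerivedZero.naturality g)

theorem extZeroIso_hom_naturality_right (X : ModuleCat.{u} R) {M N : ModuleCat.{u} R}
    (f : M ⟶ N) : ((Ext R (ModuleCat.{u} R) 0).obj (op X)).map f ≫ (extZeroIso X N).hom =
      (extZeroIso X M).hom ≫ ((linearYoneda R (ModuleCat.{u} R)).map f).app (op X) := by
  rw [← cancel_epi (extZeroIso X M).inv, ← Category.assoc, extZeroIso_inv_naturality_right,
    Category.assoc, Iso.inv_hom_id, Iso.inv_hom_id_assoc, Category.comp_id]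

theorem extZeroIso_hom_naturality_left {X Y : ModuleCat.{u} R} (g : X ⟶ Y) (M : ModuleCat.{u} R) :
    ((Ext R (ModuleCat.{u} R) 0).map g.op).app M ≫ (extZeroIso X M).hom =
      (extZeroIso Y M).hom ≫ ((linearYoneda R (ModuleCat.{u} R)).obj M).map g.op := by
  rw [← cancel_epi (extZeroIso Y M).inv, ← Category.assoc, extZeroIso_inv_naturality_left,
    Category.assoc, Iso.inv_hom_id, Iso.inv_hom_id_assoc, Category.comp_id]

end ModuleCat

namespace localCohomology

open Limits Opposite

variable {R : Type u} [CommRing R] (J : Ideal R)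

/-- Evaluation at the class of `1` of homomorphisms out of `R/J^n`. -/
noncomputable def evalOne (M : ModuleCat.{u} R) (n : ℕ) :
    ((linearYoneda R (ModuleCat.{u} R)).obj M).obj (op (ModuleCat.of R (R ⧸ J ^ n))) ⟶ M :=
  ModuleCat.ofHom
    { toFun := fun φ => @ModuleCat.Hom.hom R _ (ModuleCat.of R (R ⧸ J ^ n)) M φ
        (Submodule.Quotient.mk 1)
      map_add' := fun _ _ => rfl
      map_smul' := fun _ _ => rfl }

/-- The canonical map from the zeroth local cohomology module of `M` to `M`. -/
noncomputable def fromZero (M : ModuleCat.{u} R) : (localCohomology J 0).obj M ⟶ M :=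
  (isColimitCocone J 0 M).desc
    { pt := M
      ι :=
        { app := fun k => (ModuleCat.extZeroIso _ M).hom ≫ evalOne J M k.unop.unop
          naturality := fun k l f => by
            refine ((Category.assoc _ _ _).symm.trans (congrArg (· ≫ evalOne J M l.unop.unop)
              (ModuleCat.extZeroIso_hom_naturality_left
                ((ringModIdeals (idealPowersDiagram J)).map f.unop) M))).trans ?_
            refine (Category.assoc _ _ _).trans ?_
            rfl } }

variable {J}

theorem fromZero_ι (M : ModuleCat.{u} R) (k) (y : (system J 0 M).obj k) :
    fromZero J M ((cocone J 0 M).ι.app k y) =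
      evalOne J M k.unop.unop ((ModuleCat.extZeroIso _ M).hom y) :=
  ConcreteCategory.congr_hom ((isColimitCocone J 0 M).fac _ k) y

theorem fromZero_injective (M : ModuleCat.{u} R) : Function.Injective (fromZero J M) := by
  refine (injective_iff_map_eq_zero (fromZero J M).hom).2 fun z hz => ?_
  obtain ⟨k, y, rfl⟩ := Concrete.isColimit_exists_rep _ (isColimitCocone J 0 M) z
  have h1 := (fromZero_ι M k y).symm.trans hz
  have h2 : (ModuleCat.extZeroIso (ModuleCat.of R (R ⧸ J ^ k.unop.unop)) M).hom y = 0 := by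
    refine ModuleCat.hom_ext (LinearMap.ext fun x => ?_)
    obtain ⟨x, rfl⟩ := Submodule.Quotient.mk_surjective _ x
    have h3 : (Submodule.Quotient.mk x : R ⧸ J ^ k.unop.unop) =
        x • Submodule.Quotient.mk (1 : R) := by
      rw [← Submodule.Quotient.mk_smul, smul_eq_mul, mul_one]
    exact (congrArg _ h3).trans ((map_smul _ _ _).trans ((congrArg (x • ·) h1).trans (smul_zero _)))
  have h4 : y = 0 := by
    have := congrArg (ModuleCat.extZeroIso (ModuleCat.of R (R ⧸ J ^ k.unop.unop)) M).inv h2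
    exact (ConcreteCategory.congr_hom (ModuleCat.extZeroIso
      (ModuleCat.of R (R ⧸ J ^ k.unop.unop)) M).hom_inv_id y).symm.trans (this.trans (map_zero _))
  exact (congrArg _ h4).trans (map_zero _)

/-- The preimage is the class of the map `R/J^n → M` sending `1` to `m`. With `fromZero_injective`
this identifies `H^0_J(M)` with the `J`-power torsion of `M`. -/
theorem exists_fromZero_eq (M : ModuleCat.{u} R) (m : M) {n : ℕ} (hm : ∀ r ∈ J ^ n, r • m = 0) :
    ∃ z, fromZero J M z = m := by
  let φ : ModuleCat.of R (R ⧸ J ^ n) ⟶ M := ModuleCat.ofHom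
    ((J ^ n).liftQ (LinearMap.toSpanSingleton R M m) fun r hr => hm r hr)
  refine ⟨(cocone J 0 M).ι.app (op (op n)) ((ModuleCat.extZeroIso _ M).inv φ), ?_⟩
  refine (fromZero_ι M (op (op n)) _).trans ?_
  refine (congrArg _ (ConcreteCategory.congr_hom (ModuleCat.extZeroIso
      (ModuleCat.of R (R ⧸ J ^ n)) M).inv_hom_id φ)).trans ?_
  exact one_smul R m

theorem fromZero_naturality {M N : ModuleCat.{u} R} (f : M ⟶ N) :
    (localCohomology J 0).map f ≫ fromZero J N = fromZero J M ≫ f := by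
  refine (isColimitCocone J 0 M).hom_ext fun k => ModuleCat.hom_ext (LinearMap.ext fun y => ?_)
  have h1 := ConcreteCategory.congr_hom (cocone_ι_map J 0 f k) y
  refine (congrArg (fromZero J N) h1).trans ((fromZero_ι N k _).trans ?_)
  refine (congrArg _ (ConcreteCategory.congr_hom
    (ModuleCat.extZeroIso_hom_naturality_right _ f) y)).trans ?_
  exact congrArg f (fromZero_ι M k y).symm

end localCohomology

/-! ### Local cohomology of unbundled modules; vanishing on torsion modules -/

section LocalCohomologyModule

variable {R : Type u} [CommRing R] (J : Ideal R)

/-- The `i`-th local cohomology module of an unbundled module. -/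
noncomputable abbrev LocCoh (i : ℕ) (M : Type u) [AddCommGroup M] [Module R M] : ModuleCat.{u} R :=
  (localCohomology J i).obj (ModuleCat.of R M)

variable {M N P : Type u} [AddCommGroup M] [Module R M] [AddCommGroup N] [Module R N]
  [AddCommGroup P] [Module R P]

/-- The linear map between local cohomology modules induced by a linear map. -/
noncomputable def LocCoh.map (i : ℕ) (f : M →ₗ[R] N) : LocCoh J i M →ₗ[R] LocCoh J i N :=
  ((localCohomology J i).map (ModuleCat.ofHom f)).hom

namespace LocCoh

theorem map_id (i : ℕ) : map J i (LinearMap.id : M →ₗ[R] M) = LinearMap.id :=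
  congrArg ModuleCat.Hom.hom ((localCohomology J i).map_id _)

theorem map_comp (i : ℕ) (g : N →ₗ[R] P) (f : M →ₗ[R] N) :
    map J i (g ∘ₗ f) = map J i g ∘ₗ map J i f :=
  congrArg ModuleCat.Hom.hom ((localCohomology J i).map_comp (ModuleCat.ofHom f) (ModuleCat.ofHom g))

theorem map_lsmul (i : ℕ) (r : R) :
    map J i (LinearMap.lsmul R M r) = LinearMap.lsmul R (LocCoh J i M) r :=
  congrArg ModuleCat.Hom.hom (localCohomology.map_smul_id i (ModuleCat.of R M) r)

/-- Isomorphic modules have isomorphic local cohomology. -/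
noncomputable def mapEquiv (i : ℕ) (e : M ≃ₗ[R] N) : LocCoh J i M ≃ₗ[R] LocCoh J i N :=
  LinearEquiv.ofLinearMap (map J i e.toLinearMap) (map J i e.symm.toLinearMap)
    (by rw [← map_comp, LinearEquiv.comp_coe, LinearEquiv.symm_trans_self]; exact map_id J i)
    (by rw [← map_comp, LinearEquiv.comp_coe, LinearEquiv.self_trans_symm]; exact map_id J i)

variable {J}

theorem exact_map {f : M →ₗ[R] N} {g : N →ₗ[R] P} (hf : Function.Injective f)
    (hfg : Function.Exact f g) (hg : Function.Surjective g) (i : ℕ) :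
    Function.Exact (map J i f) (map J i g) :=
  localCohomology.exact_middle (ModuleCat.shortComplex_shortExact
    (ModuleCat.shortComplexOfCompEqZero f g hfg.linearMap_comp_eq_zero) hfg hf hg) i

theorem exists_connecting {f : M →ₗ[R] N} {g : N →ₗ[R] P} (hf : Function.Injective f)
    (hfg : Function.Exact f g) (hg : Function.Surjective g) (i : ℕ) :
    ∃ δ : LocCoh J i P →ₗ[R] LocCoh J (i + 1) M,
      Function.Exact (map J i g) δ ∧ Function.Exact δ (map J (i + 1) f) := by
  obtain ⟨δ, h₁, h₂⟩ := localCohomology.exists_connecting (J := J)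
    (ModuleCat.shortComplex_shortExact
    (ModuleCat.shortComplexOfCompEqZero f g hfg.linearMap_comp_eq_zero) hfg hf hg) i
  exact ⟨δ.hom, h₁, h₂⟩

theorem exists_pow_smul_eq_zero {i : ℕ} (z : LocCoh J i M) :
    ∃ n : ℕ, ∀ r ∈ J ^ n, r • z = 0 :=
  localCohomology.exists_pow_smul_eq_zero z

theorem subsingleton_of_injective [Module.Injective R M] (i : ℕ) :
    Subsingleton (LocCoh J (i + 1) M) := by
  have := Module.injective_object_of_injective_module R M
  exact localCohomology.subsingleton_of_injective i (ModuleCat.of R M)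

variable (J M) in
/-- The canonical map from the zeroth local cohomology module. -/
noncomputable def zeroι : LocCoh J 0 M →ₗ[R] M :=
  (localCohomology.fromZero J (ModuleCat.of R M)).hom

theorem zeroι_injective : Function.Injective (zeroι J M) :=
  localCohomology.fromZero_injective _

theorem exists_zeroι_eq (m : M) {n : ℕ} (hm : ∀ r ∈ J ^ n, r • m = 0) : ∃ z, zeroι J M z = m :=
  localCohomology.exists_fromZero_eq (ModuleCat.of R M) m hm

theorem zeroι_map (f : M →ₗ[R] N) (z : LocCoh J 0 M) :
    zeroι J N (map J 0 f z) = f (zeroι J M z) :=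
  ConcreteCategory.congr_hom (localCohomology.fromZero_naturality (J := J) (ModuleCat.ofHom f)) z

theorem map_zero_injective {f : M →ₗ[R] N} (hf : Function.Injective f) :
    Function.Injective (map J 0 f) := fun a b h =>
  zeroι_injective (hf (by rw [← zeroι_map, ← zeroι_map, h]))

/-- The zeroth local cohomology of a torsion module is the module itself. -/
noncomputable def zeroEquiv (hM : ∀ m : M, ∃ n : ℕ, ∀ r ∈ J ^ n, r • m = 0) :
    LocCoh J 0 M ≃ₗ[R] M :=
  LinearEquiv.ofBijective (zeroι J M) ⟨zeroι_injective, fun m =>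
    (hM m).elim fun _ hn => exists_zeroι_eq m hn⟩

end LocCoh

variable (M) in
/-- The submodule of elements annihilated by a power of `J`. -/
def powTorsion : Submodule R M where
  carrier := {m | ∃ n : ℕ, ∀ r ∈ J ^ n, r • m = 0}
  zero_mem' := ⟨0, fun r _ => smul_zero r⟩
  add_mem' := by
    rintro a b ⟨n, hn⟩ ⟨k, hk⟩
    exact ⟨n + k, fun r hr => by
      rw [smul_add, hn r (Ideal.pow_le_pow_right (Nat.le_add_right n k) hr),
        hk r (Ideal.pow_le_pow_right (Nat.le_add_left k n) hr), add_zero]⟩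
  smul_mem' := by
    rintro c a ⟨n, hn⟩
    exact ⟨n, fun r hr => by rw [smul_comm, hn r hr, smul_zero]⟩

variable {J} in
theorem exists_pow_smul_eq_zero_of_fg [Module.Finite R M]
    (hM : ∀ m : M, ∃ n : ℕ, ∀ r ∈ J ^ n, r • m = 0) : ∃ n : ℕ, ∀ r ∈ J ^ n, ∀ m : M, r • m = 0 := by
  obtain ⟨s, hs⟩ := Module.Finite.fg_top (R := R) (M := M)
  choose n hn using hM
  refine ⟨s.sup n, fun r hr m => ?_⟩
  have : (⊤ : Submodule R M) ≤ LinearMap.ker (LinearMap.lsmul R M r) := by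
    rw [← hs, Submodule.span_le]
    intro x hx
    exact hn x r (Ideal.pow_le_pow_right (Finset.le_sup hx) hr)
  exact this (Submodule.mem_top (x := m))

/-- Baer's criterion via Artin–Rees: a map from `I` kills `J^(n+k) ∩ I` for suitable `n`, `k`, so it
extends through `R/J^(n+k)`, and the extension automatically takes torsion values. -/
theorem injective_powTorsion [IsNoetherianRing R] [Module.Injective R M] :
    Module.Injective R (powTorsion J M) := by
  apply Module.Baer.injective
  intro I g
  obtain ⟨n, hn⟩ : ∃ n : ℕ, ∀ r ∈ J ^ n, ∀ m : LinearMap.range g, r • m = 0 := by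
    refine exists_pow_smul_eq_zero_of_fg (M := LinearMap.range g) fun m => ?_
    obtain ⟨n, hn⟩ := m.1.2
    exact ⟨n, fun r hr => Subtype.ext (Subtype.ext (hn r hr))⟩
  -- Artin–Rees gives `J^(n+k) ∩ I ⊆ J^n I`, and `J^n` kills the image of `g`.
  obtain ⟨k, hk⟩ := J.exists_pow_inf_eq_pow_smul I
  let p : I →ₗ[R] R ⧸ J ^ (n + k) := (J ^ (n + k)).mkQ ∘ₗ I.subtype
  let g' : I →ₗ[R] M := (powTorsion J M).subtype ∘ₗ g
  have hker : LinearMap.ker p ≤ LinearMap.ker g' := by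
    intro x hx
    have hx1 : (x : R) ∈ J ^ (n + k) := (Submodule.Quotient.mk_eq_zero _).1 hx
    have hx2 : (x : R) ∈ J ^ n • I := by
      have : (x : R) ∈ J ^ (n + k) • (⊤ : Submodule R R) ⊓ I := ⟨by simpa using hx1, x.2⟩
      rw [hk (n + k) (Nat.le_add_left k n), Nat.add_sub_cancel] at this
      exact Submodule.smul_mono le_rfl inf_le_right this
    have hx3 : J ^ n • I ≤ (LinearMap.ker g').map I.subtype := by
      rw [Submodule.smul_le]
      intro r hr y hy
      refine ⟨r • ⟨y, hy⟩, ?_, rfl⟩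
      change g' _ = 0
      rw [map_smul]
      exact congrArg (fun z : LinearMap.range g => ((z : powTorsion J M) : M))
        (hn r hr ⟨g ⟨y, hy⟩, ⟨_, rfl⟩⟩)
    obtain ⟨y, hy, hyx⟩ := hx3 hx2
    exact (Subtype.ext hyx : y = x) ▸ hy
  obtain ⟨h, hh⟩ := Module.Injective.out ((LinearMap.ker p).liftQ p le_rfl)
    (LinearMap.ker_eq_bot.1 (Submodule.ker_liftQ_eq_bot _ _ _ le_rfl))
    ((LinearMap.ker p).liftQ g' hker)
  refine ⟨(h ∘ₗ (J ^ (n + k)).mkQ).codRestrict (powTorsion J M) fun x => ⟨n + k, fun r hr => ?_⟩,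
    fun x hx => Subtype.ext ?_⟩
  · rw [← map_smul, LinearMap.comp_apply]
    have : (J ^ (n + k)).mkQ (r • x) = 0 :=
      (Submodule.Quotient.mk_eq_zero _).2 (Ideal.mul_mem_right x _ hr)
    rw [this, map_zero]
  · exact hh (Submodule.Quotient.mk ⟨x, hx⟩)

-- Dimension shifting: a torsion module embeds in a torsion injective one, with torsion cokernel. In
-- the lowest degree the connecting map vanishes because `H^0` of a torsion module is the module
-- itself.
variable {J} in
theorem LocCoh.subsingleton_of_torsion [IsNoetherianRing R] (i : ℕ)
    (hM : ∀ m : M, ∃ n : ℕ, ∀ r ∈ J ^ n, r • m = 0) : Subsingleton (LocCoh J (i + 1) M) := by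
  induction i using Nat.strong_induction_on generalizing M with | _ i ih => ?_
  obtain ⟨G, _, _, hGi, hGt, f, hf⟩ : ∃ (G : Type u) (_ : AddCommGroup G) (_ : Module R G),
      Module.Injective R G ∧ (∀ g : G, ∃ n : ℕ, ∀ r ∈ J ^ n, r • g = 0) ∧
      ∃ f : M →ₗ[R] G, Function.Injective f := by
    let I : ModuleCat.{u} R := Injective.under (ModuleCat.of R M)
    let ι : M →ₗ[R] I := (Injective.ι (ModuleCat.of R M)).hom
    have hι : Function.Injective ι :=
      (ModuleCat.mono_iff_injective (Injective.ι (ModuleCat.of R M))).1 inferInstance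
    have hI : Module.Injective R I :=
      Module.injective_module_of_injective_object R I (inj := Injective.injective_under _)
    refine ⟨powTorsion J I, inferInstance, inferInstance, injective_powTorsion J, fun g =>
      g.2.imp fun n hn r hr => Subtype.ext (hn r hr), ι.codRestrict _ fun m =>
      (hM m).imp fun n hn r hr => by rw [← map_smul, hn r hr, map_zero],
      fun a b h => hι (congrArg Subtype.val h)⟩
  have hCt : ∀ c : G ⧸ LinearMap.range f, ∃ n : ℕ, ∀ r ∈ J ^ n, r • c = 0 := by
    intro c
    obtain ⟨g, rfl⟩ := Submodule.Quotient.mk_surjective _ c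
    exact (hGt g).imp fun n hn r hr => by rw [← Submodule.Quotient.mk_smul, hn r hr]; rfl
  have hex : Function.Exact f (LinearMap.range f).mkQ := LinearMap.exact_map_mkQ_range f
  obtain ⟨δ, h₁, h₂⟩ := exists_connecting (J := J) hf hex (Submodule.mkQ_surjective _) i
  have hG : Subsingleton (LocCoh J (i + 1) G) := subsingleton_of_injective i
  have hδ : δ = 0 := by
    cases i with
    | zero =>
      ext z
      refine (h₁ z).2 ?_
      obtain ⟨g, hg⟩ := Submodule.mkQ_surjective (LinearMap.range f) (zeroι J _ z)
      obtain ⟨y, hy⟩ := exists_zeroι_eq g (hGt g).choose_spec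
      exact ⟨y, zeroι_injective (by rw [zeroι_map, hy, hg])⟩
    | succ i =>
      have := ih i (Nat.lt_succ_self i) hCt
      ext z
      rw [Subsingleton.elim z 0, map_zero, map_zero]
  refine subsingleton_of_forall_eq 0 fun z => ?_
  obtain ⟨y, rfl⟩ := (h₂ z).1 (Subsingleton.elim _ _)
  rw [hδ, LinearMap.zero_apply]

end LocalCohomologyModule

/-! ### Koszul Euler characteristic: additivity and positivity -/

section EulerCharacteristic

/-- The Euler characteristic of a module with respect to a sequence of ring elements, that is, the
alternating sum of the lengths of its Koszul cohomology modules, defined by recursion. -/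
noncomputable def koszulChar {R : Type u} [CommRing R] :
    List R → (M : Type v) → [AddCommGroup M] → [Module R M] → ℤ
  | [], M, _, _ => (Module.length R M).toNat
  | x :: l, M, _, _ => koszulChar l (LinearMap.ker (LinearMap.lsmul R M x)) -
      koszulChar l (M ⧸ LinearMap.range (LinearMap.lsmul R M x))

section

variable {R : Type u} [CommRing R]

/-- `toNat` turns infinite length into `0`; under `KoszulAdmissible` the lengths reached by the
recursion are finite. -/
theorem koszulChar_nil (M : Type v) [AddCommGroup M] [Module R M] :
    koszulChar ([] : List R) M = (Module.length R M).toNat := by rw [koszulChar]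

theorem koszulChar_cons (x : R) (l : List R) (M : Type v) [AddCommGroup M] [Module R M] :
    koszulChar (x :: l) M = koszulChar l (LinearMap.ker (LinearMap.lsmul R M x)) -
      koszulChar l (M ⧸ LinearMap.range (LinearMap.lsmul R M x)) := by rw [koszulChar]

/-- A linear equivalence restricts to the kernels of multiplication by a ring element. -/
def LinearEquiv.kerLsmul {M N : Type*} [AddCommGroup M] [Module R M]
    [AddCommGroup N] [Module R N] (e : M ≃ₗ[R] N) (x : R) :
    LinearMap.ker (LinearMap.lsmul R M x) ≃ₗ[R] LinearMap.ker (LinearMap.lsmul R N x) :=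
  e.ofSubmodules _ _ (by
    ext n
    simp only [Submodule.mem_map, LinearMap.mem_ker, LinearMap.lsmul_apply]
    constructor
    · rintro ⟨m, hm, rfl⟩
      change x • e m = 0
      rw [← map_smul, hm, map_zero]
    · intro hn
      exact ⟨e.symm n, by rw [← map_smul, hn, map_zero], e.apply_symm_apply n⟩)

/-- A linear equivalence induces one on quotients by multiples of a ring element. -/
def LinearEquiv.quotRangeLsmul {M N : Type*} [AddCommGroup M] [Module R M]
    [AddCommGroup N] [Module R N] (e : M ≃ₗ[R] N) (x : R) :
    (M ⧸ LinearMap.range (LinearMap.lsmul R M x)) ≃ₗ[R]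
      N ⧸ LinearMap.range (LinearMap.lsmul R N x) :=
  Submodule.Quotient.equiv _ _ e (by
    ext n
    simp only [Submodule.mem_map, LinearMap.mem_range, LinearMap.lsmul_apply]
    constructor
    · rintro ⟨_, ⟨m, rfl⟩, rfl⟩
      exact ⟨e m, (map_smul e x m).symm⟩
    · rintro ⟨m, rfl⟩
      exact ⟨x • e.symm m, ⟨e.symm m, rfl⟩, by
        change e (x • e.symm m) = _
        rw [map_smul, e.apply_symm_apply]⟩)

theorem LinearEquiv.koszulChar_eq (l : List R) {M : Type*} {N : Type*} [AddCommGroup M]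
    [Module R M] [AddCommGroup N] [Module R N] (e : M ≃ₗ[R] N) :
    koszulChar l M = koszulChar l N := by
  induction l generalizing M N with
  | nil => rw [koszulChar_nil, koszulChar_nil, e.length_eq]
  | cons x l ih =>
    rw [koszulChar_cons, koszulChar_cons, ih (e.kerLsmul x), ih (e.quotRangeLsmul x)]

theorem koszulChar_eq_zero_of_subsingleton (l : List R) (M : Type v) [AddCommGroup M] [Module R M]
    [Subsingleton M] : koszulChar l M = 0 := by
  cases l with
  | nil => rw [koszulChar_nil, Module.length_eq_zero]; rfl
  | cons x l =>
    rw [koszulChar_cons, sub_eq_zero]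
    exact LinearEquiv.koszulChar_eq l (LinearEquiv.ofSubsingleton _ _)

theorem koszulChar_cons_of_smul_eq_zero (x : R) (l : List R) {M : Type v} [AddCommGroup M]
    [Module R M] (h : ∀ m : M, x • m = 0) : koszulChar (x :: l) M = 0 := by
  have h0 : LinearMap.lsmul R M x = 0 := LinearMap.ext h
  rw [koszulChar_cons, sub_eq_zero, h0]
  exact LinearEquiv.koszulChar_eq l (((LinearEquiv.ofEq _ _ LinearMap.ker_zero).trans
    Submodule.topEquiv).trans (Submodule.quotEquivOfEqBot _ LinearMap.range_zero).symm)

theorem koszulChar_cons_of_injective (x : R) (l : List R) {M : Type v} [AddCommGroup M]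
    [Module R M] (h : ∀ m : M, x • m = 0 → m = 0) :
    koszulChar (x :: l) M = - koszulChar l (M ⧸ LinearMap.range (LinearMap.lsmul R M x)) := by
  have : Subsingleton (LinearMap.ker (LinearMap.lsmul R M x)) :=
    subsingleton_of_forall_eq 0 fun m => Subtype.ext (h m.1 m.2)
  rw [koszulChar_cons, koszulChar_eq_zero_of_subsingleton l (LinearMap.ker _), zero_sub]

theorem koszulChar_cons_of_surjective (x : R) (l : List R) {M : Type v} [AddCommGroup M]
    [Module R M] (h : ∀ m : M, ∃ n : M, x • n = m) :
    koszulChar (x :: l) M = koszulChar l (LinearMap.ker (LinearMap.lsmul R M x)) := by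
  have h0 : LinearMap.range (LinearMap.lsmul R M x) = ⊤ := LinearMap.range_eq_top.2 h
  have : Subsingleton (M ⧸ LinearMap.range (LinearMap.lsmul R M x)) := by
    rw [h0]; infer_instance
  rw [koszulChar_cons, koszulChar_eq_zero_of_subsingleton l (M ⧸ _), sub_zero]

end

variable {R : Type u} [CommRing R] [IsLocalRing R]

open IsLocalRing

/-- The sequence `l` generates, modulo the annihilator of `M`, an ideal whose radical contains the
maximal ideal. -/
def IsParamSeq (l : List R) (M : Type v) [AddCommGroup M] [Module R M] : Prop :=
  maximalIdeal R ≤ (Ideal.ofList l ⊔ Module.annihilator R M).radical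

theorem IsParamSeq.of_le {l : List R} {M : Type*} {N : Type*} [AddCommGroup M] [Module R M]
    [AddCommGroup N] [Module R N] (h : IsParamSeq l M)
    (hMN : Module.annihilator R M ≤ Module.annihilator R N) : IsParamSeq l N :=
  h.trans (Ideal.radical_mono (sup_le_sup_left hMN _))

theorem IsParamSeq.of_injective {l : List R} {M : Type*} {N : Type*} [AddCommGroup M] [Module R M]
    [AddCommGroup N] [Module R N] (h : IsParamSeq l M) (f : N →ₗ[R] M)
    (hf : Function.Injective f) : IsParamSeq l N :=
  h.of_le (f.annihilator_le_of_injective hf)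

theorem IsParamSeq.of_surjective {l : List R} {M : Type*} {N : Type*} [AddCommGroup M] [Module R M]
    [AddCommGroup N] [Module R N] (h : IsParamSeq l M) (f : M →ₗ[R] N)
    (hf : Function.Surjective f) : IsParamSeq l N :=
  h.of_le (f.annihilator_le_of_surjective hf)

/-- An element with a power killing `M` lies in the radical of the annihilator, so it is superfluous
as a parameter. -/
theorem IsParamSeq.tail {x : R} {l : List R} {M : Type v} [AddCommGroup M] [Module R M]
    (h : IsParamSeq (x :: l) M) {k : ℕ} (hx : ∀ m : M, x ^ k • m = 0) : IsParamSeq l M := by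
  refine h.trans ?_
  rw [Ideal.radical_le_radical_iff, Ideal.ofList_cons, sup_assoc, sup_le_iff]
  refine ⟨?_, Ideal.le_radical⟩
  rw [Ideal.span_singleton_le_iff_mem]
  exact ⟨k, Ideal.mem_sup_right (Module.mem_annihilator.2 hx)⟩

/-- The modules on which the Euler characteristic is additive. -/
def KoszulAdmissible (l : List R) (M : Type v) [AddCommGroup M] [Module R M] : Prop :=
  (IsNoetherian R M ∨ IsArtinian R M) ∧ IsParamSeq l M

theorem KoszulAdmissible.of_injective {l : List R} {M : Type*} {N : Type*} [AddCommGroup M]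
    [Module R M] [AddCommGroup N] [Module R N] (h : KoszulAdmissible l M) (f : N →ₗ[R] M)
    (hf : Function.Injective f) : KoszulAdmissible l N :=
  ⟨h.1.imp (fun (_ : IsNoetherian R M) => isNoetherian_of_injective f hf)
    fun (_ : IsArtinian R M) => isArtinian_of_injective f hf, h.2.of_injective f hf⟩

theorem KoszulAdmissible.of_surjective {l : List R} {M : Type*} {N : Type*} [AddCommGroup M]
    [Module R M] [AddCommGroup N] [Module R N] (h : KoszulAdmissible l M) (f : M →ₗ[R] N)
    (hf : Function.Surjective f) : KoszulAdmissible l N :=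
  ⟨h.1.imp (fun (_ : IsNoetherian R M) => isNoetherian_of_surjective f (LinearMap.range_eq_top.2 hf))
    fun (_ : IsArtinian R M) => isArtinian_of_surjective M f hf, h.2.of_surjective f hf⟩

theorem KoszulAdmissible.ker {x : R} {l : List R} {M : Type v} [AddCommGroup M] [Module R M]
    (h : KoszulAdmissible (x :: l) M) :
    KoszulAdmissible l (LinearMap.ker (LinearMap.lsmul R M x)) := by
  have h1 := h.of_injective (LinearMap.ker (LinearMap.lsmul R M x)).subtype
    (Submodule.subtype_injective _)
  exact ⟨h1.1, h1.2.tail (k := 1) fun m => Subtype.ext (by rw [pow_one]; exact m.2)⟩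

theorem KoszulAdmissible.quot {x : R} {l : List R} {M : Type v} [AddCommGroup M] [Module R M]
    (h : KoszulAdmissible (x :: l) M) :
    KoszulAdmissible l (M ⧸ LinearMap.range (LinearMap.lsmul R M x)) := by
  have h1 := h.of_surjective (LinearMap.range (LinearMap.lsmul R M x)).mkQ
    (Submodule.mkQ_surjective _)
  refine ⟨h1.1, h1.2.tail (k := 1) fun m => ?_⟩
  obtain ⟨m, rfl⟩ := Submodule.Quotient.mk_surjective _ m
  rw [pow_one, ← Submodule.Quotient.mk_smul, Submodule.Quotient.mk_eq_zero]
  exact ⟨m, rfl⟩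

/-- `M` is a module over an Artinian quotient of `R`, where the two conditions agree. -/
theorem isNoetherian_iff_isArtinian_of_pow_smul [IsNoetherianRing R] {M : Type v} [AddCommGroup M]
    [Module R M] {k : ℕ} (h : ∀ r ∈ maximalIdeal R ^ k, ∀ m : M, r • m = 0) :
    IsNoetherian R M ↔ IsArtinian R M := by
  -- The exponent `k + 1` keeps the quotient ring nonzero even when `k = 0`.
  have h' : Module.IsTorsionBySet R M (maximalIdeal R ^ (k + 1) : Ideal R) := fun m r =>
    h r (Ideal.pow_le_pow_right (Nat.le_succ k) r.2) m
  let S := R ⧸ maximalIdeal R ^ (k + 1)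
  have : Nontrivial S := Ideal.Quotient.nontrivial_iff.2
    (ne_top_of_le_ne_top (Ideal.IsPrime.ne_top inferInstance) (Ideal.pow_le_self k.succ_ne_zero))
  have : IsLocalRing S := IsLocalRing.of_surjective' (Ideal.Quotient.mk _) Ideal.Quotient.mk_surjective
  have : IsArtinianRing S := by
    rw [isArtinianRing_iff_isNilpotent_maximalIdeal]
    refine ⟨k + 1, ?_⟩
    have h1 : maximalIdeal S = (maximalIdeal R).map (Ideal.Quotient.mk _) := by
      refine (IsLocalRing.eq_maximalIdeal ?_).symm
      exact Ideal.IsMaximal.map_of_surjective_of_ker_le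
        Ideal.Quotient.mk_surjective (by rw [Ideal.mk_ker]; exact Ideal.pow_le_self k.succ_ne_zero)
    rw [h1, ← Ideal.map_pow, Ideal.map_quotient_self, Ideal.zero_eq_bot]
  let := h'.module
  have : IsScalarTower R S M := h'.isScalarTower
  have hs : Function.Surjective (algebraMap R S) := Ideal.Quotient.mk_surjective
  constructor
  · intro hM
    have hM' : IsNoetherian S M := isNoetherian_of_tower R hM
    have : IsArtinian S M := IsSemiprimaryRing.isNoetherian_iff_isArtinian.1 hM'
    exact isArtinian_of_surjective_algebraMap hs
  · intro hM
    have hM' : IsArtinian S M := isArtinian_of_tower R hM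
    have : IsNoetherian S M := IsSemiprimaryRing.isNoetherian_iff_isArtinian.2 hM'
    have : Module.Finite R M := Module.Finite.trans S M
    infer_instance

theorem IsParamSeq.exists_pow_smul_eq_zero [IsNoetherianRing R] {M : Type v} [AddCommGroup M]
    [Module R M] (h : IsParamSeq ([] : List R) M) :
    ∃ k : ℕ, ∀ r ∈ maximalIdeal R ^ k, ∀ m : M, r • m = 0 := by
  obtain ⟨k, hk⟩ := Ideal.exists_pow_le_of_le_radical_of_fg h (IsNoetherian.noetherian _)
  refine ⟨k, fun r hr m => ?_⟩
  have := hk hr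
  rw [Ideal.ofList_nil, bot_sup_eq] at this
  exact Module.mem_annihilator.1 this m

theorem KoszulAdmissible.isFiniteLength [IsNoetherianRing R] {M : Type v} [AddCommGroup M]
    [Module R M] (h : KoszulAdmissible ([] : List R) M) : IsNoetherian R M ∧ IsArtinian R M := by
  obtain ⟨k, hk⟩ := h.2.exists_pow_smul_eq_zero
  have := isNoetherian_iff_isArtinian_of_pow_smul hk
  exact ⟨h.1.elim id this.2, h.1.elim this.1 id⟩

section

variable [IsNoetherianRing R] {M N P : Type v} [AddCommGroup M] [Module R M]
  [AddCommGroup N] [Module R N] [AddCommGroup P] [Module R P]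

/-- The snake lemma for multiplication by `x` gives a six-term exact sequence of kernels and
cokernels; additivity for `l` makes its alternating sum vanish. -/
theorem koszulChar_eq_add (l : List R) {f : M →ₗ[R] N} {g : N →ₗ[R] P}
    (hN : KoszulAdmissible l N) (hf : Function.Injective f) (hfg : Function.Exact f g)
    (hg : Function.Surjective g) : koszulChar l N = koszulChar l M + koszulChar l P := by
  induction l generalizing M N P with
  | nil =>
    have h1 := hN.isFiniteLength
    have h2 := (hN.of_injective f hf).isFiniteLength
    have h3 := (hN.of_surjective g hg).isFiniteLength
    have := h1.1; have := h1.2; have := h2.1; have := h2.2; have := h3.1; have := h3.2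
    rw [koszulChar_nil, koszulChar_nil, koszulChar_nil,
      Module.length_eq_add_of_exact f g hf hg hfg,
      ENat.toNat_add Module.length_ne_top Module.length_ne_top, Nat.cast_add]
  | cons x l ih =>
    have hM := hN.of_injective f hf
    have hP := hN.of_surjective g hg
    have key : ∀ {U V : Type v} [AddCommGroup U] [Module R U] [AddCommGroup V] [Module R V]
        (φ : U →ₗ[R] V), KoszulAdmissible l U →
        koszulChar l U = koszulChar l (LinearMap.ker φ) + koszulChar l (LinearMap.range φ) := by
      intro U V _ _ _ _ φ hU
      exact ih (f := (LinearMap.ker φ).subtype) (g := φ.rangeRestrict) hU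
        (Submodule.subtype_injective _) (by
          rw [LinearMap.exact_iff, LinearMap.ker_rangeRestrict, Submodule.range_subtype])
        φ.surjective_rangeRestrict
    let aM := LinearMap.lsmul R M x
    let aN := LinearMap.lsmul R N x
    let aP := LinearMap.lsmul R P x
    have hMN : f ∘ₗ aM = aN ∘ₗ f := LinearMap.ext fun m => map_smul f x m
    have hNP : g ∘ₗ aN = aP ∘ₗ g := LinearMap.ext fun m => map_smul g x m
    let u₁ : LinearMap.ker aM →ₗ[R] LinearMap.ker aN := f.restrict fun m hm => by
      change aN (f m) = 0
      rw [← LinearMap.comp_apply, ← hMN, LinearMap.comp_apply, LinearMap.mem_ker.1 hm, map_zero]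
    let u₂ : LinearMap.ker aN →ₗ[R] LinearMap.ker aP := g.restrict fun m hm => by
      change aP (g m) = 0
      rw [← LinearMap.comp_apply, ← hNP, LinearMap.comp_apply, LinearMap.mem_ker.1 hm, map_zero]
    let v₁ : (M ⧸ LinearMap.range aM) →ₗ[R] N ⧸ LinearMap.range aN :=
      Submodule.mapQ _ _ f (by
        rintro _ ⟨m, rfl⟩
        exact ⟨f m, (LinearMap.congr_fun hMN m).symm⟩)
    let v₂ : (N ⧸ LinearMap.range aN) →ₗ[R] P ⧸ LinearMap.range aP :=
      Submodule.mapQ _ _ g (by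
        rintro _ ⟨m, rfl⟩
        exact ⟨g m, (LinearMap.congr_fun hNP m).symm⟩)
    let ιN : LinearMap.ker aN →ₗ[R] N := (LinearMap.ker aN).subtype
    let ιP : LinearMap.ker aP →ₗ[R] P := (LinearMap.ker aP).subtype
    have hιN : Function.Exact ιN aN := aN.exact_subtype_ker_map
    have hιP : Function.Exact ιP aP := aP.exact_subtype_ker_map
    have hπM : Function.Exact aM (LinearMap.range aM).mkQ := aM.exact_map_mkQ_range
    have hπN : Function.Exact aN (LinearMap.range aN).mkQ := aN.exact_map_mkQ_range
    let δ : LinearMap.ker aP →ₗ[R] M ⧸ LinearMap.range aM :=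
      SnakeLemma.δ' aM aN aP f g hfg f g hfg hMN hNP ιP hιP (LinearMap.range aM).mkQ hπM hg hf
    have e₁ : LinearMap.ker δ = LinearMap.range u₂ := LinearMap.exact_iff.1
      (SnakeLemma.exact_δ'_right aM aN aP f g hfg f g hfg hMN hNP ιN hιN ιP hιP _ hπM hg hf u₂ rfl
        (Submodule.subtype_injective _))
    have e₂ : LinearMap.ker v₁ = LinearMap.range δ := LinearMap.exact_iff.1
      (SnakeLemma.exact_δ'_left aM aN aP f g hfg f g hfg hMN hNP ιP hιP _ hπM _ hπN hg hf v₁ rfl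
        (Submodule.mkQ_surjective _))
    have e₀ : LinearMap.ker u₂ = LinearMap.range u₁ := by
      ext n
      constructor
      · intro hn
        obtain ⟨m, hm⟩ := (hfg n.1).1 (congrArg Subtype.val hn)
        refine ⟨⟨m, hf ?_⟩, Subtype.ext hm⟩
        rw [map_zero]
        exact (LinearMap.congr_fun hMN m).trans ((congrArg aN hm).trans n.2)
      · rintro ⟨m, rfl⟩
        exact Subtype.ext (hfg.apply_apply_eq_zero m.1)
    have e₃ : LinearMap.ker v₂ = LinearMap.range v₁ := by
      ext n
      constructor
      · intro hn
        obtain ⟨n, rfl⟩ := Submodule.Quotient.mk_surjective _ n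
        obtain ⟨p, hp⟩ : g n ∈ LinearMap.range aP := (Submodule.Quotient.mk_eq_zero _).1 hn
        obtain ⟨n', rfl⟩ := hg p
        obtain ⟨m, hm⟩ := (hfg (n - x • n')).1 (by
          rw [map_sub, map_smul, sub_eq_zero]
          exact hp.symm)
        refine ⟨Submodule.Quotient.mk m, ?_⟩
        refine (congrArg Submodule.Quotient.mk hm).trans ?_
        rw [Submodule.Quotient.eq]
        exact ⟨-n', by simp [aN]⟩
      · rintro ⟨m, rfl⟩
        obtain ⟨m, rfl⟩ := Submodule.Quotient.mk_surjective _ m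
        exact congrArg Submodule.Quotient.mk (hfg.apply_apply_eq_zero m)
    have hu₁ : Function.Injective u₁ := fun a b h => Subtype.ext (hf (congrArg Subtype.val h))
    have hv₂ : LinearMap.range v₂ = ⊤ := LinearMap.range_eq_top.2 fun p => by
      obtain ⟨p, rfl⟩ := Submodule.Quotient.mk_surjective _ p
      obtain ⟨n, rfl⟩ := hg p
      exact ⟨Submodule.Quotient.mk n, rfl⟩
    -- Each term splits as the kernel plus the image of its outgoing map, and exactness makes these
    -- contributions cancel in pairs.
    have k₁ : koszulChar l (LinearMap.ker aM) = koszulChar l (LinearMap.range u₁) :=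
      (LinearEquiv.ofInjective u₁ hu₁).koszulChar_eq l
    have k₂ := key u₂ hN.ker
    have k₃ := key δ hP.ker
    have k₄ := key v₁ hM.quot
    have k₅ := key v₂ hN.quot
    have k₆ : koszulChar l (LinearMap.range v₂) = koszulChar l (P ⧸ LinearMap.range aP) :=
      ((LinearEquiv.ofEq _ _ hv₂).trans Submodule.topEquiv).koszulChar_eq l
    rw [e₀] at k₂
    rw [e₁] at k₃
    rw [e₂] at k₄
    rw [e₃] at k₅
    rw [koszulChar_cons, koszulChar_cons, koszulChar_cons, k₂, k₅, k₁, k₃, k₄, k₆]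
    ring

theorem koszulChar_eq_ker_add_range (l : List R) (φ : M →ₗ[R] N) (hM : KoszulAdmissible l M) :
    koszulChar l M = koszulChar l (LinearMap.ker φ) + koszulChar l (LinearMap.range φ) :=
  koszulChar_eq_add l (f := (LinearMap.ker φ).subtype) (g := φ.rangeRestrict) hM
    (Submodule.subtype_injective _) (by
      rw [LinearMap.exact_iff, LinearMap.ker_rangeRestrict, Submodule.range_subtype])
    φ.surjective_rangeRestrict

/-- In `0 → ker x → M → xM → 0` the kernel contributes nothing, and `xM` is killed by a smaller
power of `x`. -/
theorem koszulChar_cons_of_pow_smul_eq_zero (x : R) (l : List R) (hM : KoszulAdmissible (x :: l) M)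
    {k : ℕ} (h : ∀ m : M, x ^ k • m = 0) : koszulChar (x :: l) M = 0 := by
  induction k generalizing M with
  | zero =>
    have : Subsingleton M := subsingleton_of_forall_eq 0 fun m => by simpa using h m
    exact koszulChar_eq_zero_of_subsingleton _ _
  | succ k ih =>
    rw [koszulChar_eq_ker_add_range (x :: l) (LinearMap.lsmul R M x) hM,
      koszulChar_cons_of_smul_eq_zero x l fun m => Subtype.ext m.2, zero_add]
    refine ih (hM.of_injective (LinearMap.range _).subtype (Submodule.subtype_injective _)) ?_
    rintro ⟨_, ⟨m, rfl⟩⟩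
    refine Subtype.ext ?_
    change x ^ k • (x • m) = 0
    rw [smul_smul, ← pow_succ, h]

/-- The images of `x^n` stabilize. The kernel of `x^n` contributes `0`; on the stable image `x` is
surjective, so the subtracted term disappears and an Artinian kernel remains for the induction. -/
theorem koszulChar_nonneg (l : List R) (hM : IsArtinian R M) (hl : IsParamSeq l M) :
    0 ≤ koszulChar l M := by
  induction l generalizing M with
  | nil => rw [koszulChar_nil]; exact Int.natCast_nonneg _
  | cons x l ih =>
    have hMa : KoszulAdmissible (x :: l) M := ⟨Or.inr hM, hl⟩
    obtain ⟨n, hn⟩ := IsArtinian.monotone_stabilizes (LinearMap.lsmul R M x).iterateRange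
    let φ : M →ₗ[R] M := (LinearMap.lsmul R M x) ^ n
    have hφ : ∀ j m, ((LinearMap.lsmul R M x) ^ j) m = x ^ j • m := fun j => by
      induction j with
      | zero => simp
      | succ j ihj => intro m; rw [pow_succ, Module.End.mul_apply, ihj, pow_succ, mul_smul]; rfl
    rw [koszulChar_eq_ker_add_range (x :: l) φ hMa,
      koszulChar_cons_of_pow_smul_eq_zero x l (hMa.of_injective (LinearMap.ker φ).subtype
        (Submodule.subtype_injective _)) (k := n) fun m => Subtype.ext ((hφ n m).symm.trans m.2),
      zero_add]
    have hR := hMa.of_injective (LinearMap.range φ).subtype (Submodule.subtype_injective _)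
    rw [koszulChar_cons_of_surjective x l]
    · exact ih inferInstance hR.ker.2
    · rintro ⟨m, hm⟩
      have h1 : LinearMap.range φ = LinearMap.range ((LinearMap.lsmul R M x) ^ (n + 1)) :=
        hn (n + 1) (Nat.le_succ n)
      obtain ⟨y, hy⟩ := h1.le hm
      refine ⟨⟨φ y, y, rfl⟩, Subtype.ext (Eq.trans ?_ hy)⟩
      rw [pow_succ', Module.End.mul_apply]
      rfl

end

end EulerCharacteristic

/-! ### Vanishing and Artinianness of local cohomology -/

/-- Passing to `M ⧸ N` makes `x` a nonzerodivisor at the cost of a module killed by a power of `x`;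
here `N` is the `x`-power torsion. -/
theorem Submodule.exists_pow_smul_saturation {R : Type u} [CommRing R] {M : Type v} [AddCommGroup M]
    [Module R M] [IsNoetherian R M] (x : R) :
    ∃ (N : Submodule R M) (k : ℕ), (∀ n ∈ N, x ^ k • n = 0) ∧ ∀ m, x • m ∈ N → m ∈ N := by
  obtain ⟨k, hk⟩ := monotone_stabilizes_iff_noetherian.2 ‹_› (LinearMap.lsmul R M x).iterateKer
  have hφ : ∀ j m, ((LinearMap.lsmul R M x) ^ j) m = x ^ j • m := fun j => by
    induction j with
    | zero => simp
    | succ j ihj => intro m; rw [pow_succ, Module.End.mul_apply, ihj, pow_succ, mul_smul]; rfl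
  refine ⟨LinearMap.ker ((LinearMap.lsmul R M x) ^ k), k, fun n hn => (hφ k n).symm.trans hn,
    fun m hm => ?_⟩
  have h1 : LinearMap.ker ((LinearMap.lsmul R M x) ^ k) =
    LinearMap.ker ((LinearMap.lsmul R M x) ^ (k + 1)) := hk (k + 1) (Nat.le_succ k)
  rw [h1, LinearMap.mem_ker, hφ, pow_succ, mul_smul]
  rwa [LinearMap.mem_ker, hφ] at hm

/-- Nested submodules `B ⊇ B'` of an `x`-power torsion module coincide once `x^k B` and `x^k B'`
meet `ker x` equally for every `k`; these traces live in an Artinian module. -/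
theorem isArtinian_of_ker_lsmul {R : Type u} [CommRing R] {M : Type v} [AddCommGroup M]
    [Module R M] (x : R) (ht : ∀ m : M, ∃ n : ℕ, x ^ n • m = 0)
    [IsArtinian R (LinearMap.ker (LinearMap.lsmul R M x))] : IsArtinian R M := by
  rw [← monotone_stabilizes_iff_artinian]
  intro A
  let K := LinearMap.ker (LinearMap.lsmul R M x)
  let B : ℕ → Submodule R M := fun n => A n
  have hB : ∀ {i j}, i ≤ j → B j ≤ B i := fun h => A.monotone h
  let L : ℕ → ℕ → Submodule R K := fun k n =>
    ((B n).map (LinearMap.lsmul R M (x ^ k))).comap K.subtype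
  have hL : ∀ {k k' n n'}, k ≤ k' → n ≤ n' → L k' n' ≤ L k n := by
    intro k k' n n' hk hn y hy
    obtain ⟨z, hz, hzy⟩ := hy
    refine ⟨x ^ (k' - k) • z, (B n).smul_mem _ (hB hn hz), ?_⟩
    rw [← hzy]
    simp only [LinearMap.lsmul_apply, smul_smul, ← pow_add]
    rw [Nat.add_sub_cancel' hk]
  have stab : ∀ f : ℕ → Submodule R K, (∀ i j, i ≤ j → f j ≤ f i) →
      ∃ n, ∀ m, n ≤ m → f n = f m := fun f hf =>
    monotone_stabilizes_iff_artinian.2 ‹_› ⟨fun n => OrderDual.toDual (f n), fun i j h => hf i j h⟩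
  obtain ⟨n₀, hn₀⟩ := stab (fun n => L n n) fun i j h => hL h h
  choose N hN using fun k => stab (L k) fun i j h => hL le_rfl h
  -- A stage good for all `k` at once: the finitely many rows `k < n₀` stop at `N k`, and later rows
  -- are squeezed by the stable diagonal.
  let n₁ := max n₀ ((Finset.range n₀).sup N)
  have key : ∀ k n, n₁ ≤ n → L k n = L k n₁ := by
    intro k n hn
    refine le_antisymm (hL le_rfl hn) ?_
    by_cases hk : k < n₀
    · have h1 : N k ≤ n₁ := (Finset.le_sup (f := N) (Finset.mem_range.2 hk)).trans (le_max_right _ _)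
      rw [← hN k n₁ h1, ← hN k n (h1.trans hn)]
    · push Not at hk
      calc L k n₁ ≤ L n₀ n₀ := hL hk (le_max_left _ _)
        _ = L (max k n) (max k n) := hn₀ _ (hk.trans (le_max_left _ _))
        _ ≤ L k n := hL (le_max_left _ _) (le_max_right _ _)
  refine ⟨n₁, fun n hn => ?_⟩
  refine le_antisymm (A.monotone hn) ?_
  change B n₁ ≤ B n
  -- Equal traces give `w ∈ B n` with `x^j w = x^j z`, so `z - w` is killed by a smaller power of
  -- `x`.
  have main : ∀ j, ∀ z ∈ B n₁, x ^ j • z = 0 → z ∈ B n := by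
    intro j
    induction j with
    | zero =>
      intro z _ hz
      rw [pow_zero, one_smul] at hz
      exact hz ▸ (B n).zero_mem
    | succ j ih =>
      intro z hz hz0
      have hzK : x ^ j • z ∈ K := by
        change x • (x ^ j • z) = 0
        rw [smul_smul, ← pow_succ', hz0]
      have h1 : (⟨x ^ j • z, hzK⟩ : K) ∈ L j n₁ := ⟨z, hz, rfl⟩
      rw [← key j n hn] at h1
      obtain ⟨w, hw, hwz⟩ := h1
      have h2 := ih (z - w) (sub_mem hz (hB hn hw)) (by
        rw [smul_sub, sub_eq_zero]
        exact hwz.symm)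
      simpa using add_mem h2 hw
  exact fun z hz => (ht z).elim fun j hj => main j z hz hj

namespace LocCoh

open IsLocalRing

variable {R : Type u} [CommRing R] [IsLocalRing R]

section

variable {M : Type u} [AddCommGroup M] [Module R M]

theorem exists_pow_smul_eq_zero_of_mem {x : R} (hx : x ∈ maximalIdeal R) {i : ℕ}
    (z : LocCoh (maximalIdeal R) i M) : ∃ n : ℕ, x ^ n • z = 0 :=
  (exists_pow_smul_eq_zero z).imp fun n hn => hn _ (Ideal.pow_mem_pow hx n)

theorem subsingleton_of_smul_injective {x : R} (hx : x ∈ maximalIdeal R) {i : ℕ}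
    (h : ∀ z : LocCoh (maximalIdeal R) i M, x • z = 0 → z = 0) :
    Subsingleton (LocCoh (maximalIdeal R) i M) := by
  refine subsingleton_of_forall_eq 0 fun z => ?_
  obtain ⟨n, hn⟩ := exists_pow_smul_eq_zero_of_mem hx z
  induction n with
  | zero => simpa using hn
  | succ n ih => exact ih (h _ (by rw [smul_smul, ← pow_succ', hn]))

theorem smul_eq_zero_of_smul_eq_zero {J : Ideal R} {r : R} (h : ∀ m : M, r • m = 0) {i : ℕ}
    (z : LocCoh J i M) : r • z = 0 := by
  have h1 : LinearMap.lsmul R M r = LinearMap.lsmul R M 0 :=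
    LinearMap.ext fun m => (h m).trans (zero_smul R m).symm
  have h2 := map_lsmul (M := M) J i r
  rw [h1, map_lsmul] at h2
  exact (LinearMap.congr_fun h2 z).symm.trans (zero_smul R z)

theorem subsingleton_zero_of_injective {x : R} (hx : x ∈ maximalIdeal R)
    (h : ∀ m : M, x • m = 0 → m = 0) : Subsingleton (LocCoh (maximalIdeal R) 0 M) := by
  refine subsingleton_of_smul_injective hx fun z hz => ?_
  refine map_zero_injective (J := maximalIdeal R) (f := LinearMap.lsmul R M x)
    ((injective_iff_map_eq_zero _).2 h) ?_
  rw [map_lsmul, map_zero]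
  exact hz

/-- The part of the long exact sequence given by multiplication by a nonzerodivisor. -/
theorem exists_connecting_lsmul {J : Ideal R} {x : R} (h : ∀ m : M, x • m = 0 → m = 0) (i : ℕ) :
    ∃ δ : LocCoh J i (M ⧸ LinearMap.range (LinearMap.lsmul R M x)) →ₗ[R] LocCoh J (i + 1) M,
      LinearMap.ker δ = LinearMap.range (map J i (LinearMap.range (LinearMap.lsmul R M x)).mkQ) ∧
      LinearMap.range δ = LinearMap.ker (LinearMap.lsmul R (LocCoh J (i + 1) M) x) ∧
      LinearMap.ker (map J i (LinearMap.range (LinearMap.lsmul R M x)).mkQ) =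
        LinearMap.range (LinearMap.lsmul R (LocCoh J i M) x) := by
  have hinj : Function.Injective (LinearMap.lsmul R M x) := (injective_iff_map_eq_zero _).2 h
  have hex := LinearMap.exact_map_mkQ_range (LinearMap.lsmul R M x)
  have hs := Submodule.mkQ_surjective (LinearMap.range (LinearMap.lsmul R M x))
  obtain ⟨δ, h₁, h₂⟩ := exists_connecting (J := J) hinj hex hs i
  refine ⟨δ, LinearMap.exact_iff.1 h₁, ?_, ?_⟩
  · rw [map_lsmul] at h₂
    exact (LinearMap.exact_iff.1 h₂).symm
  · have := exact_map (J := J) hinj hex hs i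
    rw [map_lsmul] at this
    exact LinearMap.exact_iff.1 this

end

variable [IsNoetherianRing R]

theorem _root_.IsParamSeq.locCoh {l : List R} {M : Type u} [AddCommGroup M] [Module R M]
    (h : IsParamSeq l M) (J : Ideal R) (i : ℕ) : IsParamSeq l (LocCoh J i M) :=
  h.of_le fun _ hr => Module.mem_annihilator.2
    (smul_eq_zero_of_smul_eq_zero (Module.mem_annihilator.1 hr))

theorem _root_.Submodule.smul_injective_quotient {M : Type*} [AddCommGroup M] [Module R M] {x : R}
    {N : Submodule R M} (h : ∀ m, x • m ∈ N → m ∈ N) (m : M ⧸ N) (hm : x • m = 0) : m = 0 := by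
  obtain ⟨m, rfl⟩ := Submodule.Quotient.mk_surjective _ m
  rw [← Submodule.Quotient.mk_smul, Submodule.Quotient.mk_eq_zero] at hm
  rw [Submodule.Quotient.mk_eq_zero]
  exact h m hm

theorem _root_.IsParamSeq.quotRange {x : R} {l : List R} {M : Type*} [AddCommGroup M] [Module R M]
    (h : IsParamSeq (x :: l) M) :
    IsParamSeq l (M ⧸ LinearMap.range (LinearMap.lsmul R M x)) := by
  refine (h.of_surjective (LinearMap.range (LinearMap.lsmul R M x)).mkQ
    (Submodule.mkQ_surjective _)).tail (k := 1) fun m => ?_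
  obtain ⟨m, rfl⟩ := Submodule.Quotient.mk_surjective _ m
  rw [pow_one, ← Submodule.Quotient.mk_smul, Submodule.Quotient.mk_eq_zero]
  exact ⟨m, rfl⟩

/-- After removing `x`-power torsion, the kernel of `x` on local cohomology is an image of
cohomology of the quotient by `x`, which vanishes by induction. Since every class is killed by a
power of `x`, a zero kernel forces vanishing. -/
theorem subsingleton_of_isParamSeq (l : List R) (hl : ∀ x ∈ l, x ∈ maximalIdeal R) {M : Type u}
    [AddCommGroup M] [Module R M] [Module.Finite R M] (hM : IsParamSeq l M) {i : ℕ}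
    (hi : l.length ≤ i) : Subsingleton (LocCoh (maximalIdeal R) (i + 1) M) := by
  induction l generalizing M i with
  | nil =>
    obtain ⟨k, hk⟩ := hM.exists_pow_smul_eq_zero
    exact subsingleton_of_torsion i fun m => ⟨k, fun r hr => hk r hr m⟩
  | cons x l ih =>
    have hl' : ∀ y ∈ l, y ∈ maximalIdeal R := fun y hy => hl y (List.mem_cons_of_mem x hy)
    obtain ⟨i, rfl⟩ : ∃ j, i = j + 1 := Nat.exists_eq_succ_of_ne_zero (by simp at hi; omega)
    have hi' : l.length ≤ i := by simpa using hi
    obtain ⟨N, k, hk, hN⟩ := Submodule.exists_pow_smul_saturation (M := M) x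
    have hN1 : Subsingleton (LocCoh (maximalIdeal R) (i + 1 + 1) N) := by
      refine ih hl' ((hM.of_injective N.subtype N.injective_subtype).tail (k := k) fun n => ?_)
        (hi'.trans (Nat.le_succ i))
      exact Subtype.ext (hk n n.2)
    have hQ : Subsingleton (LocCoh (maximalIdeal R) (i + 1)
        ((M ⧸ N) ⧸ LinearMap.range (LinearMap.lsmul R (M ⧸ N) x))) :=
      ih hl' (hM.of_surjective N.mkQ N.mkQ_surjective).quotRange hi'
    have hM' : Subsingleton (LocCoh (maximalIdeal R) (i + 1 + 1) (M ⧸ N)) := by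
      obtain ⟨δ, -, h2, -⟩ := exists_connecting_lsmul (J := maximalIdeal R)
        (Submodule.smul_injective_quotient hN) (i + 1)
      refine subsingleton_of_smul_injective (hl x List.mem_cons_self) fun z hz => ?_
      obtain ⟨w, rfl⟩ : z ∈ LinearMap.range δ := h2 ▸ hz
      rw [Subsingleton.elim w 0, map_zero]
    have hex := exact_map (J := maximalIdeal R) N.injective_subtype
      (LinearMap.exact_subtype_mkQ N) N.mkQ_surjective (i + 1 + 1)
    refine subsingleton_of_forall_eq 0 fun z => ?_
    obtain ⟨w, rfl⟩ := (hex z).1 (Subsingleton.elim _ _)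
    rw [Subsingleton.elim w 0, map_zero]

/-- The same reduction leaves an Artinian kernel of `x`, and `isArtinian_of_ker_lsmul` passes from
the kernel to the whole module. -/
theorem isArtinian_of_isParamSeq (l : List R) (hl : ∀ x ∈ l, x ∈ maximalIdeal R) {M : Type u}
    [AddCommGroup M] [Module R M] [Module.Finite R M] (hM : IsParamSeq l M) (i : ℕ) :
    IsArtinian R (LocCoh (maximalIdeal R) i M) := by
  induction l generalizing M i with
  | nil =>
    obtain ⟨k, hk⟩ := hM.exists_pow_smul_eq_zero
    cases i with
    | zero =>
      have : IsNoetherian R M := inferInstance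
      have : IsArtinian R M := (isNoetherian_iff_isArtinian_of_pow_smul hk).1 this
      exact isArtinian_of_injective (zeroι (maximalIdeal R) M) zeroι_injective
    | succ i =>
      have := subsingleton_of_torsion (J := maximalIdeal R) (M := M) i
        fun m => ⟨k, fun r hr => hk r hr m⟩
      infer_instance
  | cons x l ih =>
    have hl' : ∀ y ∈ l, y ∈ maximalIdeal R := fun y hy => hl y (List.mem_cons_of_mem x hy)
    obtain ⟨N, k, hk, hN⟩ := Submodule.exists_pow_smul_saturation (M := M) x
    have hN1 : IsArtinian R (LocCoh (maximalIdeal R) i N) := by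
      refine ih hl' ((hM.of_injective N.subtype N.injective_subtype).tail (k := k) fun n => ?_) i
      exact Subtype.ext (hk n n.2)
    have hM' : IsArtinian R (LocCoh (maximalIdeal R) i (M ⧸ N)) := by
      cases i with
      | zero =>
        have := subsingleton_zero_of_injective (hl x List.mem_cons_self)
          (Submodule.smul_injective_quotient hN)
        infer_instance
      | succ i =>
        obtain ⟨δ, -, h2, -⟩ := exists_connecting_lsmul (J := maximalIdeal R)
          (Submodule.smul_injective_quotient hN) i
        have := ih hl' (hM.of_surjective N.mkQ N.mkQ_surjective).quotRange i
        have : IsArtinian R (LinearMap.range δ) := inferInstance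
        rw [h2] at this
        exact isArtinian_of_ker_lsmul x
          (fun z => exists_pow_smul_eq_zero_of_mem (hl x List.mem_cons_self) z)
    exact isArtinian_of_range_eq_ker _ _ (LinearMap.exact_iff.1 (exact_map (J := maximalIdeal R)
      N.injective_subtype (LinearMap.exact_subtype_mkQ N) N.mkQ_surjective i)).symm

/-- The kernel of `φ` and the image of `δ` are killed by a power of `x`, hence do not contribute. -/
theorem koszulChar_eq_of_pow_smul (x : R) (l : List R) {A₀ A B C₀ : Type u}
    [AddCommGroup A₀] [Module R A₀] [AddCommGroup A] [Module R A] [AddCommGroup B] [Module R B]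
    [AddCommGroup C₀] [Module R C₀] {α : A₀ →ₗ[R] A} {φ : A →ₗ[R] B} {δ : B →ₗ[R] C₀}
    (h₁ : Function.Exact α φ) (h₂ : Function.Exact φ δ)
    (hA : KoszulAdmissible (x :: l) A) (hB : KoszulAdmissible (x :: l) B) {k : ℕ}
    (hA₀ : ∀ a : A₀, x ^ k • a = 0) (hC₀ : ∀ c : C₀, x ^ k • c = 0) :
    koszulChar (x :: l) A = koszulChar (x :: l) B := by
  rw [koszulChar_eq_ker_add_range _ φ hA, koszulChar_eq_ker_add_range _ δ hB,
    LinearMap.exact_iff.1 h₁, LinearMap.exact_iff.1 h₂,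
    koszulChar_cons_of_pow_smul_eq_zero x l (M := LinearMap.range α) (k := k) ?_ ?_,
    koszulChar_cons_of_pow_smul_eq_zero x l (M := LinearMap.range δ) (k := k) ?_ ?_, zero_add,
    add_zero]
  · exact hB.of_surjective δ.rangeRestrict δ.surjective_rangeRestrict
  · rintro ⟨_, b, rfl⟩
    exact Subtype.ext (hC₀ (δ b))
  · exact hA.of_injective (LinearMap.range α).subtype (Submodule.injective_subtype _)
  · rintro ⟨_, a, rfl⟩
    exact Subtype.ext (by
      change x ^ k • α a = 0
      rw [← map_smul, hA₀, map_zero])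

end LocCoh

/-! ### Euler characteristic of local cohomology -/

namespace LocCoh

open IsLocalRing

variable {R : Type u} [CommRing R] [IsLocalRing R] [IsNoetherianRing R]

theorem koszulAdmissible {l : List R} (hl : ∀ x ∈ l, x ∈ maximalIdeal R) {M : Type u}
    [AddCommGroup M] [Module R M] [Module.Finite R M] (hM : IsParamSeq l M) (i : ℕ) :
    KoszulAdmissible l (LocCoh (maximalIdeal R) i M) :=
  ⟨Or.inr (isArtinian_of_isParamSeq l hl hM i), hM.locCoh _ i⟩

/-- Additivity on `0 → H^i(M)/x → H^i(M/xM) → ker(x on H^{i+1}(M)) → 0`. -/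
theorem koszulChar_quotRange (x : R) (l : List R) (hl : ∀ y ∈ x :: l, y ∈ maximalIdeal R)
    {M : Type u} [AddCommGroup M] [Module R M] [Module.Finite R M] (hM : IsParamSeq (x :: l) M)
    (h : ∀ m : M, x • m = 0 → m = 0) (i : ℕ) :
    koszulChar l (LocCoh (maximalIdeal R) i (M ⧸ LinearMap.range (LinearMap.lsmul R M x))) =
      koszulChar l (LocCoh (maximalIdeal R) i M ⧸
        LinearMap.range (LinearMap.lsmul R (LocCoh (maximalIdeal R) i M) x)) +
      koszulChar l (LinearMap.ker (LinearMap.lsmul R (LocCoh (maximalIdeal R) (i + 1) M) x)) := by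
  obtain ⟨δ, h1, h2, h3⟩ := exists_connecting_lsmul (J := maximalIdeal R) h i
  rw [koszulChar_eq_ker_add_range l δ
    (koszulAdmissible (fun y hy => hl y (List.mem_cons_of_mem x hy)) hM.quotRange i), h1, h2, ← h3]
  congr 1
  exact (LinearMap.quotKerEquivRange _).symm.koszulChar_eq l

/-- Induction on `l`, with `x` made a nonzerodivisor by factoring out its power torsion. Vanishing
below the top degree comes for free from nonnegativity on Artinian modules: a sum of nonnegative
terms is zero by induction, so each term is. -/
theorem koszulChar_eq (l : List R) (hl : ∀ x ∈ l, x ∈ maximalIdeal R) {M : Type u}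
    [AddCommGroup M] [Module R M] [Module.Finite R M] (hM : IsParamSeq l M) :
    (∀ i < l.length, koszulChar l (LocCoh (maximalIdeal R) i M) = 0) ∧
      koszulChar l (LocCoh (maximalIdeal R) l.length M) = (-1) ^ l.length * koszulChar l M := by
  induction l generalizing M with
  | nil =>
    obtain ⟨k, hk⟩ := hM.exists_pow_smul_eq_zero
    refine ⟨fun i hi => absurd hi (Nat.not_lt_zero i), ?_⟩
    rw [List.length_nil, pow_zero, one_mul]
    exact (zeroEquiv fun m => ⟨k, fun r hr => hk r hr m⟩).koszulChar_eq []
  | cons x l ih =>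
    have hl' : ∀ y ∈ l, y ∈ maximalIdeal R := fun y hy => hl y (List.mem_cons_of_mem x hy)
    obtain ⟨N, k, hk, hN⟩ := Submodule.exists_pow_smul_saturation (M := M) x
    have hM' := hM.of_surjective N.mkQ N.mkQ_surjective
    have hkN : ∀ n : N, x ^ k • n = 0 := fun n => Subtype.ext (hk n n.2)
    have hx := Submodule.smul_injective_quotient hN
    have hA : ∀ i, koszulChar (x :: l) (LocCoh (maximalIdeal R) i M) =
        koszulChar (x :: l) (LocCoh (maximalIdeal R) i (M ⧸ N)) := fun i => by
      obtain ⟨δ, h1, -⟩ := exists_connecting (J := maximalIdeal R) N.injective_subtype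
        (LinearMap.exact_subtype_mkQ N) N.mkQ_surjective i
      exact koszulChar_eq_of_pow_smul x l (exact_map (J := maximalIdeal R) N.injective_subtype
        (LinearMap.exact_subtype_mkQ N) N.mkQ_surjective i) h1 (koszulAdmissible hl hM i)
        (koszulAdmissible hl hM' i) (smul_eq_zero_of_smul_eq_zero hkN)
        (smul_eq_zero_of_smul_eq_zero hkN)
    have hMa : KoszulAdmissible (x :: l) M := ⟨Or.inl inferInstance, hM⟩
    have hB : koszulChar (x :: l) M = koszulChar (x :: l) (M ⧸ N) := by
      rw [koszulChar_eq_add (x :: l) hMa N.injective_subtype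
        (LinearMap.exact_subtype_mkQ N) N.mkQ_surjective, koszulChar_cons_of_pow_smul_eq_zero x l
        (hMa.of_injective N.subtype N.injective_subtype) hkN, zero_add]
    have hC : koszulChar (x :: l) M = - koszulChar l
        ((M ⧸ N) ⧸ LinearMap.range (LinearMap.lsmul R (M ⧸ N) x)) := by
      rw [hB, koszulChar_cons_of_injective x l hx]
    obtain ⟨ih1, ih2⟩ := ih hl' hM'.quotRange
    let a : ℕ → ℤ := fun i => koszulChar l
      (LinearMap.ker (LinearMap.lsmul R (LocCoh (maximalIdeal R) i (M ⧸ N)) x))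
    let b : ℕ → ℤ := fun i => koszulChar l (LocCoh (maximalIdeal R) i (M ⧸ N) ⧸
      LinearMap.range (LinearMap.lsmul R (LocCoh (maximalIdeal R) i (M ⧸ N)) x))
    have hD : ∀ i, koszulChar (x :: l) (LocCoh (maximalIdeal R) i M) = a i - b i := fun i => by
      rw [hA, koszulChar_cons]
    have hab := koszulChar_quotRange x l hl hM' hx
    have hadm := fun i => koszulAdmissible hl hM' i
    have hart := fun i => isArtinian_of_isParamSeq (x :: l) hl hM' i
    have ha : ∀ i, 0 ≤ a i := fun i => koszulChar_nonneg l inferInstance (hadm i).ker.2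
    have hb : ∀ i, 0 ≤ b i := fun i => koszulChar_nonneg l inferInstance (hadm i).quot.2
    have hba : ∀ i < l.length, b i = 0 ∧ a (i + 1) = 0 := fun i hi => by
      have h1 : 0 = b i + a (i + 1) := (ih1 i hi).symm.trans (hab i)
      have := ha (i + 1)
      have := hb i
      omega
    have ha0 : a 0 = 0 := by
      have := subsingleton_zero_of_injective (hl x List.mem_cons_self) hx
      exact koszulChar_eq_zero_of_subsingleton _ _
    have ha' : ∀ i ≤ l.length, a i = 0 := fun i hi => by
      cases i with
      | zero => exact ha0
      | succ i => exact (hba i hi).2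
    -- Here `a` is zero, so the nonnegative Euler characteristic equals `-b`, while `b` is
    -- nonnegative too.
    have hbd : b l.length = 0 := by
      have h1 := koszulChar_nonneg (x :: l) (isArtinian_of_isParamSeq (x :: l) hl hM l.length)
        (hM.locCoh _ l.length)
      rw [hD, ha' _ le_rfl] at h1
      have := hb l.length
      omega
    -- `l` alone is a parameter sequence on the quotient by `x`, whose cohomology therefore vanishes
    -- in degree `l.length + 1`.
    have hbd' : b (l.length + 1) = 0 := by
      have := subsingleton_of_isParamSeq l hl' hM'.quotRange le_rfl
      have h1 := hab (l.length + 1)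
      rw [koszulChar_eq_zero_of_subsingleton] at h1
      have h2 : 0 = b (l.length + 1) + a (l.length + 1 + 1) := h1
      have := ha (l.length + 1 + 1)
      have := hb (l.length + 1)
      omega
    refine ⟨fun i hi => ?_, ?_⟩
    · rw [hD, ha' i (Nat.le_of_lt_succ hi)]
      rcases (Nat.le_of_lt_succ hi).lt_or_eq with h | h
      · rw [(hba i h).1, sub_zero]
      · rw [h, hbd, sub_zero]
    · have h1 := hab l.length
      rw [ih2] at h1
      have h2 : (-1) ^ l.length * koszulChar l
        ((M ⧸ N) ⧸ LinearMap.range (LinearMap.lsmul R (M ⧸ N) x)) = b l.length + a (l.length + 1) := h1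
      rw [List.length_cons, hD, hbd', sub_zero, hC, pow_succ, mul_neg_one, neg_mul_neg, h2, hbd,
        zero_add]

end LocCoh

/-! ### Systems of parameters and Krull dimension -/

section Parameters

open IsLocalRing

variable {R : Type u} [CommRing R]

theorem exists_isPrime_le_ringKrullDim_quotient (I : Ideal R) {n : ℕ}
    (h : (n : WithBot ℕ∞) ≤ ringKrullDim (R ⧸ I)) :
    ∃ P : Ideal R, P.IsPrime ∧ I ≤ P ∧ (n : WithBot ℕ∞) ≤ ringKrullDim (R ⧸ P) := by
  rw [ringKrullDim_quotient] at h
  obtain ⟨s, hs⟩ := Order.le_krullDim_iff.1 h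
  refine ⟨s.head.1.asIdeal, s.head.1.isPrime, s.head.2, ?_⟩
  rw [ringKrullDim_quotient, Order.le_krullDim_iff]
  refine ⟨⟨s.length, fun i => ⟨(s i).1, ?_⟩, fun i => s.step i⟩, hs⟩
  exact (LTSeries.head_le s i : (s.head).1 ≤ (s i).1)

theorem Ideal.ofList_map_comap {S : Type*} [CommRing S] {f : R →+* S}
    (hf : Function.Surjective f) {g : S → R} (hg : ∀ s, f (g s) = s) (l : List S) (r : R) :
    f r ∈ Ideal.ofList l ↔ r ∈ Ideal.ofList (l.map g) ⊔ RingHom.ker f := by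
  have : Ideal.ofList l = (Ideal.ofList (l.map g)).map f := by
    rw [Ideal.map_ofList, List.map_map]
    congr 1
    conv_lhs => rw [← List.map_id l]
    exact List.map_congr_left fun s _ => (hg s).symm
  rw [this, ← Ideal.mem_comap, Ideal.comap_map_of_surjective' f hf]

variable [IsNoetherianRing R] [IsLocalRing R]

theorem exists_list_length_eq_ringKrullDim (I : Ideal R) (hI : I ≠ ⊤) :
    ∃ l : List R, (∀ x ∈ l, x ∈ maximalIdeal R) ∧
      (l.length : WithBot ℕ∞) = ringKrullDim (R ⧸ I) ∧ IsParamSeq l (R ⧸ I) := by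
  have : Nontrivial (R ⧸ I) := Ideal.Quotient.nontrivial_iff.2 hI
  have hloc : IsLocalRing (R ⧸ I) :=
    IsLocalRing.of_surjective' (Ideal.Quotient.mk I) Ideal.Quotient.mk_surjective
  have hlh : IsLocalHom (Ideal.Quotient.mk I) :=
    IsLocalHom.of_surjective _ Ideal.Quotient.mk_surjective
  obtain ⟨s, hs, hc⟩ := (maximalIdeal (R ⧸ I)).exists_finset_card_eq_height_of_isNoetherianRing
  choose g hg using (Ideal.Quotient.mk_surjective : Function.Surjective (Ideal.Quotient.mk I))
  have hsl : Ideal.span (s : Set (R ⧸ I)) = Ideal.ofList s.toList := by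
    simp [Ideal.ofList]
  refine ⟨s.toList.map g, ?_, ?_, ?_⟩
  · intro x hx
    obtain ⟨y, hy, rfl⟩ := List.mem_map.1 hx
    have : Ideal.Quotient.mk I (g y) ∈ maximalIdeal (R ⧸ I) := by
      rw [hg]
      exact hs.1.2 (Ideal.subset_span (Finset.mem_toList.1 hy))
    rwa [← maximalIdeal_comap (Ideal.Quotient.mk I)]
  · rw [List.length_map, Finset.length_toList, ← maximalIdeal_height_eq_ringKrullDim, ← hc]
    rfl
  · intro r hr
    have h1 : Ideal.Quotient.mk I r ∈ maximalIdeal (R ⧸ I) := map_nonunit _ r hr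
    have h2 : maximalIdeal (R ⧸ I) ≤ (Ideal.span (s : Set (R ⧸ I))).radical := by
      rw [Ideal.radical_eq_sInf]
      exact le_sInf fun J hJ => hs.2 ⟨hJ.2, hJ.1⟩ (le_maximalIdeal hJ.2.ne_top)
    obtain ⟨n, hn⟩ := h2 h1
    rw [← map_pow, hsl, Ideal.ofList_map_comap Ideal.Quotient.mk_surjective hg,
      Ideal.mk_ker] at hn
    exact ⟨n, by rwa [Ideal.annihilator_quotient]⟩

/-- Krull's height theorem: the maximal ideal of `R ⧸ I` is minimal over the image of `l`. -/
theorem IsParamSeq.ringKrullDim_le {l : List R} {I : Ideal R} (hI : I ≠ ⊤) (h : IsParamSeq l (R ⧸ I))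
    (hl : ∀ x ∈ l, x ∈ maximalIdeal R) : ringKrullDim (R ⧸ I) ≤ l.length := by
  classical
  have : Nontrivial (R ⧸ I) := Ideal.Quotient.nontrivial_iff.2 hI
  have hloc : IsLocalRing (R ⧸ I) :=
    IsLocalRing.of_surjective' (Ideal.Quotient.mk I) Ideal.Quotient.mk_surjective
  have hlh : IsLocalHom (Ideal.Quotient.mk I) :=
    IsLocalHom.of_surjective _ Ideal.Quotient.mk_surjective
  have hm : ∀ r ∈ maximalIdeal R, Ideal.Quotient.mk I r ∈ maximalIdeal (R ⧸ I) := map_nonunit _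
  have h1 : maximalIdeal (R ⧸ I) ∈
      (Ideal.span ((l.map (Ideal.Quotient.mk I)).toFinset : Set (R ⧸ I))).minimalPrimes := by
    refine ⟨⟨inferInstance, ?_⟩, fun J hJ _ => ?_⟩
    · rw [Ideal.span_le]
      intro y hy
      obtain ⟨x, hx, rfl⟩ := List.mem_map.1 (List.mem_toFinset.1 hy)
      exact hm x (hl x hx)
    · intro y hy
      obtain ⟨r, rfl⟩ := Ideal.Quotient.mk_surjective y
      have hr : r ∈ maximalIdeal R := by rwa [← maximalIdeal_comap (Ideal.Quotient.mk I)]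
      obtain ⟨n, hn⟩ := h hr
      rw [Ideal.annihilator_quotient] at hn
      have h2 := Ideal.mem_map_of_mem (Ideal.Quotient.mk I) hn
      rw [Ideal.map_sup, Ideal.map_quotient_self, sup_bot_eq, Ideal.map_ofList, map_pow] at h2
      refine hJ.1.mem_of_pow_mem n (hJ.2 ?_)
      convert h2 using 1
      simp [Ideal.ofList]
  have h2 := Ideal.height_le_card_of_mem_minimalPrimes_span_finset h1
  rw [← maximalIdeal_height_eq_ringKrullDim]
  refine (WithBot.coe_le_coe.2 (h2.trans (Nat.cast_le.2 (List.toFinset_card_le _)))).trans ?_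
  rw [List.length_map]
  rfl

theorem ringKrullDim_quotient_le_quotient_sup_add_one (I : Ideal R) {x : R}
    (hx : x ∈ maximalIdeal R) :
    ringKrullDim (R ⧸ I) ≤ ringKrullDim (R ⧸ I ⊔ Ideal.span {x}) + 1 := by
  by_cases hI : I = ⊤
  · have : Subsingleton (R ⧸ I) := Ideal.Quotient.subsingleton_iff.2 hI
    rw [ringKrullDim_eq_bot_of_subsingleton]
    exact bot_le
  have : Nontrivial (R ⧸ I) := Ideal.Quotient.nontrivial_iff.2 hI
  have hloc : IsLocalRing (R ⧸ I) :=
    IsLocalRing.of_surjective' (Ideal.Quotient.mk I) Ideal.Quotient.mk_surjective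
  have h1 := ringKrullDim_le_ringKrullDim_quotient_add_card {Ideal.Quotient.mk I x} (by
    rw [IsLocalRing.ringJacobson_eq_maximalIdeal, Finset.coe_singleton, Set.singleton_subset_iff]
    have hlh : IsLocalHom (Ideal.Quotient.mk I) :=
      IsLocalHom.of_surjective _ Ideal.Quotient.mk_surjective
    exact map_nonunit _ x hx)
  rw [Finset.coe_singleton, Finset.card_singleton, ← Set.image_singleton, ← Ideal.map_span,
    ringKrullDim_eq_of_ringEquiv (DoubleQuot.quotQuotEquivQuotSup I (Ideal.span {x}))] at h1
  exact_mod_cast h1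

end Parameters

/-! ### Multiplicities of finitely generated modules -/

section Multiplicity

open IsLocalRing

variable {R : Type u} [CommRing R]

/-- The Euler characteristic of a module with respect to a sequence, with the sign that makes it
nonnegative on finitely generated modules. -/
noncomputable def koszulMult (l : List R) (M : Type v) [AddCommGroup M] [Module R M] : ℤ :=
  (-1) ^ l.length * koszulChar l M

theorem LinearEquiv.koszulMult_eq (l : List R) {M N : Type*} [AddCommGroup M]
    [Module R M] [AddCommGroup N] [Module R N] (e : M ≃ₗ[R] N) :
    koszulMult l M = koszulMult l N := by
  rw [koszulMult, koszulMult, e.koszulChar_eq]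

theorem koszulMult_eq_zero_of_subsingleton (l : List R) (M : Type v) [AddCommGroup M] [Module R M]
    [Subsingleton M] : koszulMult l M = 0 := by
  rw [koszulMult, koszulChar_eq_zero_of_subsingleton, mul_zero]

/-- The quotient of `R ⧸ I` by the multiples of `x`. -/
noncomputable def Ideal.quotientQuotRangeLsmul (I : Ideal R) (x : R) :
    ((R ⧸ I) ⧸ LinearMap.range (LinearMap.lsmul R (R ⧸ I) x)) ≃ₗ[R] R ⧸ I ⊔ Ideal.span {x} :=
  LinearEquiv.symm <| (Submodule.quotEquivOfEq _ _ (by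
    ext r
    rw [LinearMap.mem_ker, LinearMap.comp_apply, Submodule.mkQ_apply, Submodule.mkQ_apply,
      Submodule.Quotient.mk_eq_zero, Submodule.mem_sup]
    constructor
    · rintro ⟨a, ha, b, hb, rfl⟩
      obtain ⟨c, rfl⟩ := Ideal.mem_span_singleton'.1 hb
      refine ⟨Submodule.Quotient.mk c, ?_⟩
      rw [LinearMap.lsmul_apply, ← Submodule.Quotient.mk_smul, Submodule.Quotient.eq]
      have : x • c - (a + c * x) = -a := by rw [smul_eq_mul]; ring
      rw [this]
      exact neg_mem ha
    · rintro ⟨c, hc⟩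
      obtain ⟨c, rfl⟩ := Submodule.Quotient.mk_surjective _ c
      rw [LinearMap.lsmul_apply, ← Submodule.Quotient.mk_smul, Submodule.Quotient.eq] at hc
      refine ⟨r - x • c, by simpa using neg_mem hc, c * x, Ideal.mem_span_singleton'.2 ⟨c, rfl⟩, ?_⟩
      rw [smul_eq_mul]; ring)).trans
    (LinearMap.quotKerEquivOfSurjective
      ((LinearMap.range (LinearMap.lsmul R (R ⧸ I) x)).mkQ ∘ₗ Submodule.mkQ I)
      ((Submodule.mkQ_surjective _).comp (Submodule.mkQ_surjective _)))

variable [IsLocalRing R] [IsNoetherianRing R]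

theorem koszulMult_eq_add {l : List R} {M N P : Type v} [AddCommGroup M] [Module R M]
    [AddCommGroup N] [Module R N] [AddCommGroup P] [Module R P] {f : M →ₗ[R] N} {g : N →ₗ[R] P}
    (hN : KoszulAdmissible l N)
    (hf : Function.Injective f) (hfg : Function.Exact f g) (hg : Function.Surjective g) :
    koszulMult l N = koszulMult l M + koszulMult l P := by
  rw [koszulMult, koszulChar_eq_add l hN hf hfg hg, mul_add]; rfl

variable {l : List R} (hl : ∀ x ∈ l, x ∈ maximalIdeal R)
include hl

theorem koszulMult_eq_koszulChar {M : Type u} [AddCommGroup M] [Module R M] [Module.Finite R M]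
    (hM : IsParamSeq l M) :
    koszulMult l M = koszulChar l (LocCoh (maximalIdeal R) l.length M) :=
  (LocCoh.koszulChar_eq l hl hM).2.symm

/-- Computed on the top local cohomology, which is Artinian, the Euler characteristic is
nonnegative. -/
theorem koszulMult_nonneg {M : Type u} [AddCommGroup M] [Module R M] [Module.Finite R M]
    (hM : IsParamSeq l M) : 0 ≤ koszulMult l M :=
  koszulMult_eq_koszulChar hl hM ▸ koszulChar_nonneg l (LocCoh.isArtinian_of_isParamSeq l hl hM _)
    (hM.locCoh _ _)

theorem koszulMult_le_of_surjective {M N : Type u} [AddCommGroup M] [Module R M] [Module.Finite R M]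
    [AddCommGroup N] [Module R N] (hM : IsParamSeq l M) {f : M →ₗ[R] N}
    (hf : Function.Surjective f) : koszulMult l N ≤ koszulMult l M := by
  rw [koszulMult_eq_add ⟨Or.inl inferInstance, hM⟩ (LinearMap.ker f).injective_subtype
    (LinearMap.exact_subtype_ker_map f) hf]
  have := koszulMult_nonneg hl (M := LinearMap.ker f) (hM.of_injective (LinearMap.ker f).subtype
    (LinearMap.ker f).injective_subtype)
  omega

/-- Pass to a domain `R ⧸ P` of large enough dimension. The first parameter is a nonzerodivisor
there, and dividing by it lowers the dimension by at most one, so induction ends at a nonzero module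
of finite length. -/
theorem koszulMult_quotient_pos {I : Ideal R} (hI : (l.length : WithBot ℕ∞) ≤ ringKrullDim (R ⧸ I))
    (h : IsParamSeq l (R ⧸ I)) : 0 < koszulMult l (R ⧸ I) := by
  induction l generalizing I with
  | nil =>
    have hne : Nontrivial (R ⧸ I) := by
      by_contra hc
      rw [not_nontrivial_iff_subsingleton] at hc
      rw [ringKrullDim_eq_bot_of_subsingleton] at hI
      simp at hI
    have h1 : KoszulAdmissible ([] : List R) (R ⧸ I) := ⟨Or.inl inferInstance, h⟩
    obtain ⟨_, _⟩ := h1.isFiniteLength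
    have h2 : Module.length R (R ⧸ I) ≠ ⊤ := Module.length_ne_top
    have h3 : Module.length R (R ⧸ I) ≠ 0 := by
      rw [Ne, Module.length_eq_zero_iff]
      exact not_subsingleton _
    rw [koszulMult, koszulChar_nil, List.length_nil, pow_zero, one_mul]
    have := ENat.toNat_eq_zero.not.2 (not_or.2 ⟨h3, h2⟩)
    omega
  | cons x l ih =>
    have hl' : ∀ y ∈ l, y ∈ maximalIdeal R := fun y hy => hl y (List.mem_cons_of_mem x hy)
    obtain ⟨P, hP, hIP, hdim⟩ := exists_isPrime_le_ringKrullDim_quotient I hI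
    have hs : Function.Surjective (Submodule.factor hIP) := Submodule.factor_surjective hIP
    refine lt_of_lt_of_le ?_ (koszulMult_le_of_surjective hl h hs)
    have hPp := h.of_surjective _ hs
    -- Otherwise `l` alone would be a parameter sequence on `R ⧸ P`, which is too short for its
    -- dimension.
    have hxP : x ∉ P := fun hx => by
      have h1 : IsParamSeq l (R ⧸ P) := by
        refine hPp.tail (k := 1) fun m => ?_
        obtain ⟨m, rfl⟩ := Submodule.Quotient.mk_surjective _ m
        rw [pow_one, ← Submodule.Quotient.mk_smul, Submodule.Quotient.mk_eq_zero]
        exact P.mul_mem_right _ hx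
      have h2 := hdim.trans (h1.ringKrullDim_le hP.ne_top hl')
      rw [List.length_cons] at h2
      have h3 : l.length + 1 ≤ l.length := by exact_mod_cast h2
      omega
    have hinj : ∀ m : R ⧸ P, x • m = 0 → m = 0 := fun m hm => by
      obtain ⟨m, rfl⟩ := Submodule.Quotient.mk_surjective _ m
      rw [← Submodule.Quotient.mk_smul, Submodule.Quotient.mk_eq_zero] at hm
      rw [Submodule.Quotient.mk_eq_zero]
      exact (hP.mem_or_mem hm).resolve_left hxP
    have e := Ideal.quotientQuotRangeLsmul P x
    rw [koszulMult, koszulChar_cons_of_injective x l hinj, List.length_cons, pow_succ, mul_neg_one,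
      neg_mul_neg, e.koszulChar_eq l]
    refine ih hl' ?_ (hPp.quotRange.of_surjective e.toLinearMap e.surjective)
    have h2 := hdim.trans (ringKrullDim_quotient_le_quotient_sup_add_one P (hl x List.mem_cons_self))
    rw [List.length_cons, Nat.cast_add, Nat.cast_one] at h2
    by_contra hc
    have h3 := h2.trans (ENat.WithBot.add_one_le_natCast_iff.2 (not_le.1 hc))
    have h4 : l.length + 1 ≤ l.length := by exact_mod_cast h3
    omega

/-- For `y ∈ Q` outside `P`, injectivity of `y` on `R ⧸ P` and additivity give `e(R/(P + (y))) = 0`,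
and `R ⧸ Q` is a quotient of this module. -/
theorem koszulMult_quotient_eq_zero (hR : maximalIdeal R ≤ (Ideal.ofList l).radical) {P Q : Ideal R}
    [P.IsPrime] (hPQ : P < Q) : koszulMult l (R ⧸ Q) = 0 := by
  have hp : ∀ {I : Ideal R}, IsParamSeq l (R ⧸ I) := fun {I} =>
    hR.trans (Ideal.radical_mono le_sup_left)
  obtain ⟨y, hyQ, hyP⟩ := SetLike.exists_of_lt hPQ
  have hinj : ∀ m : R ⧸ P, y • m = 0 → m = 0 := fun m hm => by
    obtain ⟨m, rfl⟩ := Submodule.Quotient.mk_surjective _ m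
    rw [← Submodule.Quotient.mk_smul, Submodule.Quotient.mk_eq_zero] at hm
    rw [Submodule.Quotient.mk_eq_zero]
    exact (Ideal.IsPrime.mem_or_mem ‹_› hm).resolve_left hyP
  have h1 := koszulMult_eq_add (l := l) (f := LinearMap.lsmul R (R ⧸ P) y)
    (g := (LinearMap.range (LinearMap.lsmul R (R ⧸ P) y)).mkQ) ⟨Or.inl inferInstance, hp⟩
    ((injective_iff_map_eq_zero _).2 hinj) (LinearMap.exact_map_mkQ_range _)
    (Submodule.mkQ_surjective _)
  rw [(Ideal.quotientQuotRangeLsmul P y).koszulMult_eq] at h1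
  have h2 : P ⊔ Ideal.span {y} ≤ Q := sup_le hPQ.le (by rwa [Ideal.span_singleton_le_iff_mem])
  have h3 := koszulMult_le_of_surjective hl hp (Submodule.factor_surjective h2)
  have h4 := koszulMult_nonneg hl (M := R ⧸ Q) hp
  omega

end Multiplicity

/-! ### Length of `Hom` into a module with small socle -/

section HomLength

open IsLocalRing

variable {R : Type*} [CommRing R]

section

variable {M N P : Type*} [AddCommGroup M] [Module R M] [AddCommGroup N] [Module R N]
  [AddCommGroup P] [Module R P] (E : Type*) [AddCommGroup E] [Module R E]

theorem LinearMap.lcomp_injective_of_surjective' {g : N →ₗ[R] P} (hg : Function.Surjective g) :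
    Function.Injective (LinearMap.lcomp R E g) := fun φ ψ h =>
  LinearMap.ext fun p => by
    obtain ⟨n, rfl⟩ := hg p
    exact LinearMap.congr_fun h n

theorem LinearMap.exact_subtype_rangeRestrict (g : N →ₗ[R] P) :
    Function.Exact (LinearMap.ker g).subtype g.rangeRestrict := fun m => by
  rw [← LinearMap.mem_ker, LinearMap.ker_rangeRestrict]
  exact ⟨fun h => ⟨⟨m, h⟩, rfl⟩, by rintro ⟨m, rfl⟩; exact m.2⟩

theorem LinearMap.exact_lcomp {f : M →ₗ[R] N} {g : N →ₗ[R] P} (hfg : Function.Exact f g)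
    (hg : Function.Surjective g) :
    Function.Exact (LinearMap.lcomp R E g) (LinearMap.lcomp R E f) := fun φ => by
  constructor
  · intro h
    have h1 : LinearMap.ker g ≤ LinearMap.ker φ := by
      rw [LinearMap.exact_iff.1 hfg]
      rintro _ ⟨m, rfl⟩
      exact LinearMap.congr_fun h m
    refine ⟨(LinearMap.ker g).liftQ φ h1 ∘ₗ (g.quotKerEquivOfSurjective hg).symm.toLinearMap, ?_⟩
    ext n
    have h2 : (g.quotKerEquivOfSurjective hg).symm (g n) = Submodule.Quotient.mk n := by
      rw [LinearEquiv.symm_apply_eq]; rfl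
    change (LinearMap.ker g).liftQ φ h1 ((g.quotKerEquivOfSurjective hg).symm (g n)) = φ n
    rw [h2]; rfl
  · rintro ⟨ψ, rfl⟩
    ext m
    change ψ (g (f m)) = 0
    rw [hfg.apply_apply_eq_zero, map_zero]

end

variable [IsLocalRing R]

/-- Dévissage along simple quotients; only left exactness of `Hom` is available, hence an
inequality. -/
theorem length_hom_le_of_residueField (E : Type*) [AddCommGroup E] [Module R E]
    (hE : Module.length R (ResidueField R →ₗ[R] E) ≤ 1) {M : Type*} [AddCommGroup M] [Module R M]
    (hM : IsFiniteLength R M) : Module.length R (M →ₗ[R] E) ≤ Module.length R M := by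
  induction hM with
  | of_subsingleton => rw [Module.length_eq_zero]; exact bot_le
  | @of_simple_quotient M _ _ N hs hN ih =>
    obtain ⟨I, hI, ⟨e⟩⟩ := isSimpleModule_iff_quot_maximal.1 hs
    obtain rfl := eq_maximalIdeal hI
    have h1 : Module.length R ((M ⧸ N) →ₗ[R] E) ≤ 1 :=
      ((LinearEquiv.congrLeft E R e).length_eq).trans_le hE
    rw [Module.length_eq_add_of_exact N.subtype N.mkQ N.injective_subtype N.mkQ_surjective
      (LinearMap.exact_subtype_mkQ N), Module.length_eq_one R (M ⧸ N),
      Module.length_eq_add_of_exact (LinearMap.ker (LinearMap.lcomp R E N.subtype)).subtype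
      (LinearMap.lcomp R E N.subtype).rangeRestrict (Submodule.injective_subtype _)
      (LinearMap.surjective_rangeRestrict _)
      (LinearMap.exact_subtype_rangeRestrict _), add_comm]
    refine add_le_add ((Module.length_le_of_injective (LinearMap.range _).subtype
      (Submodule.injective_subtype _)).trans ih) ?_
    rw [LinearMap.exact_iff.1 (LinearMap.exact_lcomp E (LinearMap.exact_subtype_mkQ N)
      N.mkQ_surjective)]
    refine (Module.length_le_of_surjective (LinearMap.lcomp R E N.mkQ).rangeRestrict
      (LinearMap.surjective_rangeRestrict _)).trans h1

end HomLength

/-! ### Matlis duality and Euler characteristics -/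

section MatlisDual

open IsLocalRing

variable {R : Type u} [CommRing R] {E : Type u} [AddCommGroup E] [Module R E]
  {M N P : Type u} [AddCommGroup M] [Module R M] [AddCommGroup N] [Module R N]
  [AddCommGroup P] [Module R P]

theorem LinearMap.lcomp_surjective_of_injective [hE : Module.Injective R E] {f : M →ₗ[R] N}
    (hf : Function.Injective f) : Function.Surjective (LinearMap.lcomp R E f) := fun φ =>
  (hE.out f hf φ).imp fun _ h => LinearMap.ext h

/-- The dual of a quotient by multiples of `x` is the kernel of `x` on the dual. -/
theorem nonempty_dual_quotRange_equiv (x : R) : Nonempty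
    (((M ⧸ LinearMap.range (LinearMap.lsmul R M x)) →ₗ[R] E) ≃ₗ[R]
      LinearMap.ker (LinearMap.lsmul R (M →ₗ[R] E) x)) := by
  have h := LinearMap.exact_iff.1 (LinearMap.exact_lcomp E
    (LinearMap.exact_map_mkQ_range (LinearMap.lsmul R M x)) (Submodule.mkQ_surjective _))
  have h2 : LinearMap.lcomp R E (LinearMap.lsmul R M x) = LinearMap.lsmul R (M →ₗ[R] E) x := by
    ext φ m
    exact map_smul φ x m
  rw [h2] at h
  exact ⟨(LinearEquiv.ofInjective _ (LinearMap.lcomp_injective_of_surjective' E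
    (Submodule.mkQ_surjective _))).trans (LinearEquiv.ofEq _ _ h.symm)⟩

/-- The dual of the kernel of `x` is the quotient of the dual by the multiples of `x`. -/
theorem nonempty_dual_ker_equiv [Module.Injective R E] (x : R) : Nonempty
    ((LinearMap.ker (LinearMap.lsmul R M x) →ₗ[R] E) ≃ₗ[R]
      ((M →ₗ[R] E) ⧸ LinearMap.range (LinearMap.lsmul R (M →ₗ[R] E) x))) := by
  let f := (LinearMap.ker (LinearMap.lsmul R M x)).subtype
  have hf : Function.Surjective (LinearMap.lcomp R E f) :=
    LinearMap.lcomp_surjective_of_injective (Submodule.injective_subtype _)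
  have h1 : LinearMap.ker (LinearMap.lcomp R E f) =
      LinearMap.range (LinearMap.lsmul R (M →ₗ[R] E) x) := by
    rw [LinearMap.exact_iff.1 (LinearMap.exact_lcomp E
      (LinearMap.exact_subtype_rangeRestrict (LinearMap.lsmul R M x)) (LinearMap.surjective_rangeRestrict _))]
    refine le_antisymm ?_ ?_
    · rintro _ ⟨ψ, rfl⟩
      obtain ⟨ψ', rfl⟩ := LinearMap.lcomp_surjective_of_injective (E := E)
        (Submodule.injective_subtype (LinearMap.range (LinearMap.lsmul R M x))) ψ
      exact ⟨ψ', LinearMap.ext fun m => (map_smul ψ' x m).symm⟩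
    · rintro _ ⟨ψ, rfl⟩
      exact ⟨ψ ∘ₗ (LinearMap.range (LinearMap.lsmul R M x)).subtype,
        LinearMap.ext fun m => map_smul ψ x m⟩
  exact ⟨((Submodule.quotEquivOfEq _ _ h1.symm).trans
    ((LinearMap.lcomp R E f).quotKerEquivOfSurjective hf)).symm⟩

variable [IsLocalRing R]

theorem IsInjectiveHull.length_hom_residueField {f : ResidueField R →ₗ[R] E}
    (hf : IsInjectiveHull f) : Module.length R (ResidueField R →ₗ[R] E) = 1 := by
  have e : (R ⧸ maximalIdeal R) ≃ₗ[R] (ResidueField R →ₗ[R] E) := by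
    refine LinearEquiv.ofBijective ((maximalIdeal R).liftQ (LinearMap.toSpanSingleton R _ f) ?_) ?_
    · intro r hr
      refine LinearMap.ext fun c => ?_
      have h0 : algebraMap R (ResidueField R) r = 0 := (residue_eq_zero_iff r).2 hr
      change r • f c = 0
      rw [← map_smul, Algebra.smul_def, h0, zero_mul, map_zero]
    · constructor
      · rw [injective_iff_map_eq_zero]
        intro a ha
        obtain ⟨r, rfl⟩ := Submodule.Quotient.mk_surjective _ a
        have h1 : r • f 1 = 0 := LinearMap.congr_fun ha 1
        rw [← map_smul, Algebra.smul_def, mul_one, map_eq_zero_iff f hf.mono] at h1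
        exact (Submodule.Quotient.mk_eq_zero _).2 ((residue_eq_zero_iff r).1 h1)
      · intro φ
        by_cases hφ : LinearMap.range φ = ⊥
        · exact ⟨0, by rw [map_zero, LinearMap.range_eq_bot.1 hφ]⟩
        -- By essentiality a nonzero image meets the line `f(k)`. From `φ a = f b` it follows that
        -- `φ` is `f` times a lift of `b / a`.
        obtain ⟨z, ⟨⟨a, rfl⟩, b, hb⟩, hz⟩ :=
          (Submodule.ne_bot_iff _).1 (mt (hf.essential (LinearMap.range φ)) hφ)
        obtain ⟨r, hr⟩ := residue_surjective (R := R) (b / a)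
        have ha0 : a ≠ 0 := fun h => hz (by rw [h, map_zero])
        refine ⟨Submodule.Quotient.mk r, ?_⟩
        ext c
        obtain ⟨s, hs⟩ := residue_surjective (R := R) (c / a)
        have h2 : c = s • a := by
          rw [Algebra.smul_def]
          change _ = residue R s * a
          rw [hs, div_mul_cancel₀ _ ha0]
        have h3 : r • c = s • b := by
          rw [Algebra.smul_def, Algebra.smul_def]
          change residue R r * c = residue R s * b
          rw [hs, hr]
          field_simp
        change r • f c = φ c
        rw [← map_smul, h3, h2, map_smul, map_smul, hb]
  rw [← e.length_eq, Module.length_eq_one_iff]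
  exact isSimpleModule_iff_quot_maximal.2 ⟨_, inferInstance, ⟨LinearEquiv.refl _ _⟩⟩

theorem IsInjectiveHull.length_hom {f : ResidueField R →ₗ[R] E}
    (hf : IsInjectiveHull f) (hM : IsFiniteLength R M) :
    Module.length R (M →ₗ[R] E) = Module.length R M := by
  have := hf.isInjective
  induction hM with
  | of_subsingleton => rw [Module.length_eq_zero, Module.length_eq_zero]
  | @of_simple_quotient M _ _ N hs hN ih =>
    obtain ⟨I, hI, ⟨e⟩⟩ := isSimpleModule_iff_quot_maximal.1 hs
    obtain rfl := eq_maximalIdeal hI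
    have h1 : Module.length R ((M ⧸ N) →ₗ[R] E) = 1 :=
      ((LinearEquiv.congrLeft E R e).length_eq).trans hf.length_hom_residueField
    rw [Module.length_eq_add_of_exact N.subtype N.mkQ N.injective_subtype N.mkQ_surjective
      (LinearMap.exact_subtype_mkQ N), Module.length_eq_one R (M ⧸ N),
      Module.length_eq_add_of_exact (LinearMap.lcomp R E N.mkQ) (LinearMap.lcomp R E N.subtype)
        (LinearMap.lcomp_injective_of_surjective' E N.mkQ_surjective)
        (LinearMap.lcomp_surjective_of_injective N.injective_subtype)
        (LinearMap.exact_lcomp E (LinearMap.exact_subtype_mkQ N) N.mkQ_surjective),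
      h1, ih, add_comm]

/-- A nonzero finitely generated module maps onto the residue field, which embeds in `E`. -/
theorem IsInjectiveHull.subsingleton_of_hom {f : ResidueField R →ₗ[R] E}
    (hf : IsInjectiveHull f) [Module.Finite R M] (h : Subsingleton (M →ₗ[R] E)) :
    Subsingleton M := by
  by_contra hM
  rw [not_subsingleton_iff_nontrivial] at hM
  obtain ⟨N, hN⟩ := IsCoatomic.exists_coatom (α := Submodule R M)
  have hs : IsSimpleModule R (M ⧸ N) := isSimpleModule_iff_isCoatom.2 hN
  obtain ⟨I, hI, ⟨e⟩⟩ := isSimpleModule_iff_quot_maximal.1 hs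
  obtain rfl := eq_maximalIdeal hI
  have h0 : f ∘ₗ e.toLinearMap ∘ₗ N.mkQ = 0 := Subsingleton.elim _ _
  have h1 : (f ∘ₗ e.toLinearMap ∘ₗ N.mkQ) ((e.surjective.comp N.mkQ_surjective 1).choose) = f 1 :=
    congrArg f (e.surjective.comp N.mkQ_surjective 1).choose_spec
  rw [h0, LinearMap.zero_apply] at h1
  exact one_ne_zero (hf.mono (h1.symm.trans (map_zero f).symm))

/-- Duality exchanges kernel and cokernel of `x`, which costs one sign per parameter. -/
theorem IsInjectiveHull.koszulChar_hom [IsNoetherianRing R] {f : ResidueField R →ₗ[R] E}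
    (hf : IsInjectiveHull f) {l : List R} (hM : KoszulAdmissible l M) :
    koszulChar l (M →ₗ[R] E) = (-1) ^ l.length * koszulChar l M := by
  have := hf.isInjective
  induction l generalizing M with
  | nil =>
    obtain ⟨h1, h2⟩ := hM.isFiniteLength
    rw [koszulChar_nil, koszulChar_nil, hf.length_hom
      (isFiniteLength_iff_isNoetherian_isArtinian.2 ⟨h1, h2⟩), List.length_nil, pow_zero, one_mul]
  | cons x l ih =>
    obtain ⟨e1⟩ := nonempty_dual_quotRange_equiv (M := M) (E := E) x
    obtain ⟨e2⟩ := nonempty_dual_ker_equiv (M := M) (E := E) x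
    rw [koszulChar_cons, koszulChar_cons, ← e1.koszulChar_eq l, ← e2.koszulChar_eq l, ih hM.ker,
      ih hM.quot, List.length_cons]
    ring

end MatlisDual

/-! ### Right exactness in top degree -/

section TopLocalCohomology

open IsLocalRing

variable {R : Type u} [CommRing R] [IsLocalRing R] [IsNoetherianRing R]

/-- Right exactness of the top local cohomology. -/
theorem LocCoh.nonempty_quotRange_equiv {J : Ideal R} {d : ℕ}
    (hd : ∀ (N : Type u) [AddCommGroup N] [Module R N] [Module.Finite R N],
      Subsingleton (LocCoh J (d + 1) N))
    (M : Type u) [AddCommGroup M] [Module R M] [Module.Finite R M] (x : R) :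
    Nonempty ((LocCoh J d M ⧸ LinearMap.range (LinearMap.lsmul R (LocCoh J d M) x)) ≃ₗ[R]
      LocCoh J d (M ⧸ LinearMap.range (LinearMap.lsmul R M x))) := by
  -- Factor `x` as `M → xM → M`. Vanishing of `H^{d+1}` on `ker x` and on `xM` makes `H^d(M)`
  -- surject onto `H^d(xM)` and onto `H^d(M/xM)`.
  let φ := LinearMap.lsmul R M x
  obtain ⟨δ₁, h₁, -⟩ := exists_connecting (J := J) (LinearMap.ker φ).injective_subtype
    (LinearMap.exact_subtype_rangeRestrict φ) φ.surjective_rangeRestrict d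
  obtain ⟨δ₂, h₂, -⟩ := exists_connecting (J := J) (LinearMap.range φ).injective_subtype
    (LinearMap.exact_subtype_mkQ (LinearMap.range φ)) (LinearMap.range φ).mkQ_surjective d
  have h₃ := exact_map (J := J) (LinearMap.range φ).injective_subtype
    (LinearMap.exact_subtype_mkQ (LinearMap.range φ)) (LinearMap.range φ).mkQ_surjective d
  have := hd (LinearMap.ker φ)
  have := hd (LinearMap.range φ)
  have hs : Function.Surjective (map J d (LinearMap.range φ).mkQ) := fun z =>
    (h₂ z).1 (Subsingleton.elim _ _)
  have hr : Function.Surjective (map J d φ.rangeRestrict) := fun z =>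
    (h₁ z).1 (Subsingleton.elim _ _)
  have hk : LinearMap.ker (map J d (LinearMap.range φ).mkQ) =
      LinearMap.range (LinearMap.lsmul R (LocCoh J d M) x) := by
    rw [LinearMap.exact_iff.1 h₃, ← map_lsmul]
    change _ = LinearMap.range (map J d ((LinearMap.range φ).subtype ∘ₗ φ.rangeRestrict))
    rw [map_comp, LinearMap.range_comp_of_range_eq_top _ (LinearMap.range_eq_top.2 hr)]
  exact ⟨(Submodule.quotEquivOfEq _ _ hk.symm).trans
    ((map J d (LinearMap.range φ).mkQ).quotKerEquivOfSurjective hs)⟩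

/-- Generators of `I` are imposed one at a time from the zero ideal: taking the kernel of `x` inside
`W` divides the dual by `x`, which matches dividing `R ⧸ K` by `x` on the side of local cohomology.
-/
theorem nonempty_dual_torsionBySet_equiv {E : Type u} [AddCommGroup E] [Module R E]
    [Module.Injective R E] {J : Ideal R} {d : ℕ}
    (hd : ∀ (N : Type u) [AddCommGroup N] [Module R N] [Module.Finite R N],
      Subsingleton (LocCoh J (d + 1) N))
    {W : Type u} [AddCommGroup W] [Module R W] (h : Nonempty ((W →ₗ[R] E) ≃ₗ[R] LocCoh J d R))
    (I : Ideal R) :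
    Nonempty ((Submodule.torsionBySet R W I →ₗ[R] E) ≃ₗ[R] LocCoh J d (R ⧸ I)) := by
  have key : ∀ I : Ideal R, I.FG → ∀ K : Ideal R,
      Nonempty ((Submodule.torsionBySet R W K →ₗ[R] E) ≃ₗ[R] LocCoh J d (R ⧸ K)) →
      Nonempty ((Submodule.torsionBySet R W (K ⊔ I : Ideal R) →ₗ[R] E) ≃ₗ[R]
        LocCoh J d (R ⧸ K ⊔ I)) := by
    intro I hI
    induction I, hI using Submodule.fg_induction with
    | singleton x =>
      rintro K ⟨e⟩
      obtain ⟨e1⟩ := LocCoh.nonempty_quotRange_equiv hd (R ⧸ K) x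
      obtain ⟨e2⟩ := nonempty_dual_ker_equiv (M := Submodule.torsionBySet R W K) (E := E) x
      have e3 := LocCoh.mapEquiv J d (Ideal.quotientQuotRangeLsmul K x)
      have h4 : (LinearMap.ker (LinearMap.lsmul R (Submodule.torsionBySet R W K) x)).map
          (Submodule.torsionBySet R W K).subtype =
          Submodule.torsionBySet R W (K ⊔ Ideal.span {x} : Ideal R) := by
        ext w
        rw [Submodule.mem_torsionBySet_iff]
        constructor
        · rintro ⟨⟨w, hw⟩, hx, rfl⟩ ⟨a, ha⟩
          obtain ⟨b, hb, c, hc, rfl⟩ := Submodule.mem_sup.1 ha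
          obtain ⟨c, rfl⟩ := Ideal.mem_span_singleton'.1 hc
          have hx' : x • w = 0 := congrArg Subtype.val hx
          have hb' : b • w = 0 := (Submodule.mem_torsionBySet_iff _ _).1 hw ⟨b, hb⟩
          change (b + c * x) • w = 0
          rw [add_smul, mul_smul, hx', hb', smul_zero, add_zero]
        · intro hw
          refine ⟨⟨w, (Submodule.mem_torsionBySet_iff _ _).2 fun a => hw ⟨a, Ideal.mem_sup_left a.2⟩⟩, ?_, rfl⟩
          exact Subtype.ext (hw ⟨x, Ideal.mem_sup_right (Ideal.mem_span_singleton_self x)⟩)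
      have e5 := (Submodule.equivSubtypeMap _
        (LinearMap.ker (LinearMap.lsmul R (Submodule.torsionBySet R W K) x))).trans
        (LinearEquiv.ofEq _ _ h4)
      exact ⟨((LinearEquiv.congrLeft E R e5).symm.trans e2).trans
        ((e.quotRangeLsmul x).trans (e1.trans e3))⟩
    | sup I₁ h₁ I₂ h₂ ih₁ ih₂ =>
      intro K hK
      have := ih₂ _ (ih₁ K hK)
      rwa [sup_assoc] at this
  rw [← bot_sup_eq I]
  refine key I (IsNoetherian.noetherian I) ⊥ ?_
  have h0 : Submodule.torsionBySet R W ((⊥ : Ideal R) : Set R) = ⊤ := by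
    rw [eq_top_iff]
    rintro w -
    rw [Submodule.mem_torsionBySet_iff]
    rintro ⟨a, ha⟩
    obtain rfl : a = 0 := (Submodule.mem_bot R).1 ha
    exact zero_smul R w
  obtain ⟨e⟩ := h
  exact ⟨(LinearEquiv.congrLeft E R ((LinearEquiv.ofEq _ _ h0).trans Submodule.topEquiv)).trans
    (e.trans (LocCoh.mapEquiv J d (Submodule.quotEquivOfEqBot ⊥ rfl).symm))⟩

end TopLocalCohomology

/-! ### Multiplicities and associated primes of a canonical module -/

section CanonicalMultiplicity

open IsLocalRing

variable {R : Type u} [CommRing R] [IsLocalRing R] [IsNoetherianRing R]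

theorem exists_list_length_eq_of_ringKrullDim_eq {d : ℕ} (hd : ringKrullDim R = d) :
    ∃ l : List R, (∀ x ∈ l, x ∈ maximalIdeal R) ∧ l.length = d ∧
      maximalIdeal R ≤ (Ideal.ofList l).radical := by
  obtain ⟨l, hl, h1, h2⟩ := exists_list_length_eq_ringKrullDim (⊥ : Ideal R) bot_ne_top
  refine ⟨l, hl, ?_, ?_⟩
  · rw [ringKrullDim_eq_of_ringEquiv (RingEquiv.quotientBot R), hd] at h1
    exact_mod_cast h1
  · rwa [IsParamSeq, Ideal.annihilator_quotient, sup_bot_eq] at h2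

/-- A chain of length `d` above `Q` would be lengthened by a minimal prime strictly below `Q`. -/
theorem ringKrullDim_quotient_lt_of_notMem_minimalPrimes {d : ℕ} (hd : ringKrullDim R = d)
    {Q : Ideal R} [Q.IsPrime] (hQ : Q ∉ minimalPrimes R) : ringKrullDim (R ⧸ Q) < d := by
  by_contra hc
  rw [not_lt, ringKrullDim_quotient, Order.le_krullDim_iff] at hc
  obtain ⟨s, hs⟩ := hc
  obtain ⟨P, hP, hPQ⟩ := Ideal.exists_minimalPrimes_le (bot_le : ⊥ ≤ Q)
  have hlt : P < Q := lt_of_le_of_ne hPQ fun h => hQ (h ▸ hP)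
  let s' : LTSeries (PrimeSpectrum R) := s.map Subtype.val fun _ _ h => h
  have h1 : (⟨P, hP.1.1⟩ : PrimeSpectrum R) < s'.head :=
    lt_of_lt_of_le (b := (⟨Q, ‹_›⟩ : PrimeSpectrum R)) hlt s.head.2
  have h2 : ((s'.cons _ h1).length : WithBot ℕ∞) ≤ ringKrullDim R := Order.le_krullDim_iff.2 ⟨_, rfl⟩
  rw [hd, RelSeries.cons_length] at h2
  have h3 : s.length + 1 ≤ d := by exact_mod_cast h2
  omega

variable {l : List R} (hl : ∀ x ∈ l, x ∈ maximalIdeal R)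
  (hR : maximalIdeal R ≤ (Ideal.ofList l).radical)
include hl hR

theorem subsingleton_locCoh_succ (N : Type u) [AddCommGroup N] [Module R N] [Module.Finite R N] :
    Subsingleton (LocCoh (maximalIdeal R) (l.length + 1) N) :=
  LocCoh.subsingleton_of_isParamSeq l hl (hR.trans (Ideal.radical_mono le_sup_left)) le_rfl

variable {E : Type u} [AddCommGroup E] [Module R E] {f : ResidueField R →ₗ[R] E}
  (hf : IsInjectiveHull f) {W : Type u} [AddCommGroup W] [Module R W] [Module.Finite R W]
include hf

theorem koszulMult_eq_of_nonempty_dual_equiv {M : Type u} [AddCommGroup M] [Module R M]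
    [Module.Finite R M]
    (h : Nonempty ((W →ₗ[R] E) ≃ₗ[R] LocCoh (maximalIdeal R) l.length M)) :
    koszulMult l W = koszulMult l M := by
  obtain ⟨e⟩ := h
  have hp : ∀ (N : Type u) [AddCommGroup N] [Module R N], IsParamSeq l N := fun N _ _ =>
    hR.trans (Ideal.radical_mono le_sup_left)
  rw [koszulMult_eq_koszulChar hl (hp M), ← e.koszulChar_eq,
    hf.koszulChar_hom ⟨Or.inl inferInstance, hp W⟩, koszulMult]

variable (h : Nonempty ((W →ₗ[R] E) ≃ₗ[R] LocCoh (maximalIdeal R) l.length R))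
include h

theorem koszulMult_torsionBySet (J : Ideal R) :
    koszulMult l (Submodule.torsionBySet R W J) = koszulMult l (R ⧸ J) :=
  have := hf.isInjective
  koszulMult_eq_of_nonempty_dual_equiv hl hR hf
    (nonempty_dual_torsionBySet_equiv (subsingleton_locCoh_succ hl hR) h J)

/-- If `Q` is not minimal, then `dim R/Q < d`, so `H^d_m(R/Q) = 0`. This is the dual of the
`Q`-torsion of `W`, which must then be zero. -/
theorem mem_minimalPrimes_of_mem_associatedPrimes_of_dual (hdim : ringKrullDim R = l.length)
    {Q : Ideal R} (hQ : Q ∈ associatedPrimes R W) : Q ∈ minimalPrimes R := by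
  by_contra hc
  have := hQ.isPrime
  have hne := this.ne_top
  have hlt := ringKrullDim_quotient_lt_of_notMem_minimalPrimes hdim hc
  obtain ⟨l', hl', h1, h2⟩ := exists_list_length_eq_ringKrullDim Q hne
  rw [← h1] at hlt
  have h3 : l'.length < l.length := by exact_mod_cast hlt
  have := hf.isInjective
  obtain ⟨e⟩ := nonempty_dual_torsionBySet_equiv (subsingleton_locCoh_succ hl hR) h Q
  obtain ⟨k, hk⟩ : ∃ k, l.length = k + 1 := Nat.exists_eq_succ_of_ne_zero (by omega)
  have h4 : Subsingleton (LocCoh (maximalIdeal R) l.length (R ⧸ Q)) := by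
    rw [hk]
    exact LocCoh.subsingleton_of_isParamSeq l' hl' h2 (by omega)
  have h5 : Subsingleton (Submodule.torsionBySet R W Q) :=
    hf.subsingleton_of_hom e.toEquiv.subsingleton
  obtain ⟨-, w, hw⟩ := isAssociatedPrime_iff.1 hQ
  have h6 : w ∈ Submodule.torsionBySet R W Q := by
    rw [Submodule.mem_torsionBySet_iff]
    rintro ⟨a, ha⟩
    rw [SetLike.mem_coe, hw, Submodule.mem_colon_singleton, Submodule.mem_bot] at ha
    exact ha
  have h7 : w = 0 := congrArg Subtype.val (Subsingleton.elim (⟨w, h6⟩ : Submodule.torsionBySet R W Q) 0)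
  refine hne ((Ideal.eq_top_iff_one _).2 ?_)
  rw [hw, Submodule.mem_colon_singleton, h7, smul_zero]
  exact Submodule.zero_mem _

end CanonicalMultiplicity

/-! ### Lengths at minimal primes and the associativity formula -/

section LocalLength

variable {R : Type u} [CommRing R]

/-- The length of the localization of a module at a prime ideal. -/
noncomputable def localLength (P : Ideal R) [P.IsPrime] (M : Type v) [AddCommGroup M]
    [Module R M] : ℕ∞ :=
  Module.length (Localization.AtPrime P) (LocalizedModule.AtPrime P M)

section

variable (P : Ideal R) [P.IsPrime] {M N K : Type*} [AddCommGroup M] [Module R M]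
  [AddCommGroup N] [Module R N] [AddCommGroup K] [Module R K]

theorem LocalizedModule.map_exact' (S : Submonoid R) {f : M →ₗ[R] N} {g : N →ₗ[R] K}
    (h : Function.Exact f g) :
    Function.Exact (LocalizedModule.map S f) (LocalizedModule.map S g) :=
  LocalizedModule.map_exact S f g h

theorem localLength_eq_add {f : M →ₗ[R] N} {g : N →ₗ[R] K} (hf : Function.Injective f)
    (hfg : Function.Exact f g) (hg : Function.Surjective g) :
    localLength P N = localLength P M + localLength P K :=
  Module.length_eq_add_of_exact _ _ (LocalizedModule.map_injective _ f hf)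
    (LocalizedModule.map_surjective _ g hg) (LocalizedModule.map_exact' _ hfg)

theorem localLength_eq_zero_of_smul {M : Type*} [AddCommGroup M] [Module R M] {r : R} (hr : r ∉ P)
    (h : ∀ m : M, r • m = 0) : localLength P M = 0 := by
  rw [localLength, Module.length_eq_zero_iff, LocalizedModule.subsingleton_iff]
  exact fun m => ⟨r, hr, h m⟩

theorem localLength_eq (e : M ≃ₗ[R] N) : localLength P M = localLength P N := by
  have := localLength_eq_add P (f := e.toLinearMap) (g := (0 : N →ₗ[R] PUnit.{1})) e.injective
    ((e.exact_zero_iff_surjective _).2 e.surjective) (Function.surjective_to_subsingleton _)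
  rw [this, localLength_eq_zero_of_smul P (M := PUnit.{1}) (r := 1) (fun h => (inferInstance : P.IsPrime).ne_top
    ((Ideal.eq_top_iff_one _).2 h)) fun _ => Subsingleton.elim _ _, add_zero]

theorem localLength_quotient_self : localLength P (R ⧸ P) = 1 := by
  rw [localLength, Module.length_eq_one_iff, isSimpleModule_iff_toSpanSingleton_surjective]
  constructor
  · rw [← not_subsingleton_iff_nontrivial, LocalizedModule.subsingleton_iff]
    intro h
    obtain ⟨r, hr, h1⟩ := h (Submodule.Quotient.mk 1)
    rw [← Submodule.Quotient.mk_smul, Submodule.Quotient.mk_eq_zero, smul_eq_mul, mul_one] at h1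
    exact hr h1
  · intro x hx y
    induction x using LocalizedModule.induction_on with | _ m s => ?_
    induction y using LocalizedModule.induction_on with | _ n t => ?_
    obtain ⟨m, rfl⟩ := Submodule.Quotient.mk_surjective _ m
    obtain ⟨n, rfl⟩ := Submodule.Quotient.mk_surjective _ n
    have hm : m ∉ P := fun h => hx (by
      rw [(Submodule.Quotient.mk_eq_zero P).2 h, LocalizedModule.zero_mk])
    refine ⟨Localization.mk ((s : R) * n) (t * ⟨m, hm⟩), ?_⟩
    rw [LinearMap.toSpanSingleton_apply, LocalizedModule.mk_smul_mk, LocalizedModule.mk_eq]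
    refine ⟨1, ?_⟩
    rw [one_smul, one_smul, ← Submodule.Quotient.mk_smul, Submonoid.smul_def, Submonoid.smul_def,
      ← Submodule.Quotient.mk_smul, ← Submodule.Quotient.mk_smul]
    congr 1
    simp only [Submonoid.coe_mul, smul_eq_mul]
    ring

end

theorem isArtinianRing_localization_of_mem_minimalPrimes [IsNoetherianRing R] {P : Ideal R}
    [P.IsPrime] (hP : P ∈ minimalPrimes R) : IsArtinianRing (Localization.AtPrime P) := by
  have : Ring.KrullDimLE 0 (Localization.AtPrime P) := .of_isLocalization P hP _
  have : IsNoetherianRing (Localization.AtPrime P) := IsLocalization.isNoetherianRing P.primeCompl _ ‹_›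
  exact IsNoetherianRing.isArtinianRing_of_krullDimLE_zero

theorem isFiniteLength_localizedModule [IsNoetherianRing R] {P : Ideal R}
    [P.IsPrime] (hP : P ∈ minimalPrimes R) (M : Type v) [AddCommGroup M] [Module R M]
    [Module.Finite R M] :
    IsFiniteLength (Localization.AtPrime P) (LocalizedModule.AtPrime P M) := by
  have := isArtinianRing_localization_of_mem_minimalPrimes hP
  have : IsNoetherianRing (Localization.AtPrime P) := inferInstance
  exact isFiniteLength_iff_isNoetherian_isArtinian.2 ⟨inferInstance, inferInstance⟩

theorem localLength_ne_top [IsNoetherianRing R] {P : Ideal R}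
    [P.IsPrime] (hP : P ∈ minimalPrimes R) (M : Type v) [AddCommGroup M] [Module R M]
    [Module.Finite R M] : localLength P M ≠ ⊤ :=
  Module.length_ne_top_iff.2 (isFiniteLength_localizedModule hP M)

open IsLocalRing

instance minimalPrimes.isPrime_coe (P : minimalPrimes R) : (P : Ideal R).IsPrime := P.2.1.1

/-- The associativity formula for multiplicities. -/
theorem koszulMult_eq_sum [IsNoetherianRing R] [IsLocalRing R] [Fintype (minimalPrimes R)]
    {l : List R} (hl : ∀ x ∈ l, x ∈ maximalIdeal R)
    (hR : maximalIdeal R ≤ (Ideal.ofList l).radical) (M : Type u) [AddCommGroup M] [Module R M]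
    [Module.Finite R M] :
    koszulMult l M = ∑ P : minimalPrimes R,
      ((localLength P.1 M).toNat : ℤ) * koszulMult l (R ⧸ P.1) := by
  have hp : ∀ (N : Type u) [AddCommGroup N] [Module R N], IsParamSeq l N := fun N _ _ =>
    hR.trans (Ideal.radical_mono le_sup_left)
  -- Both sides are additive, so prime filtrations reduce to `R ⧸ Q`; for nonminimal `Q` both sides
  -- are zero.
  induction ‹Module.Finite R M› using
    IsNoetherianRing.induction_on_isQuotientEquivQuotientPrime R with
  | subsingleton N =>
    rw [koszulMult_eq_zero_of_subsingleton]
    refine (Finset.sum_eq_zero fun P _ => ?_).symm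
    rw [localLength_eq_zero_of_smul P.1 (r := 1) (fun h => P.2.1.1.ne_top
      ((Ideal.eq_top_iff_one _).2 h)) fun _ => Subsingleton.elim _ _]
    simp
  | quotient N Q e =>
    have hQ := Q.2
    rw [e.koszulMult_eq]
    have h0 : ∀ P : minimalPrimes R, P.1 ≠ Q.1 → localLength P.1 N = 0 := fun P hPQ => by
      have : ¬ Q.1 ≤ P.1 := fun h => hPQ (le_antisymm (P.2.2 ⟨hQ, bot_le⟩ h) h)
      obtain ⟨r, hrQ, hrP⟩ := SetLike.not_le_iff_exists.1 this
      refine localLength_eq_zero_of_smul P.1 hrP fun n => e.injective ?_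
      rw [map_smul, map_zero]
      obtain ⟨a, ha⟩ := Submodule.Quotient.mk_surjective _ (e n)
      rw [← ha, ← Submodule.Quotient.mk_smul, Submodule.Quotient.mk_eq_zero]
      exact Q.1.mul_mem_right _ hrQ
    by_cases hmin : Q.1 ∈ minimalPrimes R
    · rw [Finset.sum_eq_single (⟨Q.1, hmin⟩ : minimalPrimes R)]
      · have h1 : localLength Q.1 N = 1 := (localLength_eq Q.1 e).trans (localLength_quotient_self _)
        rw [show (localLength (⟨Q.1, hmin⟩ : minimalPrimes R).1 N) = 1 from h1]
        simp
      · intro P _ hP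
        rw [h0 P fun h => hP (Subtype.ext h)]
        simp
      · exact fun h => absurd (Finset.mem_univ _) h
    · obtain ⟨P, hP, hPQ⟩ := Ideal.exists_minimalPrimes_le (bot_le : ⊥ ≤ Q.1)
      have := hP.1.1
      rw [koszulMult_quotient_eq_zero hl hR
        (lt_of_le_of_ne hPQ fun h => hmin (h ▸ hP))]
      refine (Finset.sum_eq_zero fun P _ => ?_).symm
      rw [h0 P fun h => hmin (h ▸ P.2)]
      simp
  | exact N₁ N₂ N₃ f g hf hg hfg h₁ h₃ =>
    rw [koszulMult_eq_add ⟨Or.inl inferInstance, hp N₂⟩ hf hfg hg, h₁, h₃, ← Finset.sum_add_distrib]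
    refine Finset.sum_congr rfl fun P _ => ?_
    rw [localLength_eq_add P.1 hf hfg hg,
      ENat.toNat_add (localLength_ne_top P.2 N₁) (localLength_ne_top P.2 N₃)]
    push_cast
    ring

end LocalLength

/-! ### Length criteria over Artinian local rings -/

section ArtinianLocal

open IsLocalRing

theorem LinearMap.injective_of_surjective_of_length_eq {R M N : Type*} [Ring R] [AddCommGroup M]
    [Module R M] [AddCommGroup N] [Module R N] (f : M →ₗ[R] N) (hf : Function.Surjective f)
    (h : Module.length R M = Module.length R N) (hN : Module.length R N ≠ ⊤) :
    Function.Injective f := by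
  rw [Module.length_eq_add_of_exact (LinearMap.ker f).subtype f (Submodule.injective_subtype _) hf
    (LinearMap.exact_subtype_ker_map f)] at h
  have h1 : Module.length R (LinearMap.ker f) = 0 :=
    nonpos_iff_eq_zero.1 ((ENat.add_le_add_iff_right hN).1 (h.le.trans (zero_add _).ge))
  rw [Module.length_eq_zero_iff] at h1
  exact LinearMap.ker_eq_bot.1 (Submodule.subsingleton_iff_eq_bot.1 h1)

theorem LinearMap.surjective_of_injective_of_length_eq {R M N : Type*} [Ring R] [AddCommGroup M]
    [Module R M] [AddCommGroup N] [Module R N] (f : M →ₗ[R] N) (hf : Function.Injective f)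
    (h : Module.length R M = Module.length R N) (hM : Module.length R M ≠ ⊤) :
    Function.Surjective f := by
  rw [Module.length_eq_add_of_exact f (LinearMap.range f).mkQ hf (Submodule.mkQ_surjective _)
    (LinearMap.exact_map_mkQ_range f)] at h
  have h1 : Module.length R (N ⧸ LinearMap.range f) = 0 :=
    nonpos_iff_eq_zero.1 ((ENat.add_le_add_iff_left hM).1 (h.ge.trans (add_zero _).ge))
  rw [Module.length_eq_zero_iff, Submodule.Quotient.subsingleton_iff] at h1
  exact LinearMap.range_eq_top.1 h1

variable {B : Type*} [CommRing B] [IsLocalRing B] [IsArtinianRing B]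

theorem isFiniteLength_of_finite (M : Type*) [AddCommGroup M] [Module B M] [Module.Finite B M] :
    IsFiniteLength B M :=
  isFiniteLength_iff_isNoetherian_isArtinian.2 ⟨inferInstance, inferInstance⟩

theorem length_le_of_length_hom_residueField_le_one {N : Type*} [AddCommGroup N] [Module B N]
    (hs : Module.length B (ResidueField B →ₗ[B] N) ≤ 1) : Module.length B N ≤ Module.length B B :=
  ((LinearMap.ringLmapEquivSelf B B N).length_eq).symm.trans_le
    (length_hom_le_of_residueField N hs (isFiniteLength_of_finite B))

/-- Restriction `Hom(B, N) → Hom(I, N)` has kernel of length at most that of `B ⧸ I` and target of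
length at most that of `I`. As `Hom(B, N)` has the length of `B`, restriction must be onto. -/
theorem baer_of_length_eq {N : Type*} [AddCommGroup N] [Module B N]
    (hs : Module.length B (ResidueField B →ₗ[B] N) ≤ 1)
    (h : Module.length B N = Module.length B B) : Module.Baer B N := by
  intro I g
  have hB := isFiniteLength_of_finite (B := B) B
  have hBt := Module.length_ne_top_iff.2 hB
  let ρ := LinearMap.lcomp B N I.subtype
  have h1 : Module.length B (B →ₗ[B] N) = Module.length B (LinearMap.ker ρ) +
      Module.length B (LinearMap.range ρ) :=
    Module.length_eq_add_of_exact _ _ (Submodule.injective_subtype _)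
      (LinearMap.surjective_rangeRestrict _) (LinearMap.exact_subtype_rangeRestrict ρ)
  rw [(LinearMap.ringLmapEquivSelf B B N).length_eq, h,
    Module.length_eq_add_of_exact I.subtype (Submodule.mkQ I) (Submodule.injective_subtype _)
      (Submodule.mkQ_surjective _) (LinearMap.exact_subtype_mkQ _)] at h1
  have h2 : Module.length B (LinearMap.ker ρ) ≤ Module.length B (B ⧸ I) := by
    rw [LinearMap.exact_iff.1 (LinearMap.exact_lcomp N (LinearMap.exact_subtype_mkQ I)
      (Submodule.mkQ_surjective _))]
    exact (Module.length_le_of_surjective (LinearMap.lcomp B N (Submodule.mkQ I)).rangeRestrict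
      (LinearMap.surjective_rangeRestrict _)).trans
      (length_hom_le_of_residueField N hs (isFiniteLength_of_finite _))
  have h3 : Module.length B (LinearMap.range ρ) ≤ Module.length B (I →ₗ[B] N) :=
    Module.length_le_of_injective (LinearMap.range ρ).subtype (Submodule.injective_subtype _)
  have h4 : Module.length B (I →ₗ[B] N) ≤ Module.length B I :=
    length_hom_le_of_residueField N hs (isFiniteLength_of_finite I)
  have hI : Module.length B I ≠ ⊤ := Module.length_ne_top_iff.2 (isFiniteLength_of_finite I)
  have hQ : Module.length B (B ⧸ I) ≠ ⊤ := Module.length_ne_top_iff.2 (isFiniteLength_of_finite _)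
  have h5 : Module.length B (LinearMap.range ρ) = Module.length B (I →ₗ[B] N) := by
    refine le_antisymm h3 (h4.trans ?_)
    rw [add_comm] at h1
    exact (ENat.add_le_add_iff_left hQ).1 (h1.le.trans (add_le_add_left h2 _))
  obtain ⟨g', hg'⟩ : ∃ g', ρ g' = g := by
    obtain ⟨⟨_, g', rfl⟩, hy⟩ := LinearMap.surjective_of_injective_of_length_eq
      (LinearMap.range ρ).subtype (Submodule.injective_subtype _) h5
      (ne_top_of_le_ne_top hI (h3.trans h4)) g
    exact ⟨g', hy⟩
  exact ⟨g', fun x hx => LinearMap.congr_fun hg' ⟨x, hx⟩⟩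

theorem exists_injective_residueField (N : Type*) [AddCommGroup N] [Module B N] [Nontrivial N] :
    ∃ f : ResidueField B →ₗ[B] N, Function.Injective f := by
  obtain ⟨P, hP⟩ := associatedPrimes.nonempty B N
  obtain ⟨h1, f, hf⟩ := (isAssociatedPrime_iff_exists_injective_linearMap P N).1 hP
  obtain rfl : P = maximalIdeal B := IsLocalRing.eq_maximalIdeal inferInstance
  exact ⟨f, hf⟩

/-- Extend the socle embedding of the residue field from `N` into the self-injective ring. A nonzero
kernel would contain a copy of the residue field. -/
theorem exists_injective_of_length_hom_residueField_le_one {N : Type*} [AddCommGroup N] [Module B N]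
    [Nontrivial N] (hs : Module.length B (ResidueField B →ₗ[B] N) ≤ 1) (hB : Module.Baer B B) :
    ∃ φ : N →ₗ[B] B, Function.Injective φ := by
  obtain ⟨j, hj⟩ := exists_injective_residueField (B := B) N
  obtain ⟨i, hi⟩ := exists_injective_residueField (B := B) B
  obtain ⟨φ, hφ⟩ := hB.extension_property j hj i
  refine ⟨φ, ?_⟩
  rw [← LinearMap.ker_eq_bot]
  by_contra hne
  have : Nontrivial (LinearMap.ker φ) := Submodule.nontrivial_iff_ne_bot.2 hne
  obtain ⟨j', hj'⟩ := exists_injective_residueField (B := B) (LinearMap.ker φ)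
  have hj0 : j ≠ 0 := by
    rintro rfl
    exact one_ne_zero (hj (a₁ := (1 : ResidueField B)) (a₂ := 0) rfl)
  have hsimple : IsSimpleModule B (ResidueField B →ₗ[B] N) := Module.length_eq_one_iff.1
    (le_antisymm hs (Order.one_le_iff_pos.2 (Module.length_pos_iff.2 ⟨j, 0, hj0⟩)))
  -- The copy of the residue field in the kernel is a multiple `b • j`; applying `φ` gives `b • i =
  -- 0`, so that copy is zero.
  obtain ⟨b, hb⟩ := (isSimpleModule_iff_toSpanSingleton_surjective.1 hsimple).2 j hj0
    ((LinearMap.ker φ).subtype ∘ₗ j')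
  have h1 : b • i 1 = 0 := by
    rw [← hφ]
    change b • φ (j 1) = 0
    rw [← map_smul]
    have := LinearMap.congr_fun hb 1
    change b • j 1 = (j' 1 : N) at this
    rw [this]
    exact (j' 1).2
  have h2 : b • (1 : ResidueField B) = 0 := hi (by rw [map_smul, h1, map_zero])
  have h3 : (j' 1 : N) = 0 := by
    have := LinearMap.congr_fun hb 1
    change b • j 1 = (j' 1 : N) at this
    rw [← this, ← map_smul, h2, map_zero]
  exact one_ne_zero (hj' ((Subtype.ext h3).trans (map_zero j').symm))

end ArtinianLocal

/-! ### Finite injective dimension forces self-injectivity -/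

section InjectiveDimension

open IsLocalRing Abelian

variable {B : Type u} [CommRing B] [IsLocalRing B]

theorem exists_injective_finsupp_of_maximalIdeal_smul (Q : Type u) [AddCommGroup Q] [Module B Q]
    (hQ : ∀ r ∈ maximalIdeal B, ∀ q : Q, r • q = 0) {j : ResidueField B →ₗ[B] B}
    (hj : Function.Injective j) : ∃ (ι : Type u) (f : Q →ₗ[B] ι →₀ B), Function.Injective f := by
  have ht : Module.IsTorsionBySet B Q (maximalIdeal B) := fun q r => hQ r r.2 q
  let : Module (ResidueField B) Q := ht.module
  have : IsScalarTower B (ResidueField B) Q := ht.isScalarTower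
  let b := Module.Basis.ofVectorSpace (ResidueField B) Q
  exact ⟨_, Finsupp.mapRange.linearMap j ∘ₗ (b.repr.restrictScalars B).toLinearMap,
    (Finsupp.mapRange_injective _ (map_zero j) hj).comp b.repr.injective⟩

/-- Dévissage reduces to vector spaces over the residue field. Such a space embeds in a free module,
and `Ext^{n+1}` of it sits between `Ext^{n+1}` of that free module and `Ext^{n+2}` of the cokernel,
both zero. -/
theorem subsingleton_ext_of_hasInjectiveDimensionLT {j : ResidueField B →ₗ[B] B}
    (hj : Function.Injective j) (X : ModuleCat.{u} B) (n : ℕ) [HasInjectiveDimensionLT X (n + 2)]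
    (k : ℕ) (Y : Type u) [AddCommGroup Y] [Module B Y]
    (hY : ∀ r ∈ maximalIdeal B ^ k, ∀ y : Y, r • y = 0) :
    ∀ e : Ext (ModuleCat.of B Y) X (n + 1), e = 0 := by
  induction k generalizing Y with
  | zero =>
    have : Subsingleton Y := subsingleton_of_forall_eq 0 fun y => by
      simpa using hY 1 (by simp) y
    have : Projective (ModuleCat.of B Y) :=
      (IsProjective.iff_projective (R := B) Y).1 inferInstance
    exact fun e => Ext.eq_zero_of_projective e
  | succ k ih =>
    intro e
    let Z : Submodule B Y := maximalIdeal B • ⊤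
    have hS := ModuleCat.shortComplex_shortExact (ModuleCat.shortComplexOfCompEqZero Z.subtype Z.mkQ
      (LinearMap.exact_subtype_mkQ Z).linearMap_comp_eq_zero) (LinearMap.exact_subtype_mkQ Z)
      Z.injective_subtype Z.mkQ_surjective
    obtain ⟨e', rfl⟩ := Ext.contravariant_sequence_exact₂ hS X e (ih Z (fun r hr z => by
      refine Subtype.ext ?_
      obtain ⟨z, hz⟩ := z
      change r • z = 0
      refine Submodule.smul_induction_on hz (fun s hs y _ => ?_) fun a b ha hb => ?_
      · rw [smul_smul]
        exact hY _ (by rw [pow_succ]; exact Ideal.mul_mem_mul hr hs) y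
      · rw [smul_add, ha, hb, add_zero]) _)
    obtain ⟨ι, f, hf⟩ := exists_injective_finsupp_of_maximalIdeal_smul (Y ⧸ Z) (fun r hr q => by
      obtain ⟨y, rfl⟩ := Submodule.Quotient.mk_surjective _ q
      rw [← Submodule.Quotient.mk_smul, Submodule.Quotient.mk_eq_zero]
      exact Submodule.smul_mem_smul hr trivial) hj
    have hS' := ModuleCat.shortComplex_shortExact (ModuleCat.shortComplexOfCompEqZero f
      (LinearMap.range f).mkQ (LinearMap.exact_map_mkQ_range f).linearMap_comp_eq_zero)
      (LinearMap.exact_map_mkQ_range f) hf (Submodule.mkQ_surjective _)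
    obtain ⟨e'', he''⟩ := Ext.contravariant_sequence_exact₁ hS' X e' (add_comm 1 (n + 1))
      (Ext.eq_zero_of_hasInjectiveDimensionLT _ (n + 2) le_rfl)
    have : Projective (ModuleCat.of B (ι →₀ B)) :=
      (IsProjective.iff_projective (R := B) (ι →₀ B)).1 inferInstance
    have h0 : e'' = 0 := Ext.eq_zero_of_projective e''
    have h1 : e' = 0 := by rw [← he'', h0, Ext.comp_zero]
    rw [h1, Ext.comp_zero]

/-- An Artinian local ring of finite injective dimension over itself is self-injective. -/
theorem baer_self_of_hasInjectiveDimensionLE [IsArtinianRing B] (n : ℕ)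
    (h : HasInjectiveDimensionLE (ModuleCat.of B B) n) : Module.Baer B B := by
  obtain ⟨j, hj⟩ := exists_injective_residueField (B := B) B
  induction n with
  | zero =>
    have h' : HasInjectiveDimensionLT (ModuleCat.of B B) 1 := h
    have : Injective (ModuleCat.of B B) := inferInstance
    have : Module.Injective B B := Module.injective_module_of_injective_object B B
    exact Module.Baer.of_injective this
  | succ n ih =>
    refine ih ?_
    have h' : HasInjectiveDimensionLT (ModuleCat.of B B) (n + 2) := h
    -- The maximal ideal is nilpotent, so the vanishing of `Ext^{n+1}` applies to every module and
    -- the injective dimension drops by one.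
    refine hasInjectiveDimensionLT_of_enoughProjectives _ _ fun Y => ⟨fun a b => ?_⟩
    obtain ⟨k, hk⟩ := IsArtinianRing.isNilpotent_jacobson_bot (R := B)
    have hY : ∀ r ∈ maximalIdeal B ^ k, ∀ y : Y, r • y = 0 := fun r hr y => by
      rw [jacobson_eq_maximalIdeal _ bot_ne_top] at hk
      rw [hk] at hr
      obtain rfl : r = 0 := hr
      exact zero_smul B y
    have key := subsingleton_ext_of_hasInjectiveDimensionLT hj (ModuleCat.of B B) n k Y hY
    exact (key a).trans (key b).symm

theorem hasInjectiveDimensionLE_zero_of_baer (h : Module.Baer B B) :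
    HasInjectiveDimensionLE (ModuleCat.of B B) 0 := by
  have : Module.Injective B B := h.injective
  have : Injective (ModuleCat.of B B) := Module.injective_object_of_injective_module B B
  exact (inferInstance : HasInjectiveDimensionLT (ModuleCat.of B B) 1)

end InjectiveDimension

/-! ### From local data at minimal primes to maps into the ring -/

section LocalizedCanonical

open IsLocalRing

variable {R : Type u} [CommRing R]

/-- The localization of the ring itself as a module. -/
noncomputable def localizedModuleSelfEquiv (P : Ideal R) [P.IsPrime] :
    LocalizedModule.AtPrime P R ≃ₗ[Localization.AtPrime P] Localization.AtPrime P :=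
  (IsLocalizedModule.iso P.primeCompl
    (Algebra.linearMap R (Localization.AtPrime P))).extendScalarsOfIsLocalization P.primeCompl _

theorem localLength_self (P : Ideal R) [P.IsPrime] :
    localLength P R = Module.length (Localization.AtPrime P) (Localization.AtPrime P) :=
  (localizedModuleSelfEquiv P).length_eq

theorem exists_notMem_smul_smul_eq_zero (P : Ideal R) [P.IsPrime] {W : Type*} [AddCommGroup W]
    [Module R W] (w : W) {I : Ideal R} (hI : I.FG) (h : ∀ p ∈ I, ∃ u ∉ P, u • p • w = 0) :
    ∃ u ∉ P, ∀ p ∈ I, p • u • w = 0 := by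
  induction I, hI using Submodule.fg_induction with
  | singleton x =>
    obtain ⟨u, hu, hx⟩ := h x (Submodule.mem_span_singleton_self x)
    refine ⟨u, hu, fun p hp => ?_⟩
    obtain ⟨a, rfl⟩ := Submodule.mem_span_singleton.1 hp
    rw [smul_assoc, smul_comm x u, hx, smul_zero]
  | sup I₁ I₂ _ _ h₁ h₂ =>
    obtain ⟨u₁, hu₁, hw₁⟩ := h₁ fun p hp => h p (Submodule.mem_sup_left hp)
    obtain ⟨u₂, hu₂, hw₂⟩ := h₂ fun p hp => h p (Submodule.mem_sup_right hp)
    refine ⟨u₁ * u₂, fun hc => ((inferInstance : P.IsPrime).mem_or_mem hc).elim hu₁ hu₂,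
      fun p hp => ?_⟩
    obtain ⟨a, ha, b, hb, rfl⟩ := Submodule.mem_sup.1 hp
    rw [add_smul, mul_smul u₁ u₂ w, smul_comm b u₁, hw₂ b hb, smul_comm u₁ u₂, smul_comm a u₂,
      hw₁ a ha, smul_zero, smul_zero, add_zero]

/-- Evaluation at `1` embeds these homomorphisms into the elements killed by `P`. As `P` is finitely
generated, one denominator clears all relations, so these elements come from the `P`-torsion of `W`.
-/
theorem length_hom_residueField_localizedModule_le [IsNoetherianRing R] (P : Ideal R) [P.IsPrime]
    (W : Type v) [AddCommGroup W] [Module R W] :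
    Module.length (Localization.AtPrime P) (ResidueField (Localization.AtPrime P)
      →ₗ[Localization.AtPrime P] LocalizedModule.AtPrime P W) ≤
      localLength P (Submodule.torsionBySet R W P) := by
  let ι := LocalizedModule.map P.primeCompl (Submodule.torsionBySet R W P).subtype
  let ev := LinearMap.applyₗ (R := Localization.AtPrime P)
    (M₂ := LocalizedModule.AtPrime P W) (1 : ResidueField (Localization.AtPrime P))
  have hev : ∀ φ, ev φ ∈ LinearMap.range ι := by
    intro φ
    obtain ⟨w, s, hws⟩ : ∃ w s, φ 1 = LocalizedModule.mk w s := by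
      induction h : φ 1 using LocalizedModule.induction_on with | _ m s => exact ⟨m, s, rfl⟩
    obtain ⟨u, hu, h⟩ := exists_notMem_smul_smul_eq_zero P w (IsNoetherian.noetherian P)
      fun p hp => by
        have h1 : algebraMap R (Localization.AtPrime P) p • φ 1 = 0 := by
          rw [← map_smul, Algebra.smul_def, mul_one]
          have : algebraMap (Localization.AtPrime P) (ResidueField (Localization.AtPrime P))
              (algebraMap R (Localization.AtPrime P) p) = 0 :=
            (residue_eq_zero_iff _).2
              ((IsLocalization.AtPrime.to_map_mem_maximal_iff _ P p).2 hp)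
          rw [this, map_zero]
        rw [hws, algebraMap_smul, LocalizedModule.smul'_mk, ← LocalizedModule.zero_mk 1,
          LocalizedModule.mk_eq] at h1
        obtain ⟨u, hu⟩ := h1
        refine ⟨u, u.2, ?_⟩
        simpa [Submonoid.smul_def] using hu
    refine ⟨LocalizedModule.mk ⟨u • w, (Submodule.mem_torsionBySet_iff _ _).2 fun a => h a a.2⟩
      (⟨u, hu⟩ * s), ?_⟩
    rw [LocalizedModule.map_mk]
    change _ = φ 1
    rw [hws]
    exact LocalizedModule.mk_cancel_common_left ⟨u, hu⟩ s w
  refine (Module.length_le_of_injective (ev.codRestrict _ hev) ?_).trans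
    (Module.length_le_of_surjective ι.rangeRestrict ι.surjective_rangeRestrict)
  intro φ ψ h
  have h1 : φ 1 = ψ 1 := congrArg Subtype.val h
  refine LinearMap.ext fun a => ?_
  obtain ⟨b, rfl⟩ := residue_surjective a
  have h2 : residue (Localization.AtPrime P) b =
    b • (1 : ResidueField (Localization.AtPrime P)) := by
    rw [Algebra.smul_def, mul_one]; rfl
  rw [h2, map_smul, map_smul, h1]

/-- A linear map to the ring which is nonzero modulo `P` is surjective after localization. -/
theorem localizedModule_map_surjective_of_notMem (P : Ideal R) [P.IsPrime] {W : Type*}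
    [AddCommGroup W] [Module R W] (φ : W →ₗ[R] R) {w : W} (hw : φ w ∉ P) :
    Function.Surjective (LocalizedModule.map P.primeCompl φ) := by
  intro y
  induction y using LocalizedModule.induction_on with | _ r s => ?_
  refine ⟨LocalizedModule.mk (r • w) (⟨φ w, hw⟩ * s), ?_⟩
  rw [LocalizedModule.map_mk, map_smul, smul_eq_mul, mul_comm]
  exact LocalizedModule.mk_cancel_common_left (⟨φ w, hw⟩ : P.primeCompl) s r

/-- An associated prime `Q` of the kernel would be minimal. At `Q` the map is onto between modules
of equal finite length, hence injective, so an element with annihilator `Q` would be killed outside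
`Q`. -/
theorem LinearMap.injective_of_localLength_eq [IsNoetherianRing R] {W : Type*} [AddCommGroup W]
    [Module R W] (hass : ∀ P ∈ associatedPrimes R W, P ∈ minimalPrimes R)
    (hlen : ∀ (P : Ideal R) [P.IsPrime], P ∈ minimalPrimes R → localLength P W = localLength P R)
    (φ : W →ₗ[R] R) (hφ : ∀ P ∈ minimalPrimes R, ∃ w, φ w ∉ P) : Function.Injective φ := by
  rw [← LinearMap.ker_eq_bot]
  by_contra hne
  have : Nontrivial (LinearMap.ker φ) := Submodule.nontrivial_iff_ne_bot.2 hne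
  obtain ⟨Q, hQ⟩ := associatedPrimes.nonempty R (LinearMap.ker φ)
  have hQmin := hass Q (associatedPrimes.subset_of_injective
    (LinearMap.ker φ).injective_subtype hQ)
  obtain ⟨hQp, x, hx⟩ := isAssociatedPrime_iff.1 hQ
  obtain ⟨w, hw⟩ := hφ Q hQmin
  have hinj := LinearMap.injective_of_surjective_of_length_eq
    (LocalizedModule.map Q.primeCompl φ) (localizedModule_map_surjective_of_notMem Q φ hw)
    (hlen Q hQmin) (localLength_ne_top hQmin R)
  have h1 : (LocalizedModule.mk (x : W) 1 : LocalizedModule Q.primeCompl W) = 0 := by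
    refine hinj ?_
    rw [LocalizedModule.map_mk, map_zero, x.2, LocalizedModule.zero_mk]
  rw [← LocalizedModule.zero_mk 1, LocalizedModule.mk_eq] at h1
  obtain ⟨u, hu⟩ := h1
  have h2 : (u : R) • (x : W) = 0 := by simpa [Submonoid.smul_def] using hu
  refine u.2 (hx.ge ?_)
  rw [Submodule.mem_colon_singleton, Submodule.mem_bot]
  exact Subtype.ext h2

/-- An embedding of the localization of `W` into the local ring is onto by lengths; finite
presentation lifts it to `W → R` up to a denominator outside `P`. -/
theorem exists_linearMap_apply_notMem [IsNoetherianRing R] {P : Ideal R} [P.IsPrime]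
    (hP : P ∈ minimalPrimes R) {W : Type*} [AddCommGroup W] [Module R W] [Module.Finite R W]
    (hlen : localLength P W = localLength P R)
    (hs : Module.length (Localization.AtPrime P) (ResidueField (Localization.AtPrime P)
      →ₗ[Localization.AtPrime P] LocalizedModule.AtPrime P W) ≤ 1)
    (hB : Module.Baer (Localization.AtPrime P) (Localization.AtPrime P)) :
    ∃ (ψ : W →ₗ[R] R) (w : W), ψ w ∉ P := by
  have := isArtinianRing_localization_of_mem_minimalPrimes hP
  rw [localLength_self] at hlen
  have hnt : Nontrivial (LocalizedModule.AtPrime P W) := by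
    rw [← Module.length_pos_iff (R := Localization.AtPrime P)]
    exact (Module.length_pos_iff.2 inferInstance).trans_eq hlen.symm
  obtain ⟨φ, hφ⟩ := exists_injective_of_length_hom_residueField_le_one hs hB
  have hsurj := φ.surjective_of_injective_of_length_eq hφ hlen (localLength_ne_top hP W)
  have := Module.finitePresentation_of_finite R W
  obtain ⟨ψ, s, hψ⟩ := Module.FinitePresentation.exists_lift_of_isLocalizedModule P.primeCompl
    (Algebra.linearMap R (Localization.AtPrime P))
    (φ.restrictScalars R ∘ₗ LocalizedModule.mkLinearMap P.primeCompl W)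
  obtain ⟨y, hy⟩ := hsurj 1
  induction y using LocalizedModule.induction_on with | _ w t => ?_
  refine ⟨ψ, w, fun hc => ?_⟩
  have h1 : algebraMap R (Localization.AtPrime P) (ψ w) =
      (s : R) • φ (LocalizedModule.mk w 1) := LinearMap.congr_fun hψ w
  have h2 : (LocalizedModule.mk w 1 : LocalizedModule.AtPrime P W) =
      (algebraMap R (Localization.AtPrime P) t) • LocalizedModule.mk w t := by
    rw [algebraMap_smul, LocalizedModule.smul'_mk]
    exact (LocalizedModule.mk_cancel t w).symm
  rw [h2, map_smul, hy, smul_eq_mul, mul_one, Algebra.smul_def, ← map_mul] at h1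
  have h3 : (s : R) * t ∈ P := by
    rw [← IsLocalization.AtPrime.to_map_mem_maximal_iff (Localization.AtPrime P) P, ← h1,
      IsLocalization.AtPrime.to_map_mem_maximal_iff _ P]
    exact hc
  exact (s * t).2 h3

theorem exists_notMem_forall_ne_mem [Finite (minimalPrimes R)] (P : minimalPrimes R) :
    ∃ c ∉ P.1, ∀ P' : minimalPrimes R, P' ≠ P → c ∈ P'.1 := by
  classical
  have := Fintype.ofFinite (minimalPrimes R)
  have h : ∀ P' : minimalPrimes R, ∃ c ∉ P.1, P' ≠ P → c ∈ P'.1 := fun P' => by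
    by_cases hne : P' = P
    · exact ⟨1, fun h => P.2.1.1.ne_top ((Ideal.eq_top_iff_one _).2 h), fun h => absurd hne h⟩
    · have : ¬ P'.1 ≤ P.1 := fun h =>
        hne (Subtype.ext (le_antisymm h (P.2.2 ⟨P'.2.1.1, bot_le⟩ h)))
      obtain ⟨c, hc, hcP⟩ := SetLike.not_le_iff_exists.1 this
      exact ⟨c, hcP, fun _ => hc⟩
  choose c hc hc' using h
  refine ⟨∏ P', c P', fun hp => ?_, fun P' hP' => ?_⟩
  · obtain ⟨P', -, hP'⟩ := (Ideal.IsPrime.prod_mem_iff).1 hp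
    exact hc P' hP'
  · exact Ideal.mem_of_dvd _ (Finset.dvd_prod_of_mem c (Finset.mem_univ P')) (hc' P' hP')

/-- Weight each local map by an element outside its own prime but inside all other minimal primes;
modulo `P` only the summand of `P` survives. -/
theorem exists_injective_linearMap_of_forall_minimalPrimes [IsNoetherianRing R] {W : Type*}
    [AddCommGroup W] [Module R W] (hass : ∀ P ∈ associatedPrimes R W, P ∈ minimalPrimes R)
    (hlen : ∀ (P : Ideal R) [P.IsPrime], P ∈ minimalPrimes R → localLength P W = localLength P R)
    (h : ∀ P ∈ minimalPrimes R, ∃ (ψ : W →ₗ[R] R) (w : W), ψ w ∉ P) :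
    ∃ φ : W →ₗ[R] R, Function.Injective φ := by
  classical
  have : Finite (minimalPrimes R) := minimalPrimes.finite_of_isNoetherianRing R
  have := Fintype.ofFinite (minimalPrimes R)
  choose ψ w hψ using fun P : minimalPrimes R => h P.1 P.2
  choose c hc hc' using fun P : minimalPrimes R => exists_notMem_forall_ne_mem P
  refine ⟨∑ P, c P • ψ P, LinearMap.injective_of_localLength_eq hass hlen _
    fun P hP => ⟨w ⟨P, hP⟩, fun hm => ?_⟩⟩
  rw [LinearMap.sum_apply, ← Finset.add_sum_erase _ _ (Finset.mem_univ (⟨P, hP⟩ : minimalPrimes R)),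
    Ideal.add_mem_iff_left] at hm
  · exact (hP.1.1.mem_or_mem hm).elim (hc ⟨P, hP⟩) (hψ ⟨P, hP⟩)
  · refine Ideal.sum_mem _ fun P' hP' => Ideal.mul_mem_right _ _ ?_
    exact hc' P' ⟨P, hP⟩ (Finset.ne_of_mem_erase hP').symm

/-- Prime avoidance: the zero divisors are the union of the associated primes, all minimal here. -/
theorem exists_mem_nonZeroDivisors_of_isUnmixedRing [IsNoetherianRing R] (h : IsUnmixedRing R)
    {I : Ideal R} (hI : ∀ P ∈ minimalPrimes R, ¬ I ≤ P) : ∃ x ∈ I, x ∈ nonZeroDivisors R := by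
  by_contra hc
  push Not at hc
  obtain ⟨P, hP, hIP⟩ : ∃ P ∈ associatedPrimes R R, I ≤ P :=
    (I.subset_union_prime_finite (associatedPrimes.finite ..) (f := id) 0 0 fun _ h _ _ ↦ h.1).1 <| by
    simp_rw [id, biUnion_associatedPrimes_eq_compl_nonZeroDivisors]
    exact fun x hx => hc x hx
  exact hI P (h P hP) hIP

end LocalizedCanonical

/-! ### Canonical modules at the minimal primes, and the theorem -/

section CanonicalModule

open IsLocalRing

variable {R : Type u} [CommRing R] [IsNoetherianRing R] [IsLocalRing R]

/-- The local structure of a canonical module at the minimal primes. -/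
structure IsGenericallyCanonical (W : Type v) [AddCommGroup W] [Module R W] : Prop where
  associatedPrimes_subset : ∀ P ∈ associatedPrimes R W, P ∈ minimalPrimes R
  length_hom_le : ∀ (P : Ideal R) [P.IsPrime], P ∈ minimalPrimes R →
    Module.length (Localization.AtPrime P) (ResidueField (Localization.AtPrime P)
      →ₗ[Localization.AtPrime P] LocalizedModule.AtPrime P W) ≤ 1
  localLength_eq : ∀ (P : Ideal R) [P.IsPrime], P ∈ minimalPrimes R →
    localLength P W = localLength P R

theorem isGenericallyCanonical_of_dual_equiv {d : ℕ} (hdim : ringKrullDim R = d)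
    (hequi : IsEquidimensionalRing R) {E : Type u} [AddCommGroup E] [Module R E]
    {f : ResidueField R →ₗ[R] E} (hf : IsInjectiveHull f) {W : Type u} [AddCommGroup W]
    [Module R W] [Module.Finite R W]
    (h : Nonempty ((W →ₗ[R] E) ≃ₗ[R] LocCoh (maximalIdeal R) d R)) :
    IsGenericallyCanonical (R := R) W := by
  classical
  obtain ⟨l, hl, rfl, hR⟩ := exists_list_length_eq_of_ringKrullDim_eq hdim
  have : Finite (minimalPrimes R) := minimalPrimes.finite_of_isNoetherianRing R
  have := Fintype.ofFinite (minimalPrimes R)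
  have hp : ∀ (N : Type u) [AddCommGroup N] [Module R N], IsParamSeq l N := fun N _ _ =>
    hR.trans (Ideal.radical_mono le_sup_left)
  have hpos : ∀ P : minimalPrimes R, 0 < koszulMult l (R ⧸ P.1) := fun P =>
    koszulMult_quotient_pos hl (by rw [hequi P.1 P.2, hdim]) (hp _)
  -- The `P`-torsion vanishes at the other minimal primes, so associativity reduces to one term, and
  -- cancelling `e(R/P) > 0` leaves length one.
  have hone : ∀ P : minimalPrimes R, localLength P.1 (Submodule.torsionBySet R W P.1) = 1 := by
    intro P
    have h1 := koszulMult_eq_sum hl hR (Submodule.torsionBySet R W P.1)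
    rw [koszulMult_torsionBySet hl hR hf h, Finset.sum_eq_single P] at h1
    · have h2 : ((localLength P.1 (Submodule.torsionBySet R W P.1)).toNat : ℤ) = 1 :=
        (mul_right_cancel₀ (hpos P).ne' ((one_mul _).trans h1)).symm
      rw [← ENat.natCast_toNat (localLength_ne_top P.2 (Submodule.torsionBySet R W P.1))]
      exact_mod_cast h2
    · intro P' _ hP'
      have hle : ¬ P.1 ≤ P'.1 := fun h =>
        hP' (Subtype.ext (le_antisymm (P'.2.2 ⟨P.2.1.1, bot_le⟩ h) h))
      obtain ⟨r, hr, hr'⟩ := SetLike.not_le_iff_exists.1 hle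
      rw [localLength_eq_zero_of_smul P'.1 hr' fun m => Subtype.ext
        ((Submodule.mem_torsionBySet_iff _ _).1 m.2 ⟨r, hr⟩)]
      simp
    · exact fun h => absurd (Finset.mem_univ _) h
  have hhom : ∀ (P : Ideal R) [P.IsPrime], P ∈ minimalPrimes R →
      Module.length (Localization.AtPrime P) (ResidueField (Localization.AtPrime P)
        →ₗ[Localization.AtPrime P] LocalizedModule.AtPrime P W) ≤ 1 := fun P _ hP =>
    (length_hom_residueField_localizedModule_le P W).trans (hone ⟨P, hP⟩).le
  have hle : ∀ P : minimalPrimes R, (localLength P.1 W).toNat ≤ (localLength P.1 R).toNat :=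
    fun P => by
      have := isArtinianRing_localization_of_mem_minimalPrimes P.2
      refine ENat.toNat_le_toNat ?_ (localLength_ne_top P.2 R)
      rw [localLength_self]
      exact length_le_of_length_hom_residueField_le_one (hhom P.1 P.2)
  refine ⟨fun Q hQ => mem_minimalPrimes_of_mem_associatedPrimes_of_dual hl hR hf h hdim hQ, hhom,
    fun P _ hP => ?_⟩
  have h1 : koszulMult l W = koszulMult l R := koszulMult_eq_of_nonempty_dual_equiv hl hR hf h
  -- Two equal sums compared termwise, with strictly positive weights, force equality of every local
  -- length.
  rw [koszulMult_eq_sum hl hR W, koszulMult_eq_sum hl hR R, Finset.sum_eq_sum_iff_of_le] at h1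
  · have h2 := mul_right_cancel₀ (hpos ⟨P, hP⟩).ne' (h1 ⟨P, hP⟩ (Finset.mem_univ _))
    rw [← ENat.natCast_toNat (localLength_ne_top hP W), ← ENat.natCast_toNat (localLength_ne_top hP R)]
    exact_mod_cast h2
  · intro P _
    exact mul_le_mul_of_nonneg_right (by exact_mod_cast hle P) (hpos P).le

theorem IsGenericallyCanonical.congr {W : Type*} [AddCommGroup W] [Module R W] {W' : Type*}
    [AddCommGroup W'] [Module R W'] (h : IsGenericallyCanonical (R := R) W) (e : W ≃ₗ[R] W') :
    IsGenericallyCanonical (R := R) W' where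
  associatedPrimes_subset := by
    rw [← LinearEquiv.AssociatedPrimes.eq e]
    exact h.associatedPrimes_subset
  length_hom_le P _ hP := by
    have e' := (IsLocalizedModule.mapEquiv P.primeCompl (LocalizedModule.mkLinearMap P.primeCompl W)
      (LocalizedModule.mkLinearMap P.primeCompl W') (Localization.AtPrime P) e)
    rw [← ((LinearEquiv.refl _ _).arrowCongr e').length_eq]
    exact h.length_hom_le P hP
  localLength_eq P _ hP := by
    rw [← _root_.localLength_eq P e]
    exact h.localLength_eq P hP

theorem IsCanonicalModule.isGenericallyCanonical (hequi : IsEquidimensionalRing R)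
    {ω : Type v} [AddCommGroup ω] [Module R ω] (hω : IsCanonicalModule R ω) :
    IsGenericallyCanonical (R := R) ω := by
  obtain ⟨hfin, d, E, f, hdim, hf, ⟨e⟩⟩ := hω
  -- Writing ω as a quotient of `R^n` replaces it by a module in the universe of `R`, where local
  -- cohomology is defined.
  obtain ⟨n, g, hg⟩ := Module.Finite.exists_fin' R ω
  have e' := g.quotKerEquivOfSurjective hg
  refine (isGenericallyCanonical_of_dual_equiv hdim hequi hf ⟨?_⟩).congr e'
  exact (LinearEquiv.congrLeft E R e').trans e

/-- The inclusion of `I` localizes to an injection between modules of equal finite length, hence an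
isomorphism. This gives `I_P = R_P`, and the length criterion for injectivity carries over to `R_P`.
-/
theorem IsGenericallyCanonical.not_le_and_baer {I : Ideal R}
    (h : IsGenericallyCanonical (R := R) I) {P : Ideal R} [P.IsPrime] (hP : P ∈ minimalPrimes R) :
    ¬ I ≤ P ∧ Module.Baer (Localization.AtPrime P) (Localization.AtPrime P) := by
  have := isArtinianRing_localization_of_mem_minimalPrimes hP
  have hlen := h.localLength_eq P hP
  let φ := LocalizedModule.map P.primeCompl (Submodule.subtype I)
  have hinj : Function.Injective φ := LocalizedModule.map_injective _ _ (Submodule.injective_subtype _)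
  have hsurj := φ.surjective_of_injective_of_length_eq hinj hlen (localLength_ne_top hP I)
  constructor
  · intro hle
    obtain ⟨y, hy⟩ := hsurj (LocalizedModule.mk 1 1)
    induction y using LocalizedModule.induction_on with | _ a s => ?_
    rw [LocalizedModule.map_mk, LocalizedModule.mk_eq] at hy
    obtain ⟨u, hu⟩ := hy
    have h1 : (u : R) * a = u * s := by simpa [Submonoid.smul_def] using hu
    exact (u * s).2 (show (u : R) * s ∈ P from h1 ▸ P.mul_mem_left _ (hle a.2))
  · have hb := baer_of_length_eq (h.length_hom_le P hP) (hlen.trans (localLength_self P))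
    exact hb.of_equiv ((LinearEquiv.ofBijective φ ⟨hinj, hsurj⟩).trans (localizedModuleSelfEquiv P))

end CanonicalModule

theorem proposition2p4 {R : Type u} [CommRing R] [IsNoetherianRing R] [IsLocalRing R]
    (hequi : IsEquidimensionalRing R) (hunm : IsUnmixedRing R)
    {ω : Type v} [AddCommGroup ω] [Module R ω] (hω : IsCanonicalModule R ω) :
    ((∃ I : Ideal R, Nonempty (I ≃ₗ[R] ω)) ↔ IsGenericallyGorenstein R) ∧
      ∀ I : Ideal R, Nonempty (I ≃ₗ[R] ω) → ∃ x ∈ I, x ∈ nonZeroDivisors R := by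
  have hgc := hω.isGenericallyCanonical hequi
  have := hω.1
  refine ⟨⟨?_, fun hG => ?_⟩, ?_⟩
  · rintro ⟨I, ⟨e⟩⟩ P _ hP
    refine ⟨IsLocalization.isNoetherianRing P.primeCompl _ ‹_›, inferInstance, 0, ?_⟩
    exact hasInjectiveDimensionLE_zero_of_baer ((hgc.congr e.symm).not_le_and_baer hP).2
  · obtain ⟨φ, hφ⟩ := exists_injective_linearMap_of_forall_minimalPrimes
      hgc.associatedPrimes_subset hgc.localLength_eq fun P hP => by
        have := hP.1.1
        have := isArtinianRing_localization_of_mem_minimalPrimes hP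
        obtain ⟨-, -, n, hn⟩ := hG P hP
        exact exists_linearMap_apply_notMem hP (hgc.localLength_eq P hP) (hgc.length_hom_le P hP)
          (baer_self_of_hasInjectiveDimensionLE n hn)
    exact ⟨LinearMap.range φ, ⟨(LinearEquiv.ofInjective φ hφ).symm⟩⟩
  · rintro I ⟨e⟩
    refine exists_mem_nonZeroDivisors_of_isUnmixedRing hunm fun P hP => ?_
    have := hP.1.1
    exact ((hgc.congr e.symm).not_le_and_baer hP).1
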